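/- Let $\mathcal O_n$ be the ring of germs at $0\in\mathbb C^n$ of holomorphic functions. For $g=(g_1,\dots,g_s)\in\mathcal O_n^s$ let $D(g)\subseteq\mathcal O_n^s$ be the submodule generated by $\frac{\partial g}{\partial x_1},\dots,\frac{\partial g}{\partial x_n}$. For an ideal $J$ of $\mathcal O_n$ write $J^{\oplus s}=J\oplus\cdots\oplus J\subseteq\mathcal O_n^s$. The colength of a submodule $M\subseteq\mathcal O_n^s$ is $\dim_{\mathbb C}\mathcal O_n^s/M$. For a germ $X$ at $0$ of an analytic subset of $\mathbb C^n$, let $I(X)\subseteq\mathcal O_n$ be the ideal of germs vanishing on $X$, let $\Theta_X$ be the module of those $\delta=(\delta_1,\dots,\delta_n)\in\mathcal O_n^n=\mathrm{Der}(\mathcal O_n)$ with $\delta(I(X))\subseteq I(X)$, where $\delta(g)=\sum_j\delta_j\frac{\partial g}{\partial x_j}$, and for $f\in\mathcal O_n$ let $J_X(f)$ be the ideal generated by $\{\delta(f):\delta\in\Theta_X\}$. Put $$\mu_X(f)=\dim_{\mathbb C}\frac{\mathcal O_n}{J_X(f)},\quad \tau_X(f)=\dim_{\mathbb C}\frac{\mathcal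 O_n}{J_X(f)+\langle f\rangle},\quad \mu_X^-(f)=\dim_{\mathbb C}\frac{\mathcal O_n}{J_X(f)+I(X)},\quad \tau_X^-(f)=\dim_{\mathbb C}\frac{\mathcal O_n}{J_X(f)+\langle f\rangle+I(X)}.$$ A germ of holomorphic map $h=(h_1,\dots,h_p):(\mathbb C^n,0)\to(\mathbb C^p,0)$ with $p\le n$ is an isolated complete intersection singularity (ICIS) if $\dim h^{-1}(0)=n-p$ and the ideal generated by $h_1,\dots,h_p$ and by the maximal minors of the Jacobian matrix of $h$ has finite colength in $\mathcal O_n$. Its Tjurina number is $\tau(h)=\dim_{\mathbb C}\mathcal O_n^p/(D(h)+\langle h_1,\dots,h_p\rangle\mathcal O_n^p)$. **Corollary 2.9.** Let $h:(\mathbb C^n,0)\to(\mathbb C^p,0)$ be an ICIS with $n-p\ge 1$, let $I=\langle h_1,\dots,h_p\rangle$ and $X=h^{-1}(0)$, and let $f\in\mathcal O_n$. Then $\mu_X(f)<\infty$ if and only if the submodule $D(f,h)+(0\oplus I^{\oplus p})$ has finite colength in $\mathcal O_n^{p+1}$. Moreover, in this case $\tau(h)$, $\tau_X(f)$, $\mu_X^-(f)$,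 $\tau_X^-(f)$ are finite and $$\mu_X(f)=\dim_{\mathbb C}\frac{\mathcal O_n^{p+1}}{D(f,h)+(0\oplus I^{\oplus p})}-\tau(h),\qquad \tau_X(f)=\dim_{\mathbb C}\frac{\mathcal O_n^{p+1}}{D(f,h)+(\langle f\rangle\oplus I^{\oplus p})}-\tau(h),$$ $$\mu_X^-(f)=\dim_{\mathbb C}\frac{\mathcal O_n^{p+1}}{D(f,h)+I^{\oplus(p+1)}}-\tau(h),\qquad \tau_X^-(f)=\dim_{\mathbb C}\frac{\mathcal O_n^{p+1}}{D(f,h)+\big((\langle f\rangle+I)\oplus I^{\oplus p}\big)}-\tau(h).$$ In particular, $$\mu_X(f)-\tau_X(f)=\dim_{\mathbb C}\frac{D(f,h)+(\langle f\rangle\oplus I^{\oplus p})}{D(f,h)+(0\oplus I^{\oplus p})},\qquad \mu_X^-(f)-\tau_X^-(f)=\dim_{\mathbb C}\frac{D(f,h)+\big((\langle f\rangle+I)\oplus I^{\oplus p}\big)}{D(f,h)+I^{\oplus(p+1)}}.$$ -/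

import Mathlib

open Filter Topology

noncomputable section

namespace BruceRoberts

/-- The `ℂ`-algebra structure (constants) on the ring of germs at `0` of all functions `ℂⁿ → ℂ`;
the scalar action is the one that Mathlib already has. -/
instance germAlgebra (n : ℕ) : Algebra ℂ (Germ (𝓝 (0 : Fin n → ℂ)) ℂ) :=
  Algebra.ofModule
    (fun r x y => by
      induction x using Germ.inductionOn
      induction y using Germ.inductionOn
      rw [← Germ.coe_smul, ← Germ.coe_mul, ← Germ.coe_mul, ← Germ.coe_smul, smul_mul_assoc])
    (fun r x y => by
      induction x using Germ.inductionOn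
      induction y using Germ.inductionOn
      rw [← Germ.coe_smul, ← Germ.coe_mul, ← Germ.coe_mul, ← Germ.coe_smul, mul_smul_comm])

/-- The ring `𝒪ₙ` of germs at `0 ∈ ℂⁿ` of holomorphic functions, as a `ℂ`-subalgebra of the
ring of germs of all functions. -/
def holomorphicGerms (n : ℕ) : Subalgebra ℂ (Germ (𝓝 (0 : Fin n → ℂ)) ℂ) where
  carrier := {g | ∃ φ : (Fin n → ℂ) → ℂ, AnalyticAt ℂ φ 0 ∧ (φ : Germ (𝓝 (0 : Fin n → ℂ)) ℂ) = g}
  mul_mem' := by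
    rintro _ _ ⟨φ, hφ, rfl⟩ ⟨ψ, hψ, rfl⟩
    exact ⟨φ * ψ, hφ.mul hψ, Germ.coe_mul φ ψ⟩
  add_mem' := by
    rintro _ _ ⟨φ, hφ, rfl⟩ ⟨ψ, hψ, rfl⟩
    exact ⟨φ + ψ, hφ.add hψ, Germ.coe_add φ ψ⟩
  algebraMap_mem' := fun r => by
    refine ⟨r • (1 : (Fin n → ℂ) → ℂ), ?_, ?_⟩
    · exact (analyticAt_const (v := r • (1 : ℂ)))
    · rw [Algebra.algebraMap_eq_smul_one, Germ.coe_smul, Germ.coe_one]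

/-- `𝒪ₙ` as a type. -/
def O (n : ℕ) : Type := ↥(holomorphicGerms n)

instance (n : ℕ) : CommRing (O n) := inferInstanceAs (CommRing ↥(holomorphicGerms n))

instance (n : ℕ) : Algebra ℂ (O n) := inferInstanceAs (Algebra ℂ ↥(holomorphicGerms n))

variable {n : ℕ}

/-- The element of `𝒪ₙ` defined by a function which is holomorphic at `0`. -/
def O.mk (φ : (Fin n → ℂ) → ℂ) (hφ : AnalyticAt ℂ φ 0) : O n := ⟨(φ : Germ _ ℂ), φ, hφ, rfl⟩

/-- A function representing the germ `g`. All the constructions below depend only on the germ. -/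
def O.rep (g : O n) : (Fin n → ℂ) → ℂ := Classical.choose g.2

theorem O.rep_analyticAt (g : O n) : AnalyticAt ℂ g.rep 0 := (Classical.choose_spec g.2).1

theorem O.coe_rep (g : O n) : (g.rep : Germ (𝓝 (0 : Fin n → ℂ)) ℂ) = g.1 :=
  (Classical.choose_spec g.2).2

theorem O.rep_mk (φ : (Fin n → ℂ) → ℂ) (hφ : AnalyticAt ℂ φ 0) : (O.mk φ hφ).rep =ᶠ[𝓝 0] φ :=
  Germ.coe_eq.1 (O.coe_rep (O.mk φ hφ))

theorem O.rep_zero : (0 : O n).rep =ᶠ[𝓝 0] 0 := Germ.coe_eq.1 (O.coe_rep (0 : O n))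

theorem O.rep_add (a b : O n) : (a + b).rep =ᶠ[𝓝 0] a.rep + b.rep := by
  refine Germ.coe_eq.1 ?_
  rw [O.coe_rep, Germ.coe_add, O.coe_rep, O.coe_rep]; rfl

theorem O.rep_mul (a b : O n) : (a * b).rep =ᶠ[𝓝 0] a.rep * b.rep := by
  refine Germ.coe_eq.1 ?_
  rw [O.coe_rep, Germ.coe_mul, O.coe_rep, O.coe_rep]; rfl

/-- The partial derivative `∂g/∂xⱼ ∈ 𝒪ₙ`. -/
def pderiv (j : Fin n) (g : O n) : O n :=
  O.mk (fun x => fderiv ℂ g.rep x (Pi.single j 1))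
    (((ContinuousLinearMap.apply ℂ ℂ (Pi.single j (1 : ℂ) : Fin n → ℂ)).analyticAt _).comp
      g.rep_analyticAt.fderiv)

/-- The partial derivative may be computed on any representative. -/
theorem pderiv_mk (j : Fin n) (φ : (Fin n → ℂ) → ℂ) (hφ : AnalyticAt ℂ φ 0) :
    (pderiv j (O.mk φ hφ)).rep =ᶠ[𝓝 0] fun x => fderiv ℂ φ x (Pi.single j 1) := by
  refine (O.rep_mk _ _).trans ?_
  filter_upwards [(O.rep_mk φ hφ).fderiv (𝕜 := ℂ)] with x hx
  rw [hx]

/-- The value `δ(g) = ∑ⱼ δⱼ ∂g/∂xⱼ` of the derivation `δ ∈ Der(𝒪ₙ) = 𝒪ₙⁿ` at `g`. -/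
def der (δ : Fin n → O n) (g : O n) : O n := ∑ j, δ j * pderiv j g

/-! ### Zero sets, vanishing ideals, logarithmic derivations -/

/-- The zero set `h⁻¹(0)` of (representatives of) the germs `h₁, …, h_p`. Only its germ at `0`
matters below. -/
def zeroSet {p : ℕ} (h : Fin p → O n) : Set (Fin n → ℂ) := {x | ∀ i, (h i).rep x = 0}

/-- The ideal `I(X)` of the germs in `𝒪ₙ` that vanish on the germ of `X` at `0`. -/
def vanishingIdeal (X : Set (Fin n → ℂ)) : Ideal (O n) where
  carrier := {g | ∀ᶠ x in 𝓝 (0 : Fin n → ℂ), x ∈ X → g.rep x = 0}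
  zero_mem' := by
    filter_upwards [O.rep_zero (n := n)] with x hx _
    simpa using hx
  add_mem' := by
    intro a b ha hb
    filter_upwards [ha, hb, O.rep_add a b] with x h1 h2 h3 hX
    rw [h3, Pi.add_apply, h1 hX, h2 hX, add_zero]
  smul_mem' := by
    intro c a ha
    filter_upwards [ha, O.rep_mul c a] with x h1 h2 hX
    rw [smul_eq_mul, h2, Pi.mul_apply, h1 hX, mul_zero]

/-- The module `Θ_X` (also written `Derlog(X)`) of the derivations `δ` with
`δ(I(X)) ⊆ I(X)`. -/
def logDer (X : Set (Fin n → ℂ)) : Submodule (O n) (Fin n → O n) where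
  carrier := {δ | ∀ g ∈ vanishingIdeal X, der δ g ∈ vanishingIdeal X}
  zero_mem' := by
    intro g _
    simp [der]
  add_mem' := by
    intro a b ha hb g hg
    have : der (a + b) g = der a g + der b g := by
      simp [der, add_mul, Finset.sum_add_distrib]
    rw [this]
    exact add_mem (ha g hg) (hb g hg)
  smul_mem' := by
    intro c a ha g hg
    have : der (c • a) g = c * der a g := by
      simp [der, Finset.mul_sum, mul_assoc]
    rw [this]
    exact Ideal.mul_mem_left _ c (ha g hg)

/-- The logarithmic ideal `J_X(f)`, generated by the `δ(f)`, `δ ∈ Θ_X`. -/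
def logIdeal (X : Set (Fin n → ℂ)) (f : O n) : Ideal (O n) :=
  Ideal.span ((fun δ => der δ f) '' (logDer X : Set (Fin n → O n)))

/-! ### Dimensions over `ℂ` -/

/-- The dimension of a complex vector space, `⊤` when it is infinite. -/
def cdim (V : Type) [AddCommGroup V] [Module ℂ V] : ℕ∞ := Cardinal.toENat (Module.rank ℂ V)

/-- The colength `dim_ℂ (𝒪ₙˢ / M)` of a submodule `M` of `𝒪ₙˢ`; the submodule has finite colength
when this is not `⊤`. -/
def colength {s : ℕ} (M : Submodule (O n) (Fin s → O n)) : ℕ∞ := cdim ((Fin s → O n) ⧸ M)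

/-- The colength `dim_ℂ (𝒪ₙ / J)` of an ideal. -/
def idealColength (J : Ideal (O n)) : ℕ∞ := cdim (O n ⧸ J)

/-- The dimension `dim_ℂ (A / B)` for submodules `B ⊆ A` of `𝒪ₙˢ`. -/
def relDim {s : ℕ} (A B : Submodule (O n) (Fin s → O n)) : ℕ∞ := cdim (↥A ⧸ B.submoduleOf A)

/-- `μ_X(f)`, the Bruce-Roberts number. -/
def muX (X : Set (Fin n → ℂ)) (f : O n) : ℕ∞ := idealColength (logIdeal X f)

/-- `τ_X(f)`, the Bruce-Roberts Tjurina number. -/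
def tauX (X : Set (Fin n → ℂ)) (f : O n) : ℕ∞ := idealColength (logIdeal X f ⊔ Ideal.span {f})

/-- `μ_X⁻(f)`, the relative Bruce-Roberts number. -/
def muXrel (X : Set (Fin n → ℂ)) (f : O n) : ℕ∞ :=
  idealColength (logIdeal X f ⊔ vanishingIdeal X)

/-- `τ_X⁻(f)`, the relative Bruce-Roberts Tjurina number. -/
def tauXrel (X : Set (Fin n → ℂ)) (f : O n) : ℕ∞ :=
  idealColength (logIdeal X f ⊔ Ideal.span {f} ⊔ vanishingIdeal X)

/-! ### Jacobian modules and isolated complete intersection singularities -/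

/-- The Jacobian module `D(g) ⊆ 𝒪ₙˢ`, generated by `∂g/∂x₁, …, ∂g/∂xₙ`. -/
def jacobianModule {s : ℕ} (g : Fin s → O n) : Submodule (O n) (Fin s → O n) :=
  Submodule.span (O n) (Set.range fun (j : Fin n) (i : Fin s) => pderiv j (g i))

/-- The ideal `⟨h₁, …, h_p⟩` of `𝒪ₙ`. -/
def componentIdeal {p : ℕ} (h : Fin p → O n) : Ideal (O n) := Ideal.span (Set.range h)

/-- The ideal generated by the maximal (`p × p`) minors of the differential matrix of `h`. -/
def minorIdeal {p : ℕ} (h : Fin p → O n) : Ideal (O n) :=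
  Ideal.span (Set.range fun e : Fin p ↪o Fin n =>
    (Matrix.of fun i j : Fin p => pderiv (e j) (h i)).det)

/-- The map germ `h : (ℂⁿ, 0) → (ℂᵖ, 0)` is an isolated complete intersection singularity. The
dimension of the analytic germ `X = h⁻¹(0)` is the Krull dimension of its local ring
`𝒪ₙ / I(X)`. -/
structure IsICIS {p : ℕ} (h : Fin p → O n) : Prop where
  map_zero : ∀ i, (h i).rep 0 = 0
  le : p ≤ n
  dim_eq : ringKrullDim (O n ⧸ vanishingIdeal (zeroSet h)) = ((n - p : ℕ) : WithBot ℕ∞)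
  finite : idealColength (componentIdeal h ⊔ minorIdeal h) < ⊤

/-- The Tjurina number `τ(h) = dim_ℂ 𝒪ₙᵖ / (D(h) + ⟨h₁, …, h_p⟩ 𝒪ₙᵖ)`. -/
def tjurina {p : ℕ} (h : Fin p → O n) : ℕ∞ :=
  colength (jacobianModule h ⊔
    componentIdeal h • (⊤ : Submodule (O n) (Fin p → O n)))

/-- `I^{⊕p} ⊆ 𝒪ₙᵖ`. -/
def idealPow (I : Ideal (O n)) (p : ℕ) : Submodule (O n) (Fin p → O n) :=
  Submodule.pi Set.univ fun _ => I

/-- `N ⊕ M ⊆ 𝒪ₙ ⊕ 𝒪ₙᵖ = 𝒪ₙᵖ⁺¹`, for an ideal `N` of `𝒪ₙ` and a submodule `M` of `𝒪ₙᵖ`. -/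
def directSum {p : ℕ} (N : Ideal (O n)) (M : Submodule (O n) (Fin p → O n)) :
    Submodule (O n) (Fin (p + 1) → O n) :=
  Submodule.comap (LinearMap.proj (R := O n) (φ := fun _ : Fin (p + 1) => O n) 0) N ⊓
    Submodule.comap (LinearMap.funLeft (O n) (O n) Fin.succ) M

/-- `D(f, h) + (N ⊕ I^{⊕p}) ⊆ 𝒪ₙᵖ⁺¹`, where `I = ⟨h₁, …, h_p⟩`. -/
def pairModule {p : ℕ} (f : O n) (h : Fin p → O n) (N : Ideal (O n)) :
    Submodule (O n) (Fin (p + 1) → O n) :=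
  jacobianModule (Fin.cons f h : Fin (p + 1) → O n) ⊔
    directSum N (idealPow (componentIdeal h) p)

end BruceRoberts

end

/-! Let N be an ideal and M = D(f,h) + (N ⊕ I^p). The colength of M is the colength of its
intersection with the first summand plus the colength of its projection to 𝒪ₙᵖ. The projection is
D(h) + I𝒪ₙᵖ, whatever f and N are, and contributes τ(h). An element of the intersection is δ(f) + u
with u in N and all δ(hᵢ) in I. If I(X) = I, these δ are exactly those of Θ_X, so the intersection
is J_X(f) + N. The choices N = 0, ⟨f⟩, I, ⟨f⟩ + I give the four formulas
(`IsICIS.idealColength_add_tjurina`). Cramer's rule shows that τ(h) is finite, so it cancels.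

The real work is I(X) = I (`IsICIS.vanishingIdeal_eq`), which needs the Nullstellensatz and the fact
that I is radical.

Analytic input: uniform limits of polynomials on a polydisc form a Banach algebra with bounded
division by a coordinate. Neumann series then give division by perturbations of xᵢ^N. This yields
finiteness of 𝒪ₙ/Q over 𝒪ₘ (`exists_eq_sum_comp`), hence Noetherianity, and, with the Gelfand theory
of the algebra, the Nullstellensatz (`frequently_ne_zero`, `vanishingIdeal_le_radical`).

Radicality: 𝒪ₙ has depth n, so 𝒪ₙ/I has depth d = n - p, and every associated prime has dimension at
least d. Since d ≥ 1, the maximal ideal is not associated, so some maximal minor avoids each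
associated prime. Generic linear forms make 𝒪ₙ/I finite and torsion-free over 𝒪_d, and complete the
Jacobian matrix of h to one whose determinant is a nonzerodivisor. This determinant annihilates the
differentials of 𝒪ₙ/I over 𝒪_d. Hence the total ring of fractions is unramified over the field Frac
𝒪_d, so it is reduced, and so is its subring 𝒪ₙ/I. -/

noncomputable section

set_option linter.unusedSectionVars false

/-! ### The polydisc algebra: division by coordinates, characters, division with remainder. -/

namespace Polydisc

variable {ι : Type} [Fintype ι] [DecidableEq ι] {r : ι → ℝ}

/-- The closed polydisc with centre `0` and polyradius `r`. -/
def polydisc (r : ι → ℝ) : Set (ι → ℂ) := {x | ∀ i, ‖x i‖ ≤ r i}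

theorem isCompact_polydisc (r : ι → ℝ) : IsCompact (polydisc r) := by
  have : polydisc r = Set.pi Set.univ fun i => Metric.closedBall (0 : ℂ) (r i) := by
    ext x; simp [polydisc]
  rw [this]
  exact isCompact_univ_pi fun i => isCompact_closedBall _ _

instance : CompactSpace (polydisc r) := isCompact_iff_compactSpace.1 (isCompact_polydisc r)

theorem update_mem {x : ι → ℂ} (hx : x ∈ polydisc r) {i : ι} {z : ℂ} (hz : ‖z‖ ≤ r i) :
    Function.update x i z ∈ polydisc r := by
  intro j
  rcases eq_or_ne j i with rfl | h
  · simpa using hz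
  · simpa [h] using hx j

theorem polydisc_mem_nhds (hr : ∀ i, 0 < r i) : polydisc r ∈ 𝓝 (0 : ι → ℂ) := by
  have : polydisc r = Set.pi Set.univ fun i => Metric.closedBall (0 : ℂ) (r i) := by
    ext x; simp [polydisc]
  rw [this]
  exact set_pi_mem_nhds Set.finite_univ fun i _ => Metric.closedBall_mem_nhds _ (hr i)

/-- Polynomials as continuous functions on the polydisc. -/
def polyFun (r : ι → ℝ) : MvPolynomial ι ℂ →ₐ[ℂ] C(polydisc r, ℂ) :=
  MvPolynomial.aeval fun i => ⟨fun x => x.1 i, (continuous_apply i).comp continuous_subtype_val⟩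

/-- The polydisc algebra: the uniform limits of polynomials on the polydisc. -/
def polyAlg (r : ι → ℝ) : Subalgebra ℂ C(polydisc r, ℂ) := (polyFun r).range.topologicalClosure

/-- The polydisc algebra as a type. -/
def PAlg (r : ι → ℝ) : Type := ↥(polyAlg r)

instance : NormedCommRing (PAlg r) := inferInstanceAs (NormedCommRing ↥(polyAlg r))

instance : NormedAlgebra ℂ (PAlg r) := inferInstanceAs (NormedAlgebra ℂ ↥(polyAlg r))

instance : CompleteSpace (PAlg r) :=
  (Subalgebra.isClosed_topologicalClosure (polyFun r).range).completeSpace_coe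


/-- Polynomials as elements of the polydisc algebra. -/
def poly (r : ι → ℝ) : MvPolynomial ι ℂ →ₐ[ℂ] PAlg r :=
  (polyFun r).codRestrict _ fun p => Subalgebra.le_topologicalClosure _ ⟨p, rfl⟩

/-- Closed conditions on the algebra are checked on polynomials and extended by density. -/
theorem denseRange_poly : DenseRange (poly r) := by
  intro w
  have h := w.2
  rw [Metric.mem_closure_iff]
  intro ε hε
  have h' : w.1 ∈ closure ((polyFun r).range : Set C(polydisc r, ℂ)) := h
  obtain ⟨_, ⟨p, rfl⟩, hp⟩ := Metric.mem_closure_iff.1 h' ε hε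
  exact ⟨poly r p, ⟨p, rfl⟩, hp⟩

/-- The value of an element of the polydisc algebra, extended by `0`. -/
def val (w : PAlg r) (x : ι → ℂ) : ℂ := by
  classical exact if h : x ∈ polydisc r then w.1 ⟨x, h⟩ else 0

theorem val_eq (w : PAlg r) {x : ι → ℂ} (h : x ∈ polydisc r) : val w x = w.1 ⟨x, h⟩ := by
  simp [val, h]

theorem ext_val {v w : PAlg r} (h : ∀ x ∈ polydisc r, val v x = val w x) : v = w := by
  apply Subtype.ext
  ext x
  have := h x.1 x.2
  rwa [val_eq _ x.2, val_eq _ x.2] at this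

/-- Evaluation at a point of the polydisc. -/
def evalAt {x : ι → ℂ} (h : x ∈ polydisc r) : PAlg r →ₐ[ℂ] ℂ :=
  (ContinuousMap.evalAlgHom ℂ ℂ (⟨x, h⟩ : polydisc r)).comp (polyAlg r).val

theorem evalAt_apply {x : ι → ℂ} (h : x ∈ polydisc r) (w : PAlg r) : evalAt h w = val w x := by
  rw [val_eq _ h]; rfl

theorem val_add (v w : PAlg r) (x : ι → ℂ) : val (v + w) x = val v x + val w x := by
  unfold val
  split_ifs
  · rfl
  · simp

theorem val_sub (v w : PAlg r) (x : ι → ℂ) : val (v - w) x = val v x - val w x := by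
  unfold val
  split_ifs
  · rfl
  · simp

theorem val_mul (v w : PAlg r) (x : ι → ℂ) : val (v * w) x = val v x * val w x := by
  unfold val
  split_ifs
  · rfl
  · simp

theorem val_smul (c : ℂ) (w : PAlg r) (x : ι → ℂ) : val (c • w) x = c * val w x := by
  unfold val
  split_ifs
  · rfl
  · simp

theorem val_zero (x : ι → ℂ) : val (0 : PAlg r) x = 0 := by
  unfold val; split_ifs <;> rfl

/-- Unlike for sums and products, the point must lie in the polydisc, because values outside are set
to 0. -/
theorem val_one {x : ι → ℂ} (h : x ∈ polydisc r) : val (1 : PAlg r) x = 1 := by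
  rw [val_eq _ h]; rfl

theorem val_sum {κ : Type*} (s : Finset κ) (w : κ → PAlg r) (x : ι → ℂ) :
    val (∑ k ∈ s, w k) x = ∑ k ∈ s, val (w k) x := by
  classical
  induction s using Finset.induction_on with
  | empty => rw [Finset.sum_empty, Finset.sum_empty, val_zero]
  | insert a s ha ih => rw [Finset.sum_insert ha, Finset.sum_insert ha, val_add, ih]

theorem val_pow (w : PAlg r) (k : ℕ) {x : ι → ℂ} (h : x ∈ polydisc r) :
    val (w ^ k) x = val w x ^ k := by
  simp only [← evalAt_apply h, map_pow]

theorem norm_val_le (w : PAlg r) (x : ι → ℂ) : ‖val w x‖ ≤ ‖w‖ := by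
  by_cases h : x ∈ polydisc r
  · rw [val_eq _ h]; exact w.1.norm_coe_le_norm _
  · rw [val, dif_neg h, norm_zero]; exact norm_nonneg w

theorem norm_le_of_val {w : PAlg r} {C : ℝ} (hC : 0 ≤ C)
    (h : ∀ x ∈ polydisc r, ‖val w x‖ ≤ C) : ‖w‖ ≤ C := by
  refine (ContinuousMap.norm_le w.1 hC).2 fun x => ?_
  have := h x.1 x.2
  rwa [val_eq _ x.2] at this

/-- The coordinate functions. -/
def coord (r : ι → ℝ) (i : ι) : PAlg r := poly r (MvPolynomial.X i)

theorem val_coord (i : ι) {x : ι → ℂ} (h : x ∈ polydisc r) : val (coord r i) x = x i := by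
  rw [val_eq _ h]
  change polyFun r (MvPolynomial.X i) ⟨x, h⟩ = x i
  rw [polyFun, MvPolynomial.aeval_X]
  rfl

theorem val_poly (p : MvPolynomial ι ℂ) {x : ι → ℂ} (h : x ∈ polydisc r) :
    val (poly r p) x = MvPolynomial.eval x p := by
  rw [← evalAt_apply h, ← MvPolynomial.coe_aeval_eq_eval]
  refine DFunLike.congr_fun (f := (evalAt h).comp (poly r)) (g := MvPolynomial.aeval x)
    (MvPolynomial.algHom_ext fun i => ?_) p
  rw [AlgHom.comp_apply, MvPolynomial.aeval_X]
  exact (evalAt_apply h _).trans (val_coord i h)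

theorem norm_coord_le (hr : ∀ i, 0 < r i) (i : ι) : ‖coord r i‖ ≤ r i :=
  norm_le_of_val (hr i).le fun x hx => by rw [val_coord i hx]; exact hx i

theorem differentiable_eval_update (p : MvPolynomial ι ℂ) (x : ι → ℂ) (i : ι) :
    Differentiable ℂ fun z : ℂ => MvPolynomial.eval (Function.update x i z) p := by
  have : (fun z : ℂ => MvPolynomial.eval (Function.update x i z) p) = fun z =>
      (MvPolynomial.aeval (fun j => if j = i then Polynomial.X else Polynomial.C (x j)) p
        : Polynomial ℂ).eval z := by
    ext z
    rw [← Polynomial.coe_aeval_eq_eval, ← MvPolynomial.coe_aeval_eq_eval]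
    refine DFunLike.congr_fun (f := MvPolynomial.aeval (Function.update x i z))
      (g := (Polynomial.aeval z).comp (MvPolynomial.aeval _))
      (MvPolynomial.algHom_ext fun j => ?_) p
    by_cases hj : j = i
    · subst hj; simp
    · simp [hj]
  rw [this]
  exact Polynomial.differentiable _

/-- The maximum principle in the `i`-th variable. -/
theorem mul_norm_le_norm_coord_mul (hr : ∀ i, 0 < r i) (i : ι) (w : PAlg r) :
    r i * ‖w‖ ≤ ‖coord r i * w‖ := by
  refine denseRange_poly.induction_on (p := fun w => r i * ‖w‖ ≤ ‖coord r i * w‖) w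
    (isClosed_le (by fun_prop) (by fun_prop)) fun p => ?_
  rw [← le_div_iff₀' (hr i)]
  set C := ‖coord r i * poly r p‖ / r i with hC
  refine norm_le_of_val (div_nonneg (norm_nonneg _) (hr i).le) fun x hx => ?_
  -- On the circle |z| = rᵢ the coordinate has modulus exactly rᵢ, so dividing by it costs exactly
  -- this factor.
  have hf : ∀ z ∈ frontier (Metric.ball (0 : ℂ) (r i)),
      ‖MvPolynomial.eval (Function.update x i z) p‖ ≤ C := by
    intro z hz
    rw [frontier_ball _ (hr i).ne', mem_sphere_zero_iff_norm] at hz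
    rw [hC, le_div_iff₀' (hr i)]
    have hm := update_mem hx (i := i) (z := z) hz.le
    have := norm_val_le (coord r i * poly r p) (Function.update x i z)
    rwa [val_mul, val_coord i hm, val_poly _ hm, norm_mul, Function.update_self, hz] at this
  have key := Complex.norm_le_of_forall_mem_frontier_norm_le Metric.isBounded_ball
    (differentiable_eval_update p x i).diffContOnCl hf (z := x i)
    (by rw [closure_ball _ (hr i).ne']; simpa using hx i)
  rw [val_poly _ hx]
  rwa [Function.update_eq_self] at key

/-- The substitution `x_i = 0` on polynomials. -/
def polyZeroAt (i : ι) : MvPolynomial ι ℂ →ₐ[ℂ] MvPolynomial ι ℂ :=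
  MvPolynomial.aeval fun j => if j = i then 0 else MvPolynomial.X j

/-- Modulo xᵢ, the identity and the substitution agree on the variables, hence on all polynomials.
-/
theorem X_dvd_sub_polyZeroAt (i : ι) (p : MvPolynomial ι ℂ) :
    MvPolynomial.X i ∣ p - polyZeroAt i p := by
  rw [← Ideal.mem_span_singleton, ← Ideal.Quotient.mk_eq_mk_iff_sub_mem]
  change Ideal.Quotient.mkₐ ℂ _ p = ((Ideal.Quotient.mkₐ ℂ _).comp (polyZeroAt i)) p
  congr 1
  apply MvPolynomial.algHom_ext
  intro j
  simp only [AlgHom.comp_apply, polyZeroAt, MvPolynomial.aeval_X]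
  split_ifs with h
  · subst h
    rw [map_zero]
    exact Ideal.Quotient.eq_zero_iff_mem.2 (Ideal.mem_span_singleton_self _)
  · rfl

/-- The substitution `x_i = 0` as a map of the polydisc. -/
def zeroMap (hr : ∀ i, 0 < r i) (i : ι) : C(polydisc r, polydisc r) :=
  ⟨fun x => ⟨Function.update x.1 i 0, update_mem x.2 (by simpa using (hr i).le)⟩, by fun_prop⟩

theorem eval_polyZeroAt (i : ι) (p : MvPolynomial ι ℂ) (x : ι → ℂ) :
    MvPolynomial.eval x (polyZeroAt i p) = MvPolynomial.eval (Function.update x i 0) p := by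
  rw [← MvPolynomial.coe_aeval_eq_eval, ← MvPolynomial.coe_aeval_eq_eval]
  refine DFunLike.congr_fun (f := (MvPolynomial.aeval x).comp (polyZeroAt i))
    (g := MvPolynomial.aeval (Function.update x i 0)) (MvPolynomial.algHom_ext fun j => ?_) p
  by_cases h : j = i
  · subst h; simp [polyZeroAt]
  · simp [polyZeroAt, h]

/-- The substitution `x_i = 0` on the polydisc algebra. -/
theorem exists_zeroAt (hr : ∀ i, 0 < r i) (i : ι) : ∃ S : PAlg r →L[ℂ] PAlg r,
    ∀ w, ∀ x ∈ polydisc r, val (S w) x = val w (Function.update x i 0) := by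
  let φ : C(polydisc r, ℂ) →ₐ[ℂ] C(polydisc r, ℂ) := ContinuousMap.compRightAlgHom ℂ ℂ (zeroMap hr i)
  have hφ : Continuous φ := ContinuousMap.continuous_precomp _
  have hmem : ∀ w ∈ polyAlg r, φ w ∈ polyAlg r := by
    intro w hw
    refine map_mem_closure (s := ((polyFun r).range : Set _)) (t := ((polyFun r).range : Set _)) hφ hw ?_
    rintro _ ⟨p, rfl⟩
    refine ⟨polyZeroAt i p, ?_⟩
    ext x
    have h1 := val_poly (r := r) (polyZeroAt i p) x.2
    have h2 := val_poly (r := r) p (zeroMap hr i x).2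
    rw [val_eq _ x.2] at h1
    rw [val_eq _ (zeroMap hr i x).2] at h2
    exact h1.trans ((eval_polyZeroAt i p x.1).trans h2.symm)
  let S : PAlg r →ₗ[ℂ] PAlg r := φ.toLinearMap.restrict (p := (polyAlg r).toSubmodule)
    (q := (polyAlg r).toSubmodule) hmem
  refine ⟨⟨S, ?_⟩, ?_⟩
  · exact Continuous.subtype_mk (hφ.comp continuous_subtype_val) _
  · intro w x hx
    rw [val_eq _ hx, val_eq _ (update_mem hx (by simpa using (hr i).le))]
    rfl

/-- The substitution `x_i = 0` on the polydisc algebra. -/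
def zeroAt (hr : ∀ i, 0 < r i) (i : ι) : PAlg r →L[ℂ] PAlg r := (exists_zeroAt hr i).choose

theorem val_zeroAt (hr : ∀ i, 0 < r i) (i : ι) (w : PAlg r) {x : ι → ℂ} (hx : x ∈ polydisc r) :
    val (zeroAt hr i w) x = val w (Function.update x i 0) :=
  (exists_zeroAt hr i).choose_spec w x hx

theorem norm_zeroAt_le (hr : ∀ i, 0 < r i) (i : ι) (w : PAlg r) : ‖zeroAt hr i w‖ ≤ ‖w‖ :=
  norm_le_of_val (norm_nonneg _) fun x hx => by
    rw [val_zeroAt hr i w hx]; exact norm_val_le _ _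

/-- By the maximum principle, multiplication by xᵢ is bounded below, so its range is closed. The
claim holds for polynomials and passes to limits. -/
theorem exists_coord_mul_eq (hr : ∀ i, 0 < r i) (i : ι) (w : PAlg r) :
    ∃ v, coord r i * v = w - zeroAt hr i w := by
  have hcl : IsClosed (Set.range fun v : PAlg r => coord r i * v) := by
    refine AntilipschitzWith.isClosed_range (K := ⟨(r i)⁻¹, (inv_pos.2 (hr i)).le⟩) (f := fun v : PAlg r => coord r i * v) ?_ ?_
    · refine AddMonoidHomClass.antilipschitz_of_bound (AddMonoidHom.mulLeft (coord r i)) fun v => ?_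
      have := mul_norm_le_norm_coord_mul hr i v
      change ‖v‖ ≤ (r i)⁻¹ * ‖coord r i * v‖
      rwa [← div_eq_inv_mul, le_div_iff₀' (hr i)]
    · exact (ContinuousLinearMap.mul ℂ (PAlg r) (coord r i)).uniformContinuous
  refine denseRange_poly.induction_on (p := fun w => w - zeroAt hr i w ∈ Set.range fun v : PAlg r => coord r i * v) w
    (hcl.preimage (by fun_prop)) fun p => ?_
  obtain ⟨q, hq⟩ := X_dvd_sub_polyZeroAt i p
  refine ⟨poly r q, ?_⟩
  change poly r _ * poly r q = _
  rw [← map_mul, ← hq, map_sub]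
  congr 1
  apply ext_val
  intro x hx
  rw [val_zeroAt hr i _ hx, val_poly _ hx, val_poly _ (update_mem hx (by simpa using (hr i).le)),
    eval_polyZeroAt]

theorem coord_mul_injective (hr : ∀ i, 0 < r i) (i : ι) {v w : PAlg r}
    (h : coord r i * v = coord r i * w) : v = w := by
  have := mul_norm_le_norm_coord_mul hr i (v - w)
  rw [mul_sub, h, sub_self, norm_zero] at this
  have h2 : ‖v - w‖ ≤ 0 := by
    by_contra hc
    push Not at hc
    nlinarith [hr i, mul_pos (hr i) hc]
  exact sub_eq_zero.1 (norm_le_zero_iff.1 h2)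

/-- The operator `w ↦ (w - w|_{x_i = 0}) / x_i`. -/
def divCoord (hr : ∀ i, 0 < r i) (i : ι) : PAlg r →L[ℂ] PAlg r :=
  LinearMap.mkContinuous
    { toFun := fun w => (exists_coord_mul_eq hr i w).choose
      map_add' := fun v w => by
        apply coord_mul_injective hr i
        rw [mul_add, (exists_coord_mul_eq hr i _).choose_spec, (exists_coord_mul_eq hr i _).choose_spec,
          (exists_coord_mul_eq hr i _).choose_spec, map_add]
        abel
      map_smul' := fun c w => by
        apply coord_mul_injective hr i
        rw [RingHom.id_apply, mul_smul_comm, (exists_coord_mul_eq hr i _).choose_spec,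
          (exists_coord_mul_eq hr i _).choose_spec, map_smul, smul_sub] }
    -- Subtracting the restriction to xᵢ = 0 at most doubles the norm, and dividing by xᵢ costs
    -- 1/rᵢ.
    (2 / r i) fun w => by
      have h1 := mul_norm_le_norm_coord_mul hr i (exists_coord_mul_eq hr i w).choose
      rw [(exists_coord_mul_eq hr i w).choose_spec] at h1
      have h2 := norm_sub_le w (zeroAt hr i w)
      have h3 := norm_zeroAt_le hr i w
      rw [div_mul_eq_mul_div, le_div_iff₀' (hr i)]
      exact h1.trans (by linarith)

theorem coord_mul_divCoord (hr : ∀ i, 0 < r i) (i : ι) (w : PAlg r) :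
    coord r i * divCoord hr i w = w - zeroAt hr i w :=
  (exists_coord_mul_eq hr i w).choose_spec

theorem norm_divCoord_le (hr : ∀ i, 0 < r i) (i : ι) : ‖divCoord hr i‖ ≤ 2 / r i :=
  LinearMap.mkContinuous_norm_le _ (by have := hr i; positivity) _

theorem zero_mem_polydisc (hr : ∀ i, 0 < r i) : (0 : ι → ℂ) ∈ polydisc r := fun i => by
  simpa using (hr i).le

/-- Translation in the variables of `s` acts on the polydisc algebra by operators that depend
analytically on the translation. -/
theorem exists_analytic_translation (hr : ∀ i, 0 < r i) (s : Finset ι) :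
    ∃ G : (ι → ℂ) → (PAlg r →L[ℂ] PAlg r), AnalyticAt ℂ G 0 ∧
      ∀ᶠ x in 𝓝 (0 : ι → ℂ), ∀ w, ∀ y ∈ polydisc r, (∀ i ∈ s, y i = 0) →
        val (G x w) y = val w (s.piecewise x y) := by
  induction s using Finset.induction_on with
  | empty => exact ⟨fun _ => 1, analyticAt_const, Eventually.of_forall fun x w y _ _ => by simp⟩
  | insert i s his ih =>
    obtain ⟨G, hG, hval⟩ := ih
    have han : AnalyticAt ℂ (fun x : ι → ℂ => x i • divCoord hr i) 0 :=
      (ContinuousLinearMap.analyticAt (ContinuousLinearMap.proj (R := ℂ) (φ := fun _ : ι => ℂ) i) 0).smul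
        analyticAt_const
    have hinv : AnalyticAt ℂ (fun x : ι → ℂ => Ring.inverse (1 - x i • divCoord hr i)) 0 := by
      have h1 := analyticAt_inverse_one_sub ℂ (PAlg r →L[ℂ] PAlg r)
      refine AnalyticAt.comp (g := fun a : PAlg r →L[ℂ] PAlg r => Ring.inverse (1 - a)) ?_ han
      rwa [show (0 : ι → ℂ) i • divCoord hr i = 0 from zero_smul ℂ (divCoord hr i)]
    refine ⟨fun x => G x * Ring.inverse (1 - x i • divCoord hr i), hG.mul hinv, ?_⟩
    have hlt : ∀ᶠ x in 𝓝 (0 : ι → ℂ), ‖x i • divCoord hr i‖ < 1 := by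
      have := han.continuousAt.norm
      refine this.eventually_lt continuousAt_const ?_
      rw [show (0 : ι → ℂ) i • divCoord hr i = 0 from zero_smul ℂ (divCoord hr i), norm_zero]
      exact one_pos
    filter_upwards [hval, hlt, polydisc_mem_nhds hr] with x hx hlt hxr w y hy hy0
    have hunit : IsUnit (1 - x i • divCoord hr i) := isUnit_one_sub_of_norm_lt_one hlt
    -- With D = `divCoord hr i`, the resolvent (1 - xᵢD)⁻¹ is a translation. At a point whose i-th
    -- coordinate is xᵢ, the term xᵢDw' equals w' minus its value at 0, so w = w' - xᵢDw' takes
    -- there the value of w' at coordinate 0.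
    set w' := Ring.inverse (1 - x i • divCoord hr i) w with hw'
    have hw : w = w' - x i • divCoord hr i w' := by
      have := Ring.mul_inverse_cancel _ hunit
      have h2 := congrArg (fun T : PAlg r →L[ℂ] PAlg r => T w) this
      simpa using h2.symm
    change val (G x w') y = _
    rw [hx w' y hy fun j hj => hy0 j (Finset.mem_insert_of_mem hj)]
    have hyx : s.piecewise x y ∈ polydisc r := by
      intro j
      by_cases hj : j ∈ s
      · simpa [hj] using hxr j
      · simpa [hj] using hy j
    have hz : Function.update (s.piecewise x y) i 0 = s.piecewise x y := by
      rw [Function.update_eq_self_iff, Finset.piecewise_eq_of_notMem _ _ _ his,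
        hy0 i (Finset.mem_insert_self _ _)]
    have hup : (insert i s).piecewise x y = Function.update (s.piecewise x y) i (x i) := by
      rw [Finset.piecewise_insert]
    have hm : Function.update (s.piecewise x y) i (x i) ∈ polydisc r := update_mem hyx (hxr i)
    have hd := congrArg (fun v => val v (Function.update (s.piecewise x y) i (x i)))
      (coord_mul_divCoord hr i w')
    simp only [val_mul, val_sub, val_coord i hm, val_zeroAt hr i _ hm, Function.update_self,
      Function.update_idem, hz] at hd
    rw [hup, hw, val_sub, val_smul, hd]
    ring

/-- Translating in all the variables and evaluating at 0 presents the value at x as a bounded linear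
functional of an operator that is analytic in x. -/
theorem analyticAt_val (hr : ∀ i, 0 < r i) (w : PAlg r) : AnalyticAt ℂ (val w) 0 := by
  obtain ⟨G, hG, hval⟩ := exists_analytic_translation hr Finset.univ
  let L : (PAlg r →L[ℂ] PAlg r) →L[ℂ] ℂ :=
    ((LinearMap.mkContinuous (evalAt (zero_mem_polydisc hr)).toLinearMap 1 fun w => by
      rw [one_mul]
      exact (congrArg norm (evalAt_apply _ w)).trans_le (norm_val_le w 0))).comp
      (ContinuousLinearMap.apply ℂ (PAlg r) w)
  have h := (L.analyticAt (G 0)).comp hG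
  refine h.congr ?_
  filter_upwards [hval] with x hx
  have := hx w 0 (zero_mem_polydisc hr) (by simp)
  rw [Finset.piecewise_univ] at this
  rw [← this]
  exact evalAt_apply _ _

theorem continuous_eval_mem (p : FormalMultilinearSeries ℂ (ι → ℂ) ℂ) (m : ℕ) :
    ∃ q : MvPolynomial ι ℂ, ∀ x, MvPolynomial.eval x q = p m fun _ => x := by
  refine ⟨∑ f : Fin m → ι, MvPolynomial.C (p m fun j => Pi.single (f j) 1) *
    ∏ j, MvPolynomial.X (f j), fun x => ?_⟩
  have hx : x = ∑ i, x i • (Pi.single i 1 : ι → ℂ) := by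
    ext j
    simp [Finset.sum_apply, Pi.single_apply]
  conv_rhs => rw [hx]
  have := (p m).map_sum (fun (_ : Fin m) (i : ι) => x i • (Pi.single i 1 : ι → ℂ))
  rw [this]
  simp only [map_sum, map_mul, map_prod, MvPolynomial.eval_C, MvPolynomial.eval_X]
  refine Finset.sum_congr rfl fun f _ => ?_
  rw [(p m).map_smul_univ, smul_eq_mul, mul_comm]

/-- A function that is analytic at `0` belongs to the polydisc algebra of every small polydisc. -/
theorem exists_val_eq_of_analyticAt {φ : (ι → ℂ) → ℂ} (hφ : AnalyticAt ℂ φ 0) :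
    ∃ ε > 0, ∀ r : ι → ℝ, (∀ i, r i ≤ ε) →
      ∃ w : PAlg r, ∀ x ∈ polydisc r, val w x = φ x := by
  obtain ⟨p, R, hp⟩ := hφ
  obtain ⟨ε', hε0, hεR⟩ := ENNReal.lt_iff_exists_nnreal_btwn.1 hp.r_pos
  have hε0' : (0 : ℝ) < ε' := by exact_mod_cast hε0
  have hu := hp.tendstoUniformlyOn' hεR
  -- Half the radius keeps the closed polydisc inside the open ball where the partial sums converge
  -- uniformly.
  refine ⟨ε' / 2, by positivity, fun r hr => ?_⟩
  have hsub : ∀ x ∈ polydisc r, x ∈ Metric.ball (0 : ι → ℂ) ε' := by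
    intro x hx
    rw [mem_ball_zero_iff]
    exact lt_of_le_of_lt ((pi_norm_le_iff_of_nonneg (by positivity)).2 fun i => (hx i).trans (hr i))
      (half_lt_self hε0')
  choose q hq using continuous_eval_mem p
  let u : ℕ → PAlg r := fun k => poly r (∑ m ∈ Finset.range k, q m)
  have huval : ∀ k, ∀ x ∈ polydisc r, val (u k) x = p.partialSum k x := by
    intro k x hx
    rw [val_poly _ hx, map_sum, FormalMultilinearSeries.partialSum]
    exact Finset.sum_congr rfl fun m _ => hq m x
  have hcont : ContinuousOn φ (polydisc r) := by
    refine (hu.continuousOn (Frequently.of_forall fun k => ?_)).mono hsub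
    have := p.partialSum_continuous k
    fun_prop
  let Φ : C(polydisc r, ℂ) := ⟨fun x => φ x.1, hcont.domRestrict⟩
  have hΦ : Φ ∈ polyAlg r := by
    refine (Subalgebra.isClosed_topologicalClosure _).mem_of_tendsto (b := atTop)
      (f := fun k => (u k).1) ?_ (Eventually.of_forall fun k => (u k).2)
    rw [ContinuousMap.tendsto_iff_tendstoUniformly, Metric.tendstoUniformly_iff]
    intro δ hδ
    rw [Metric.tendstoUniformlyOn_iff] at hu
    filter_upwards [hu δ hδ] with k hk x
    have := hk x.1 (hsub _ x.2)
    rw [sub_zero, ← huval k x.1 x.2, val_eq _ x.2] at this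
    exact this
  exact ⟨⟨Φ, hΦ⟩, fun x hx => val_eq (r := r) (⟨Φ, hΦ⟩ : PAlg r) hx⟩

/-- A proper ideal of the polydisc algebra has a zero in the polydisc. -/
theorem exists_zero_of_ne_top (hr : ∀ i, 0 < r i) {J : Ideal (PAlg r)} (hJ : J ≠ ⊤) :
    ∃ x ∈ polydisc r, ∀ w ∈ J, val w x = 0 := by
  obtain ⟨M, hM, hJM⟩ := J.exists_le_maximal hJ
  -- By Gelfand-Mazur a maximal ideal is the kernel of a character. The character does not increase
  -- norms, so its values on the coordinates form a point of the polydisc. By density of the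
  -- polynomials it is evaluation at that point.
  let χ := M.toCharacterSpace
  have hχ : ∀ w ∈ M, χ w = 0 := fun w hw => M.toCharacterSpace_apply_eq_zero_of_mem hw
  have hnt : Nontrivial (PAlg r) := ⟨0, 1, fun h => hM.ne_top ((Ideal.eq_top_iff_one _).2 (h ▸ M.zero_mem))⟩
  have hn : ∀ w, ‖χ w‖ ≤ ‖w‖ := by
    intro w
    have h1 := spectrum.norm_le_norm_mul_of_mem (WeakDual.CharacterSpace.apply_mem_spectrum χ w)
    have h2 : ‖(1 : PAlg r)‖ ≤ 1 := norm_le_of_val zero_le_one fun x hx => by rw [val_one hx]; simp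
    nlinarith [norm_nonneg w]
  let x : ι → ℂ := fun i => χ (coord r i)
  have hx : x ∈ polydisc r := fun i => (hn _).trans (norm_coord_le hr i)
  refine ⟨x, hx, fun w hw => ?_⟩
  suffices h : χ w = val w x by rw [← h]; exact hχ w (hJM hw)
  refine denseRange_poly.induction_on (p := fun w => χ w = val w x) w ?_ fun p => ?_
  · have : Continuous fun w : PAlg r => val w x := by
      have : (fun w : PAlg r => val w x) = fun w => w.1 ⟨x, hx⟩ := by ext w; exact val_eq _ hx
      rw [this]
      exact (ContinuousEvalConst.continuous_eval_const _).comp continuous_subtype_val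
    exact isClosed_eq (map_continuous χ) this
  · rw [val_poly _ hx, ← MvPolynomial.coe_aeval_eq_eval]
    refine DFunLike.congr_fun (f := (WeakDual.CharacterSpace.toAlgHom χ).comp (poly r))
      (g := MvPolynomial.aeval x) (MvPolynomial.algHom_ext fun i => ?_) p
    rw [AlgHom.comp_apply, MvPolynomial.aeval_X]
    rfl

/-- The elements of the polydisc algebra that do not depend on the variables of `s`. -/
def indep (hr : ∀ i, 0 < r i) (s : Finset ι) : Subalgebra ℂ (PAlg r) where
  carrier := {b | ∀ i ∈ s, zeroAt hr i b = b}
  mul_mem' := fun {a b} ha hb i hi => by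
    apply ext_val
    intro x hx
    have h0 := update_mem hx (i := i) (z := 0) (by simpa using (hr i).le)
    have h1 := val_zeroAt hr i a hx
    have h2 := val_zeroAt hr i b hx
    rw [ha i hi] at h1
    rw [hb i hi] at h2
    rw [val_zeroAt hr i _ hx, val_mul, val_mul, ← h1, ← h2]
  add_mem' := fun {a b} ha hb i hi => by
    change zeroAt hr i (a + b) = a + b
    rw [map_add, ha i hi, hb i hi]
  algebraMap_mem' := fun c i hi => by
    apply ext_val
    intro x hx
    have h0 := update_mem hx (i := i) (z := 0) (by simpa using (hr i).le)
    rw [val_zeroAt hr i _ hx, Algebra.algebraMap_eq_smul_one, val_smul, val_smul, val_one hx,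
      val_one h0]

theorem zeroAt_mul (hr : ∀ i, 0 < r i) (i : ι) (v w : PAlg r) :
    zeroAt hr i (v * w) = zeroAt hr i v * zeroAt hr i w := by
  apply ext_val
  intro x hx
  rw [val_zeroAt hr i _ hx, val_mul, val_mul, val_zeroAt hr i _ hx, val_zeroAt hr i _ hx]

theorem zeroAt_zeroAt_self (hr : ∀ i, 0 < r i) (i : ι) (w : PAlg r) :
    zeroAt hr i (zeroAt hr i w) = zeroAt hr i w := by
  apply ext_val
  intro x hx
  rw [val_zeroAt hr i _ hx, val_zeroAt hr i _ (update_mem hx (by simpa using (hr i).le)),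
    val_zeroAt hr i _ hx, Function.update_idem]

theorem zeroAt_comm (hr : ∀ i, 0 < r i) (i j : ι) (w : PAlg r) :
    zeroAt hr i (zeroAt hr j w) = zeroAt hr j (zeroAt hr i w) := by
  rcases eq_or_ne i j with rfl | hij
  · rfl
  apply ext_val
  intro x hx
  rw [val_zeroAt hr i _ hx, val_zeroAt hr j _ (update_mem hx (by simpa using (hr i).le)),
    val_zeroAt hr j _ hx, val_zeroAt hr i _ (update_mem hx (by simpa using (hr j).le)),
    Function.update_comm hij]

theorem zeroAt_coord_of_ne (hr : ∀ i, 0 < r i) {i j : ι} (hij : i ≠ j) :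
    zeroAt hr j (coord r i) = coord r i := by
  apply ext_val
  intro x hx
  rw [val_zeroAt hr j _ hx, val_coord i hx, val_coord i (update_mem hx (by simpa using (hr j).le)),
    Function.update_of_ne hij]

theorem divCoord_mul (hr : ∀ i, 0 < r i) (i : ι) {b : PAlg r} (hb : zeroAt hr i b = b)
    (w : PAlg r) : divCoord hr i (b * w) = b * divCoord hr i w := by
  apply coord_mul_injective hr i
  rw [coord_mul_divCoord, mul_left_comm, coord_mul_divCoord, zeroAt_mul, hb, mul_sub]

theorem zeroAt_divCoord (hr : ∀ i, 0 < r i) {i j : ι} (hij : i ≠ j) {w : PAlg r}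
    (hw : zeroAt hr j w = w) : zeroAt hr j (divCoord hr i w) = divCoord hr i w := by
  apply coord_mul_injective hr i
  rw [coord_mul_divCoord, ← zeroAt_coord_of_ne hr hij, ← zeroAt_mul, coord_mul_divCoord, map_sub,
    hw, zeroAt_comm, hw]

/-- Products of powers `< N` of the coordinates in `s`. -/
def monom (r : ι → ℝ) (N : ℕ) (s : Finset ι) (k : ι → Fin N) : PAlg r :=
  ∏ i ∈ s, coord r i ^ (k i : ℕ)

/-- The space of the polynomials of degree `< N` in each of the variables of `s`, with coefficients
that do not depend on these variables. -/
def lowDegree (hr : ∀ i, 0 < r i) (N : ℕ) (s : Finset ι) : Submodule ℂ (PAlg r) :=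
  Submodule.span ℂ {w | ∃ b ∈ indep hr s, ∃ k, w = b * monom r N s k}

/-- Taylor expansion of order N in xᵢ, with x_i^N D^N w as remainder for D = `divCoord hr i`. -/
theorem sub_coord_pow_mul_divCoord_pow (hr : ∀ i, 0 < r i) (N : ℕ) (i : ι) (w : PAlg r) :
    w - coord r i ^ N * (divCoord hr i ^ N) w =
      ∑ k ∈ Finset.range N, coord r i ^ k * zeroAt hr i ((divCoord hr i ^ k) w) := by
  induction N with
  | zero => simp
  | succ N ih =>
    rw [Finset.sum_range_succ, ← ih, pow_succ' (divCoord hr i), mul_apply_eq_comp,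
      pow_succ, mul_assoc, coord_mul_divCoord]
    ring

/-- Division by xᵢ commutes with the monomials in the other variables and preserves independence of
the variables of s. The Taylor coefficients in xᵢ are thus independent of s and, after setting xᵢ =
0, of xᵢ as well. -/
theorem sub_coord_pow_mem_lowDegree (hr : ∀ i, 0 < r i) (N : ℕ) {s : Finset ι} {i : ι}
    (hi : i ∉ s) {w : PAlg r} (hw : w ∈ lowDegree hr N s) :
    w - coord r i ^ N * (divCoord hr i ^ N) w ∈ lowDegree hr N (insert i s) := by
  let T : PAlg r →ₗ[ℂ] PAlg r :=
    LinearMap.id - (LinearMap.mulLeft ℂ (coord r i ^ N)) ∘ₗ (divCoord hr i ^ N).toLinearMap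
  change T w ∈ lowDegree hr N (insert i s)
  suffices h : lowDegree hr N s ≤ (lowDegree hr N (insert i s)).comap T from h hw
  rw [lowDegree, Submodule.span_le]
  rintro _ ⟨b, hb, k, rfl⟩
  change (b * monom r N s k) - coord r i ^ N * (divCoord hr i ^ N) (b * monom r N s k) ∈
    lowDegree hr N (insert i s)
  rw [sub_coord_pow_mul_divCoord_pow]
  refine Submodule.sum_mem _ fun m hm => ?_
  have hmon : zeroAt hr i (monom r N s k) = monom r N s k := by
    have : monom r N s k ∈ indep hr {i} := by
      refine Subalgebra.prod_mem _ fun j hj => Subalgebra.pow_mem _ ?_ _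
      intro l hl
      rw [Finset.mem_singleton.1 hl]
      exact zeroAt_coord_of_ne hr fun h => hi (h ▸ hj)
    exact this i (Finset.mem_singleton_self _)
  have hD : ∀ m : ℕ, (divCoord hr i ^ m) (b * monom r N s k) =
      monom r N s k * (divCoord hr i ^ m) b := by
    intro m
    induction m with
    | zero => simp [mul_comm]
    | succ m ih =>
      rw [pow_succ', mul_apply_eq_comp, ih, divCoord_mul hr i hmon,
        mul_apply_eq_comp]
  have hind : ∀ m : ℕ, (divCoord hr i ^ m) b ∈ indep hr s := by
    intro m
    induction m with
    | zero => simpa using hb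
    | succ m ih =>
      intro j hj
      rw [pow_succ', mul_apply_eq_comp]
      exact zeroAt_divCoord hr (show i ≠ j from fun h => hi (h ▸ hj)) (ih j hj)
  refine Submodule.subset_span ⟨zeroAt hr i ((divCoord hr i ^ m) b), ?_,
    Function.update k i ⟨m, Finset.mem_range.1 hm⟩, ?_⟩
  · intro j hj
    rcases Finset.mem_insert.1 hj with rfl | hj
    · exact zeroAt_zeroAt_self hr _ _
    · rw [zeroAt_comm, hind m j hj]
  · rw [hD, zeroAt_mul, hmon]
    unfold monom
    rw [Finset.prod_insert hi, Function.update_self]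
    have : ∏ j ∈ s, coord r j ^ ((Function.update k i ⟨m, Finset.mem_range.1 hm⟩ j : Fin N) : ℕ) =
        ∏ j ∈ s, coord r j ^ (k j : ℕ) := by
      refine Finset.prod_congr rfl fun j hj => ?_
      rw [Function.update_of_ne (show j ≠ i from fun h => hi (h ▸ hj))]
    rw [this]
    ring

/-- Division by the powers `x_i ^ N`, `i ∈ s`, with bounds that only involve the radii of the
variables of `s`. -/
theorem exists_division_pow (hr : ∀ i, 0 < r i) {N : ℕ} (hN : 0 < N) (s : Finset ι) :
    ∃ (S : PAlg r →L[ℂ] PAlg r) (T : ι → PAlg r →L[ℂ] PAlg r),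
      (∀ w, S w ∈ lowDegree hr N s) ∧ ‖S‖ ≤ (1 + 2 ^ N) ^ s.card ∧
      (∀ i ∈ s, ‖T i‖ ≤ (2 / r i) ^ N * (1 + 2 ^ N) ^ s.card) ∧
      ∀ w, w = S w + ∑ i ∈ s, coord r i ^ N * T i w := by
  induction s using Finset.induction_on with
  | empty =>
    refine ⟨1, fun _ => 0, fun w => ?_, ?_, by simp, by simp⟩
    · exact Submodule.subset_span ⟨w, fun i hi => by simp at hi, fun _ => ⟨0, hN⟩, by simp [monom]⟩
    · rw [Finset.card_empty, pow_zero]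
      exact ContinuousLinearMap.norm_id_le
  | insert i s hi ih =>
    obtain ⟨S, T, hS, hSn, hTn, hw⟩ := ih
    have hri := hr i
    have hDn : ‖divCoord hr i ^ N‖ ≤ (2 / r i) ^ N :=
      (norm_pow_le' _ hN).trans (pow_le_pow_left₀ (norm_nonneg _) (norm_divCoord_le hr i) N)
    have hMn : ‖ContinuousLinearMap.mul ℂ (PAlg r) (coord r i ^ N)‖ ≤ r i ^ N :=
      (ContinuousLinearMap.opNorm_mul_apply_le _ _ _).trans ((norm_pow_le' _ hN).trans
        (pow_le_pow_left₀ (norm_nonneg _) (norm_coord_le hr i) N))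
    let R : PAlg r →L[ℂ] PAlg r :=
      1 - ContinuousLinearMap.mul ℂ (PAlg r) (coord r i ^ N) * divCoord hr i ^ N
    -- The radius cancels: r_i^N (2/r_i)^N = 2^N.
    have hR : ‖R‖ ≤ 1 + 2 ^ N := by
      refine (norm_sub_le _ _).trans (add_le_add ContinuousLinearMap.norm_id_le ?_)
      refine (norm_mul_le _ _).trans ((mul_le_mul hMn hDn (norm_nonneg _) (by positivity)).trans ?_)
      rw [← mul_pow, mul_div_cancel₀ _ hri.ne']
    have h1 : (1 : ℝ) ≤ 1 + 2 ^ N := by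
      have : (0 : ℝ) < 2 ^ N := by positivity
      linarith
    refine ⟨R * S, fun j => if j = i then divCoord hr i ^ N * S else T j, fun w => ?_, ?_, ?_,
      fun w => ?_⟩
    · exact sub_coord_pow_mem_lowDegree hr N hi (hS w)
    · rw [Finset.card_insert_of_notMem hi, pow_succ']
      exact (norm_mul_le _ _).trans (mul_le_mul hR hSn (norm_nonneg _) (by positivity))
    · intro j hj
      have hcard : (1 + 2 ^ N : ℝ) ^ s.card ≤ (1 + 2 ^ N) ^ (insert i s).card :=
        pow_le_pow_right₀ h1 (Finset.card_le_card (Finset.subset_insert _ _))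
      dsimp only
      split_ifs with h
      · subst h
        refine (norm_mul_le _ _).trans (mul_le_mul hDn (hSn.trans hcard) (norm_nonneg _) ?_)
        positivity
      · have hrj := hr j
        refine (hTn j (Finset.mem_of_mem_insert_of_ne hj h)).trans ?_
        gcongr
    · have : ∑ j ∈ s, coord r j ^ N * (if j = i then divCoord hr i ^ N * S else T j) w =
          ∑ j ∈ s, coord r j ^ N * T j w :=
        Finset.sum_congr rfl fun j hj => by
          rw [if_neg (show j ≠ i from fun h => hi (h ▸ hj))]
      rw [Finset.sum_insert hi]
      beta_reduce
      rw [if_pos rfl, this]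
      nth_rw 1 [hw w]
      change _ = S w - coord r i ^ N * (divCoord hr i ^ N) (S w) +
        (coord r i ^ N * (divCoord hr i ^ N) (S w) + _)
      ring

/-- Division by small perturbations of the powers `x_i ^ N`, `i ∈ s`. -/
theorem exists_division (hr : ∀ i, 0 < r i) {N : ℕ} (hN : 0 < N) (s : Finset ι) (e : ι → PAlg r)
    (he : ∑ i ∈ s, ‖e i‖ * ((2 / r i) ^ N * (1 + 2 ^ N) ^ s.card) < 1) (w : PAlg r) :
    ∃ u ∈ lowDegree hr N s, ∃ v : ι → PAlg r, w = u + ∑ i ∈ s, (coord r i ^ N - e i) * v i := by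
  obtain ⟨S, T, hS, -, hT, hw⟩ := exists_division_pow hr hN s
  -- Θ is the error made when the unperturbed quotients are used with the perturbed divisors.
  -- Dividing u = (1 - Θ)⁻¹w instead of w absorbs it.
  let Θ : PAlg r →L[ℂ] PAlg r := ∑ i ∈ s, ContinuousLinearMap.mul ℂ (PAlg r) (e i) * T i
  have hΘ : ‖Θ‖ < 1 := by
    refine (norm_sum_le _ _).trans_lt (lt_of_le_of_lt (Finset.sum_le_sum fun i hi => ?_) he)
    exact (norm_mul_le _ _).trans (mul_le_mul (ContinuousLinearMap.opNorm_mul_apply_le _ _ _)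
      (hT i hi) (norm_nonneg _) (norm_nonneg _))
  have hunit : IsUnit (1 - Θ) := isUnit_one_sub_of_norm_lt_one hΘ
  set u := Ring.inverse (1 - Θ) w with hu
  have h : u - Θ u = w := by
    have h2 := congrArg (fun T : PAlg r →L[ℂ] PAlg r => T w) (Ring.mul_inverse_cancel _ hunit)
    simpa using h2
  refine ⟨S u, hS u, fun i => T i u, ?_⟩
  have hΘu : Θ u = ∑ i ∈ s, e i * T i u := by
    simp [Θ]
  rw [← h, hΘu]
  nth_rw 1 [hw u]
  simp only [sub_mul, Finset.sum_sub_distrib]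
  abel

end Polydisc

/-! ### The local domain 𝒪ₙ: values at 0, units, composition with map germs. -/

namespace BruceRoberts

variable {n m : ℕ}

theorem O.ext_rep {a b : O n} (h : a.rep =ᶠ[𝓝 0] b.rep) : a = b := by
  apply Subtype.ext
  rw [← O.coe_rep a, ← O.coe_rep b]
  exact Germ.coe_eq.2 h

theorem O.rep_algebraMap (c : ℂ) : (algebraMap ℂ (O n) c).rep =ᶠ[𝓝 0] fun _ => c := by
  refine Germ.coe_eq.1 ?_
  rw [O.coe_rep]
  change algebraMap ℂ (Germ (𝓝 (0 : Fin n → ℂ)) ℂ) c = _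
  rw [Algebra.algebraMap_eq_smul_one, ← Germ.coe_one, ← Germ.coe_smul]
  congr 1
  ext x
  simp

theorem O.rep_one : (1 : O n).rep =ᶠ[𝓝 0] fun _ => 1 := by
  simpa using O.rep_algebraMap (n := n) 1

/-- The value of a germ at `0`. -/
def O.ev (n : ℕ) : O n →ₐ[ℂ] ℂ where
  toFun g := g.rep 0
  map_one' := (O.rep_one (n := n)).eq_of_nhds
  map_mul' a b := (O.rep_mul a b).eq_of_nhds
  map_zero' := (O.rep_zero (n := n)).eq_of_nhds
  map_add' a b := (O.rep_add a b).eq_of_nhds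
  commutes' c := (O.rep_algebraMap (n := n) c).eq_of_nhds

theorem O.ev_apply (g : O n) : O.ev n g = g.rep 0 := rfl

theorem O.ev_mk (φ : (Fin n → ℂ) → ℂ) (hφ : AnalyticAt ℂ φ 0) : O.ev n (O.mk φ hφ) = φ 0 :=
  (O.rep_mk φ hφ).eq_of_nhds

theorem O.rep_sum {κ : Type*} (s : Finset κ) (g : κ → O n) :
    (∑ k ∈ s, g k).rep =ᶠ[𝓝 0] fun x => ∑ k ∈ s, (g k).rep x := by
  classical
  induction s using Finset.induction_on with
  | empty => exact O.rep_zero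
  | insert a s ha ih =>
    rw [Finset.sum_insert ha]
    filter_upwards [O.rep_add (g a) (∑ k ∈ s, g k), ih] with x h1 h2
    rw [h1, Pi.add_apply, h2, Finset.sum_insert ha]

theorem O.rep_pow (g : O n) (k : ℕ) : (g ^ k).rep =ᶠ[𝓝 0] fun x => g.rep x ^ k := by
  induction k with
  | zero => simpa using O.rep_one (n := n)
  | succ k ih =>
    rw [pow_succ]
    filter_upwards [O.rep_mul (g ^ k) g, ih] with x h1 h2
    rw [h1, Pi.mul_apply, h2, pow_succ]

instance : Nontrivial (O n) := (O.ev n).toRingHom.domain_nontrivial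

theorem O.isUnit_iff {g : O n} : IsUnit g ↔ O.ev n g ≠ 0 := by
  refine ⟨fun h => (h.map (O.ev n)).ne_zero, fun h => ?_⟩
  have hi : AnalyticAt ℂ (fun x => (g.rep x)⁻¹) 0 := g.rep_analyticAt.fun_inv h
  refine IsUnit.of_mul_eq_one (O.mk _ hi) (O.ext_rep ?_)
  filter_upwards [O.rep_mul g (O.mk _ hi), O.rep_mk _ hi, O.rep_one (n := n),
    g.rep_analyticAt.continuousAt.eventually_ne h] with x h1 h2 h3 h4
  rw [h1, Pi.mul_apply, h2, h3, mul_inv_cancel₀ h4]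

instance : IsLocalRing (O n) := by
  refine IsLocalRing.of_nonunits_add fun a b ha hb => ?_
  simp only [mem_nonunits_iff, O.isUnit_iff, not_not] at *
  rw [map_add, ha, hb, add_zero]

theorem O.mem_maximalIdeal {g : O n} : g ∈ IsLocalRing.maximalIdeal (O n) ↔ O.ev n g = 0 := by
  rw [IsLocalRing.mem_maximalIdeal, mem_nonunits_iff, O.isUnit_iff, not_not]

/-- The coordinate germs. -/
def O.X (i : Fin n) : O n := O.mk (fun x => x i)
  (ContinuousLinearMap.analyticAt (ContinuousLinearMap.proj (R := ℂ) (φ := fun _ : Fin n => ℂ) i) 0)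

theorem O.rep_X (i : Fin n) : (O.X i).rep =ᶠ[𝓝 0] fun x => x i := O.rep_mk _ _

theorem O.ev_X (i : Fin n) : O.ev n (O.X i) = 0 := O.ev_mk _ _

/-- The map germ with components `F`. -/
def O.toMap (F : Fin m → O n) (x : Fin n → ℂ) : Fin m → ℂ := fun j => (F j).rep x

theorem O.analyticAt_toMap (F : Fin m → O n) : AnalyticAt ℂ (O.toMap F) 0 :=
  AnalyticAt.pi fun j => (F j).rep_analyticAt

theorem O.tendsto_toMap {F : Fin m → O n} (hF : ∀ j, O.ev n (F j) = 0) :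
    Tendsto (O.toMap F) (𝓝 0) (𝓝 0) := by
  have h : O.toMap F 0 = 0 := funext hF
  have := (O.analyticAt_toMap F).continuousAt.tendsto
  rwa [h] at this

/-- The germ of the composition `φ ∘ F`. -/
def O.compMk (F : Fin m → O n) (hF : ∀ j, O.ev n (F j) = 0) (φ : (Fin m → ℂ) → ℂ)
    (hφ : AnalyticAt ℂ φ 0) : O n :=
  O.mk (fun x => φ (O.toMap F x)) (by
    have h : O.toMap F 0 = 0 := funext hF
    exact AnalyticAt.comp (g := φ) (by rwa [h]) (O.analyticAt_toMap F))

theorem O.rep_compMk (F : Fin m → O n) (hF : ∀ j, O.ev n (F j) = 0) (φ : (Fin m → ℂ) → ℂ)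
    (hφ : AnalyticAt ℂ φ 0) : (O.compMk F hF φ hφ).rep =ᶠ[𝓝 0] fun x => φ (O.toMap F x) :=
  O.rep_mk (fun x => φ (O.toMap F x)) _

/-- Composition with the map germ `F` as a homomorphism `𝒪ₘ → 𝒪ₙ`. -/
def O.comp (F : Fin m → O n) (hF : ∀ j, O.ev n (F j) = 0) : O m →ₐ[ℂ] O n where
  toFun g := O.compMk F hF g.rep g.rep_analyticAt
  map_one' := O.ext_rep (by
    filter_upwards [O.rep_compMk F hF _ _, O.rep_one (n := n),
      (O.tendsto_toMap hF).eventually (O.rep_one (n := m))] with x h1 h2 h3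
    rw [h1, h2, h3])
  map_mul' a b := O.ext_rep (by
    filter_upwards [O.rep_compMk F hF _ _, O.rep_mul (O.compMk F hF a.rep a.rep_analyticAt)
      (O.compMk F hF b.rep b.rep_analyticAt), O.rep_compMk F hF _ _, O.rep_compMk F hF _ _,
      (O.tendsto_toMap hF).eventually (O.rep_mul a b)] with x h1 h2 h3 h4 h5
    rw [h2, Pi.mul_apply]
    rw [h1, h3, h4, h5, Pi.mul_apply])
  map_zero' := O.ext_rep (by
    filter_upwards [O.rep_compMk F hF _ _, O.rep_zero (n := n),
      (O.tendsto_toMap hF).eventually (O.rep_zero (n := m))] with x h1 h2 h3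
    rw [h1, h2, h3]; rfl)
  map_add' a b := O.ext_rep (by
    filter_upwards [O.rep_compMk F hF _ _, O.rep_add (O.compMk F hF a.rep a.rep_analyticAt)
      (O.compMk F hF b.rep b.rep_analyticAt), O.rep_compMk F hF _ _, O.rep_compMk F hF _ _,
      (O.tendsto_toMap hF).eventually (O.rep_add a b)] with x h1 h2 h3 h4 h5
    rw [h2, Pi.add_apply]
    rw [h1, h3, h4, h5, Pi.add_apply])
  commutes' c := O.ext_rep (by
    filter_upwards [O.rep_compMk F hF _ _, O.rep_algebraMap (n := n) c,
      (O.tendsto_toMap hF).eventually (O.rep_algebraMap (n := m) c)] with x h1 h2 h3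
    rw [h1, h2, h3])

theorem O.rep_comp (F : Fin m → O n) (hF : ∀ j, O.ev n (F j) = 0) (g : O m) :
    (O.comp F hF g).rep =ᶠ[𝓝 0] fun x => g.rep (O.toMap F x) :=
  O.rep_compMk F hF _ g.rep_analyticAt

theorem O.comp_X (F : Fin m → O n) (hF : ∀ j, O.ev n (F j) = 0) (j : Fin m) :
    O.comp F hF (O.X j) = F j := O.ext_rep (by
  filter_upwards [O.rep_comp F hF (O.X j), (O.tendsto_toMap hF).eventually (O.rep_X j)]
    with x h1 h2
  rw [h1, h2]; rfl)

theorem O.exists_ball (g : O n) : ∃ ε > 0, AnalyticOnNhd ℂ g.rep (Metric.ball 0 ε) := by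
  obtain ⟨ε, hε, h⟩ := Metric.eventually_nhds_iff_ball.1 g.rep_analyticAt.eventually_analyticAt
  exact ⟨ε, hε, fun x hx => h x hx⟩

/-- Identity theorem on a common ball: if a is nonzero at one of its points, b vanishes near that
point, hence on the whole ball. -/
instance : IsDomain (O n) := by
  refine @NoZeroDivisors.to_isDomain _ _ _ ⟨fun {a b} hab => ?_⟩
  obtain ⟨ε₁, h1, ha⟩ := O.exists_ball a
  obtain ⟨ε₂, h2, hb⟩ := O.exists_ball b
  have hm := O.rep_mul a b
  rw [hab] at hm
  obtain ⟨ε₃, h3, hz⟩ := Metric.eventually_nhds_iff_ball.1 (hm.symm.trans (O.rep_zero (n := n)))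
  set ε := min ε₁ (min ε₂ ε₃)
  have hε : 0 < ε := by positivity
  by_cases hA : ∀ x ∈ Metric.ball (0 : Fin n → ℂ) ε, a.rep x = 0
  · left
    refine O.ext_rep ?_
    filter_upwards [Metric.ball_mem_nhds (0 : Fin n → ℂ) hε, O.rep_zero (n := n)] with x hx h0
    rw [hA x hx, h0]; rfl
  · right
    push Not at hA
    obtain ⟨x, hx, hax⟩ := hA
    have hsub : Metric.ball (0 : Fin n → ℂ) ε ⊆ Metric.ball 0 ε₂ :=
      Metric.ball_subset_ball ((min_le_right _ _).trans (min_le_left _ _))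
    have hsub1 : Metric.ball (0 : Fin n → ℂ) ε ⊆ Metric.ball 0 ε₁ :=
      Metric.ball_subset_ball (min_le_left _ _)
    have hsub3 : Metric.ball (0 : Fin n → ℂ) ε ⊆ Metric.ball 0 ε₃ :=
      Metric.ball_subset_ball ((min_le_right _ _).trans (min_le_right _ _))
    have key := (hb.mono hsub).eqOn_zero_of_preconnected_of_eventuallyEq_zero
      (convex_ball (0 : Fin n → ℂ) ε).isPreconnected hx (by
        filter_upwards [Metric.isOpen_ball.mem_nhds hx,
          (ha x (hsub1 hx)).continuousAt.eventually_ne hax] with y hy hay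
        have := hz y (hsub3 hy)
        exact (mul_eq_zero.1 this).resolve_left hay)
    refine O.ext_rep ?_
    filter_upwards [Metric.ball_mem_nhds (0 : Fin n → ℂ) hε, O.rep_zero (n := n)] with x hx h0
    rw [key hx, h0]

/-! ### Derivations -/

theorem O.rep_pderiv (j : Fin n) (g : O n) :
    (pderiv j g).rep =ᶠ[𝓝 0] fun x => fderiv ℂ g.rep x (Pi.single j 1) := O.rep_mk _ _

theorem O.eventually_differentiableAt (g : O n) : ∀ᶠ x in 𝓝 0, DifferentiableAt ℂ g.rep x :=
  g.rep_analyticAt.eventually_analyticAt.mono fun _ h => h.differentiableAt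

/-- The partial derivative as a derivation. -/
def pd (j : Fin n) : Derivation ℂ (O n) (O n) where
  toFun := pderiv j
  map_add' a b := O.ext_rep (by
    filter_upwards [O.rep_pderiv j (a + b), O.rep_add (pderiv j a) (pderiv j b), O.rep_pderiv j a,
      O.rep_pderiv j b, (O.rep_add a b).fderiv (𝕜 := ℂ), a.eventually_differentiableAt,
      b.eventually_differentiableAt] with x h1 h2 h3 h4 h5 h6 h7
    rw [h1, h2, Pi.add_apply, h3, h4, h5, fderiv_add h6 h7]
    rfl)
  map_smul' c a := O.ext_rep (by
    rw [RingHom.id_apply, Algebra.smul_def, Algebra.smul_def]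
    filter_upwards [O.rep_pderiv j (algebraMap ℂ (O n) c * a),
      O.rep_mul (algebraMap ℂ (O n) c) (pderiv j a), O.rep_pderiv j a, O.rep_algebraMap (n := n) c,
      ((O.rep_mul (algebraMap ℂ (O n) c) a).trans
        ((O.rep_algebraMap (n := n) c).mul EventuallyEq.rfl)).fderiv (𝕜 := ℂ),
      a.eventually_differentiableAt] with x h1 h2 h3 h4 h5 h6
    rw [h1, h2, Pi.mul_apply, h3, h4, h5]
    have : fderiv ℂ (fun y => c * a.rep y) x = c • fderiv ℂ a.rep x := fderiv_const_mul h6 c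
    exact congrArg (fun L : (Fin n → ℂ) →L[ℂ] ℂ => L (Pi.single j 1)) this)
  map_one_eq_zero' := O.ext_rep (by
    filter_upwards [O.rep_pderiv j (1 : O n), O.rep_zero (n := n),
      (O.rep_one (n := n)).fderiv (𝕜 := ℂ)] with x h1 h2 h3
    change (pderiv j 1).rep x = _
    rw [h1, h2, h3]
    simp)
  leibniz' a b := O.ext_rep (by
    change (pderiv j (a * b)).rep =ᶠ[𝓝 0] (a • pderiv j b + b • pderiv j a).rep
    rw [smul_eq_mul, smul_eq_mul]
    filter_upwards [O.rep_pderiv j (a * b), O.rep_add (a * pderiv j b) (b * pderiv j a),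
      O.rep_mul a (pderiv j b), O.rep_mul b (pderiv j a), O.rep_pderiv j a,
      O.rep_pderiv j b, (O.rep_mul a b).fderiv (𝕜 := ℂ), a.eventually_differentiableAt,
      b.eventually_differentiableAt] with x h1 h2 h3 h4 h5 h6 h7 h8 h9
    rw [h1, h2, Pi.add_apply, h3, h4, Pi.mul_apply, Pi.mul_apply, h5, h6, h7, fderiv_mul h8 h9]
    rfl)

theorem pd_apply (j : Fin n) (g : O n) : pd j g = pderiv j g := rfl

theorem pderiv_X (i j : Fin n) : pderiv j (O.X i) = if i = j then 1 else 0 := O.ext_rep (by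
  have h : (if i = j then 1 else 0 : O n).rep =ᶠ[𝓝 0] fun _ => if i = j then 1 else 0 := by
    split_ifs
    · exact O.rep_one
    · exact O.rep_zero
  filter_upwards [O.rep_pderiv j (O.X i), (O.rep_X i).fderiv (𝕜 := ℂ), h] with x h1 h2 h3
  rw [h1, h2, h3]
  have : fderiv ℂ (fun y : Fin n → ℂ => y i) x = ContinuousLinearMap.proj i :=
    (ContinuousLinearMap.proj (R := ℂ) (φ := fun _ : Fin n => ℂ) i).fderiv
  rw [this]
  simp [Pi.single_apply])

end BruceRoberts

/-! ### Uniform bounds on small polydiscs and expansions in monomials. -/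

namespace Polydisc

variable {ι : Type} [Fintype ι] [DecidableEq ι] {r : ι → ℝ}

/-- The bound C does not depend on the polydisc, so some radii can be shrunk after C is known. -/
theorem exists_val_eq_and_norm_le {φ : (ι → ℂ) → ℂ} (hφ : AnalyticAt ℂ φ 0) :
    ∃ ε > 0, ∃ C ≥ 0, ∀ r : ι → ℝ, (∀ i, r i ≤ ε) →
      ∃ w : PAlg r, (∀ x ∈ polydisc r, val w x = φ x) ∧ ‖w‖ ≤ C := by
  obtain ⟨ε, hε, h⟩ := exists_val_eq_of_analyticAt hφ
  have hb : ∀ᶠ x in 𝓝 0, ‖φ x‖ ≤ ‖φ 0‖ + 1 :=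
    (hφ.continuousAt.norm.eventually_lt continuousAt_const (lt_add_one _)).mono fun _ h => h.le
  obtain ⟨δ, hδ, hb⟩ := Metric.eventually_nhds_iff_ball.1 hb
  refine ⟨min ε (δ / 2), by positivity, ‖φ 0‖ + 1, by positivity, fun r hr => ?_⟩
  obtain ⟨w, hw⟩ := h r fun i => (hr i).trans (min_le_left _ _)
  refine ⟨w, hw, norm_le_of_val (by positivity) fun x hx => ?_⟩
  rw [hw x hx]
  refine hb x (mem_ball_zero_iff.2 (lt_of_le_of_lt ((pi_norm_le_iff_of_nonneg (by positivity)).2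
    fun i => (hx i).trans ((hr i).trans (min_le_right _ _))) (half_lt_self hδ)))

theorem val_indep (hr : ∀ i, 0 < r i) (s : Finset ι) {b : PAlg r} (hb : b ∈ indep hr s)
    {x : ι → ℂ} (hx : x ∈ polydisc r) : val b (s.piecewise 0 x) = val b x := by
  induction s using Finset.induction_on with
  | empty => simp
  | insert i s hi ih =>
    have hx' : s.piecewise 0 x ∈ polydisc r := by
      intro j
      by_cases hj : j ∈ s
      · simpa [hj] using (hr j).le
      · simpa [hj] using hx j
    rw [Finset.piecewise_insert, Pi.zero_apply, ← val_zeroAt hr i b hx',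
      hb i (Finset.mem_insert_self _ _)]
    exact ih fun j hj => hb j (Finset.mem_insert_of_mem hj)

theorem exists_eq_sum_of_mem_lowDegree (hr : ∀ i, 0 < r i) {N : ℕ} {s : Finset ι} {u : PAlg r}
    (hu : u ∈ lowDegree hr N s) :
    ∃ b : (ι → Fin N) → PAlg r, (∀ k, b k ∈ indep hr s) ∧ u = ∑ k, b k * monom r N s k := by
  induction hu using Submodule.span_induction with
  | mem u hu =>
    obtain ⟨b, hb, k, rfl⟩ := hu
    refine ⟨Pi.single k b, fun l => ?_, ?_⟩
    · rcases eq_or_ne l k with rfl | h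
      · simpa using hb
      · simp [h]
    · rw [Finset.sum_eq_single k (fun l _ h => by simp [h]) (by simp), Pi.single_eq_same]
  | zero => exact ⟨0, fun _ => zero_mem _, by simp⟩
  | add u v _ _ hu hv =>
    obtain ⟨b, hb, rfl⟩ := hu
    obtain ⟨c, hc, rfl⟩ := hv
    exact ⟨b + c, fun k => add_mem (hb k) (hc k), by simp [add_mul, Finset.sum_add_distrib]⟩
  | smul a u _ hu =>
    obtain ⟨b, hb, rfl⟩ := hu
    exact ⟨a • b, fun k => Subalgebra.smul_mem _ (hb k) a, by simp [Finset.smul_sum]⟩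

end Polydisc

/-! ### Division for germs, substitution, and finiteness of 𝒪ₙ/Q over 𝒪ₘ. -/

namespace BruceRoberts

open Polydisc

variable {n m : ℕ}

/-- The `x`-variables among the variables `(x, y)`. -/
abbrev leftVars (n m : ℕ) : Finset (Fin n ⊕ Fin m) := Finset.univ.map Function.Embedding.inl

theorem analyticAt_comp_inl (g : O n) :
    AnalyticAt ℂ (fun z : Fin n ⊕ Fin m → ℂ => g.rep (z ∘ Sum.inl)) 0 := by
  refine AnalyticAt.comp (g := g.rep) (f := fun z : Fin n ⊕ Fin m → ℂ => z ∘ Sum.inl)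
    g.rep_analyticAt ?_
  exact (ContinuousLinearMap.pi fun i => ContinuousLinearMap.proj (R := ℂ)
    (φ := fun _ : Fin n ⊕ Fin m => ℂ) (Sum.inl i)).analyticAt 0

/-- Germs in the variables `x` may be lifted to a polydisc in the variables `(x, y)` on which the
division by `x_i ^ N - ∑ⱼ A_ij y_j` is possible. -/
theorem exists_polydisc_division {L : Type} [Finite L] (Φ : L → O n) (A : Fin n → Fin m → O n)
    {U : Set (Fin n → ℂ)} (hU : U ∈ 𝓝 0) {N : ℕ} (hN : 0 < N) :
    ∃ (r : Fin n ⊕ Fin m → ℝ) (hr : ∀ i, 0 < r i) (φ : L → PAlg r) (a : Fin n → Fin m → PAlg r),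
      (∀ l, ∀ z ∈ polydisc r, val (φ l) z = (Φ l).rep (z ∘ Sum.inl)) ∧
      (∀ i j, ∀ z ∈ polydisc r, val (a i j) z = (A i j).rep (z ∘ Sum.inl)) ∧
      (∀ z ∈ polydisc r, z ∘ Sum.inl ∈ U) ∧
      ∀ w, ∃ u ∈ lowDegree hr N (leftVars n m), ∃ v : Fin n → PAlg r,
        w = u + ∑ i, (coord r (Sum.inl i) ^ N - ∑ j, a i j * coord r (Sum.inr j)) * v i := by
  classical
  have := Fintype.ofFinite L
  choose ε₁ hε₁ h₁ using fun l => exists_val_eq_of_analyticAt (analyticAt_comp_inl (m := m) (Φ l))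
  choose ε₂ hε₂ C hC h₂ using fun p : Fin n × Fin m =>
    exists_val_eq_and_norm_le (analyticAt_comp_inl (m := m) (A p.1 p.2))
  obtain ⟨ε₃, hε₃, h₃⟩ := Metric.mem_nhds_iff.1 hU
  obtain ⟨ε, hε, he₁, he₂, he₃⟩ : ∃ ε > 0, (∀ l, ε ≤ ε₁ l) ∧ (∀ p, ε ≤ ε₂ p) ∧ ε < ε₃ := by
    have ha : ∀ᶠ ε in 𝓝[>] (0 : ℝ), ∀ l, ε ≤ ε₁ l := eventually_all.2 fun l =>
      (eventually_nhdsWithin_of_eventually_nhds (eventually_le_nhds (hε₁ l)))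
    have hb : ∀ᶠ ε in 𝓝[>] (0 : ℝ), ∀ p, ε ≤ ε₂ p := eventually_all.2 fun l =>
      (eventually_nhdsWithin_of_eventually_nhds (eventually_le_nhds (hε₂ l)))
    have hc : ∀ᶠ ε in 𝓝[>] (0 : ℝ), ε < ε₃ :=
      (eventually_nhdsWithin_of_eventually_nhds (eventually_lt_nhds hε₃))
    obtain ⟨ε, ⟨h2, h3, h4⟩, h1⟩ := ((ha.and (hb.and hc)).and self_mem_nhdsWithin).exists
    exact ⟨ε, h1, h2, h3, h4⟩
  set B : ℝ := (2 / ε) ^ N * (1 + 2 ^ N) ^ (leftVars n m).card with hB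
  have hB0 : 0 ≤ B := by positivity
  set K : ℝ := ∑ i : Fin n, (∑ j : Fin m, C (i, j)) * B with hK
  have hK0 : 0 ≤ K := Finset.sum_nonneg fun i _ =>
    mul_nonneg (Finset.sum_nonneg fun j _ => hC _) hB0
  -- The x-radii stay equal to ε, and only they enter B. The perturbation has total size at most Kρ,
  -- which this choice of the y-radius makes smaller than 1.
  set ρ : ℝ := min ε (1 / (K + 1)) with hρ
  have hρ0 : 0 < ρ := by positivity
  let r : Fin n ⊕ Fin m → ℝ := Sum.elim (fun _ => ε) (fun _ => ρ)
  have hr : ∀ i, 0 < r i := by rintro (i | j) <;> simpa [r]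
  have hrε : ∀ i, r i ≤ ε := by
    rintro (i | j)
    · exact le_rfl
    · exact min_le_left _ _
  choose φ hφ using fun l => h₁ l r fun i => (hrε i).trans (he₁ l)
  choose a ha haC using fun p => h₂ p r fun i => (hrε i).trans (he₂ p)
  refine ⟨r, hr, φ, fun i j => a (i, j), hφ, fun i j => ha (i, j), fun z hz => h₃ ?_, fun w => ?_⟩
  · exact mem_ball_zero_iff.2 (lt_of_le_of_lt ((pi_norm_le_iff_of_nonneg hε.le).2
      fun i => hz (Sum.inl i)) he₃)
  · let e : Fin n ⊕ Fin m → PAlg r := Sum.elim (fun i => ∑ j, a (i, j) * coord r (Sum.inr j)) 0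
    have hen : ∀ i, ‖e (Sum.inl i)‖ ≤ (∑ j, C (i, j)) * ρ := by
      intro i
      rw [Finset.sum_mul]
      refine (norm_sum_le _ _).trans (Finset.sum_le_sum fun j _ => ?_)
      exact (norm_mul_le _ _).trans (mul_le_mul (haC _) (norm_coord_le hr _) (norm_nonneg _) (hC _))
    obtain ⟨u, hu, v, hv⟩ := exists_division hr hN (leftVars n m) e (by
      rw [Finset.sum_map]
      calc _ ≤ ∑ i : Fin n, ((∑ j, C (i, j)) * ρ) * B :=
            Finset.sum_le_sum fun i _ => mul_le_mul_of_nonneg_right (hen i) hB0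
        _ = K * ρ := by rw [hK, Finset.sum_mul]; exact Finset.sum_congr rfl fun i _ => by ring
        _ ≤ K * (1 / (K + 1)) := by gcongr; exact min_le_right _ _
        _ < 1 := by rw [mul_one_div, div_lt_one (by positivity)]; linarith) w
    refine ⟨u, hu, fun i => v (Sum.inl i), hv.trans ?_⟩
    rw [Finset.sum_map]
    rfl

section subst

variable {ι : Type} [Fintype ι] [DecidableEq ι] {r : ι → ℝ}

theorem tendsto_germs {G : ι → O n} (hG : ∀ i, O.ev n (G i) = 0) :
    Tendsto (fun x i => (G i).rep x) (𝓝 0) (𝓝 0) := by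
  refine tendsto_pi_nhds.2 fun i => ?_
  have := (G i).rep_analyticAt.continuousAt.tendsto
  rwa [← O.ev_apply, hG i] at this

theorem analyticAt_val_germs (hr : ∀ i, 0 < r i) {G : ι → O n} (hG : ∀ i, O.ev n (G i) = 0)
    (w : PAlg r) : AnalyticAt ℂ (fun x => val w fun i => (G i).rep x) 0 := by
  refine AnalyticAt.comp (g := val w) ?_ (AnalyticAt.pi fun i => (G i).rep_analyticAt)
  have : (fun i => (G i).rep 0) = 0 := funext hG
  rw [this]
  exact analyticAt_val hr w

/-- Substitution of germs for the variables in elements of the polydisc algebra. -/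
def subst (hr : ∀ i, 0 < r i) {G : ι → O n} (hG : ∀ i, O.ev n (G i) = 0) : PAlg r →ₐ[ℂ] O n where
  toFun w := O.mk _ (analyticAt_val_germs hr hG w)
  map_one' := O.ext_rep (by
    filter_upwards [O.rep_mk _ (analyticAt_val_germs hr hG 1), O.rep_one (n := n),
      (tendsto_germs hG).eventually (polydisc_mem_nhds hr)] with x h1 h2 h3
    rw [h1, h2, val_one h3])
  map_mul' v w := O.ext_rep (by
    filter_upwards [O.rep_mk _ (analyticAt_val_germs hr hG (v * w)),
      O.rep_mk _ (analyticAt_val_germs hr hG v), O.rep_mk _ (analyticAt_val_germs hr hG w),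
      O.rep_mul (O.mk _ (analyticAt_val_germs hr hG v)) (O.mk _ (analyticAt_val_germs hr hG w))]
      with x h1 h2 h3 h4
    rw [h1, h4, Pi.mul_apply, h2, h3, val_mul])
  map_zero' := O.ext_rep (by
    filter_upwards [O.rep_mk _ (analyticAt_val_germs hr hG 0), O.rep_zero (n := n)] with x h1 h2
    rw [h1, h2, val_zero, Pi.zero_apply])
  map_add' v w := O.ext_rep (by
    filter_upwards [O.rep_mk _ (analyticAt_val_germs hr hG (v + w)),
      O.rep_mk _ (analyticAt_val_germs hr hG v), O.rep_mk _ (analyticAt_val_germs hr hG w),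
      O.rep_add (O.mk _ (analyticAt_val_germs hr hG v)) (O.mk _ (analyticAt_val_germs hr hG w))]
      with x h1 h2 h3 h4
    rw [h1, h4, Pi.add_apply, h2, h3, val_add])
  commutes' c := O.ext_rep (by
    filter_upwards [O.rep_mk _ (analyticAt_val_germs hr hG (algebraMap ℂ (PAlg r) c)),
      O.rep_algebraMap (n := n) c, (tendsto_germs hG).eventually (polydisc_mem_nhds hr)]
      with x h1 h2 h3
    rw [h1, h2, Algebra.algebraMap_eq_smul_one, val_smul, val_one h3, mul_one])

theorem rep_subst (hr : ∀ i, 0 < r i) {G : ι → O n} (hG : ∀ i, O.ev n (G i) = 0) (w : PAlg r) :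
    (subst hr hG w).rep =ᶠ[𝓝 0] fun x => val w fun i => (G i).rep x :=
  O.rep_mk _ (analyticAt_val_germs hr hG w)

theorem subst_eq (hr : ∀ i, 0 < r i) {G : ι → O n} (hG : ∀ i, O.ev n (G i) = 0) (w : PAlg r)
    {g : O n} (h : ∀ᶠ x in 𝓝 0, (fun i => (G i).rep x) ∈ polydisc r →
      val w (fun i => (G i).rep x) = g.rep x) : subst hr hG w = g := O.ext_rep (by
  filter_upwards [rep_subst hr hG w, h,
    (tendsto_germs hG).eventually (polydisc_mem_nhds hr)] with x h1 h2 h3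
  rw [h1, h2 h3])

theorem subst_coord (hr : ∀ i, 0 < r i) {G : ι → O n} (hG : ∀ i, O.ev n (G i) = 0) (i : ι) :
    subst hr hG (coord r i) = G i :=
  subst_eq hr hG _ (Eventually.of_forall fun x hx => by rw [val_coord i hx])

/-- The germs `(x, F)`. -/
def graphGerms (F : Fin m → O n) : Fin n ⊕ Fin m → O n := Sum.elim O.X F

theorem ev_graphGerms {F : Fin m → O n} (hF : ∀ j, O.ev n (F j) = 0) (i : Fin n ⊕ Fin m) :
    O.ev n (graphGerms F i) = 0 := by
  rcases i with i | j
  · exact O.ev_X i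
  · exact hF j

theorem eventually_graphGerms_inl (F : Fin m → O n) :
    ∀ᶠ x in 𝓝 0, (fun i => (graphGerms F i).rep x) ∘ Sum.inl = x := by
  have : ∀ᶠ x in 𝓝 (0 : Fin n → ℂ), ∀ i, (O.X i).rep x = x i :=
    eventually_all.2 fun i => O.rep_X i
  filter_upwards [this] with x hx
  exact funext hx

theorem subst_graphGerms_lift {r : Fin n ⊕ Fin m → ℝ} (hr : ∀ i, 0 < r i) {F : Fin m → O n}
    (hF : ∀ j, O.ev n (F j) = 0) {w : PAlg r} {g : O n}
    (h : ∀ z ∈ polydisc r, val w z = g.rep (z ∘ Sum.inl)) :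
    subst hr (ev_graphGerms hF) w = g := by
  refine subst_eq hr _ _ ?_
  filter_upwards [eventually_graphGerms_inl F] with x hx hmem
  rw [h _ hmem, hx]

theorem analyticAt_elim_zero : AnalyticAt ℂ
    (fun y : Fin m → ℂ => (Sum.elim 0 y : Fin n ⊕ Fin m → ℂ)) 0 := by
  refine AnalyticAt.pi fun i => ?_
  rcases i with i | j
  · exact analyticAt_const
  · exact ContinuousLinearMap.analyticAt
      (ContinuousLinearMap.proj (R := ℂ) (φ := fun _ : Fin m => ℂ) j) 0

/-- The restriction of an element of the polydisc algebra to `x = 0`. -/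
def restrictRight {r : Fin n ⊕ Fin m → ℝ} (hr : ∀ i, 0 < r i) (b : PAlg r) : O m :=
  O.mk (fun y => val b (Sum.elim 0 y)) (by
    refine AnalyticAt.comp (g := val b) ?_ analyticAt_elim_zero
    convert! analyticAt_val hr b
    ext i; rcases i <;> rfl)

/-- A function independent of x is determined by its restriction to x = 0, so putting y = F in it is
a pull-back from 𝒪ₘ. -/
theorem subst_graphGerms_indep {r : Fin n ⊕ Fin m → ℝ} (hr : ∀ i, 0 < r i) {F : Fin m → O n}
    (hF : ∀ j, O.ev n (F j) = 0) {b : PAlg r} (hb : b ∈ indep hr (leftVars n m)) :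
    subst hr (ev_graphGerms hF) b = O.comp F hF (restrictRight hr b) := by
  refine subst_eq hr _ _ ?_
  filter_upwards [O.rep_comp F hF (restrictRight hr b),
    (O.tendsto_toMap hF).eventually (O.rep_mk (fun y => val b (Sum.elim 0 y)) _)]
    with x h1 h2 hmem
  rw [h1]
  refine Eq.trans ?_ h2.symm
  rw [← val_indep hr _ hb hmem]
  congr 1
  ext i
  rcases i with i | j
  · simp
  · simp [O.toMap, graphGerms]

end subst

/-- If a power of each coordinate lies in the ideal generated by the components of `F` and by `Q`,
then `𝒪ₙ / Q` is generated over `𝒪ₘ` by finitely many monomials. -/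
theorem exists_eq_sum_comp (F : Fin m → O n) (hF : ∀ j, O.ev n (F j) = 0) (Q : Ideal (O n)) {N : ℕ}
    (hN : 0 < N) (h : ∀ i, O.X i ^ N ∈ Ideal.span (Set.range F) ⊔ Q) (g : O n) :
    ∃ c : (Fin n ⊕ Fin m → Fin N) → O m,
      g - ∑ k, O.comp F hF (c k) * ∏ i, O.X i ^ (k (Sum.inl i) : ℕ) ∈ Q := by
  have h' : ∀ i, ∃ A : Fin m → O n, ∃ q ∈ Q, O.X i ^ N = ∑ j, A j * F j + q := by
    intro i
    obtain ⟨a, ha, q, hq, hs⟩ := Submodule.mem_sup.1 (h i)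
    obtain ⟨A, hA⟩ := (Ideal.mem_span_range_iff_exists_fun).1 ha
    exact ⟨A, q, hq, by rw [hA, hs]⟩
  choose A q hq hA using h'
  obtain ⟨r, hr, φ, a, hφ, ha, -, hdiv⟩ := exists_polydisc_division (m := m) (fun _ : Unit => g) A
    Filter.univ_mem hN
  obtain ⟨u, hu, v, hv⟩ := hdiv (φ ())
  obtain ⟨b, hb, rfl⟩ := exists_eq_sum_of_mem_lowDegree hr hu
  refine ⟨fun k => restrictRight hr (b k), ?_⟩
  -- Putting y = F turns each divisor x_i^N - ∑ⱼ A_ij yⱼ into an element of Q, so only the remainder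
  -- survives modulo Q. Its coefficients become pull-backs. The entries of k at the y-variables play
  -- no role.
  have hE := congrArg (subst hr (ev_graphGerms hF)) hv
  have hmon : ∀ k, subst hr (ev_graphGerms hF) (monom r N (leftVars n m) k) =
      ∏ i, O.X i ^ (k (Sum.inl i) : ℕ) := by
    intro k
    rw [monom, Finset.prod_map, map_prod]
    refine Finset.prod_congr rfl fun i _ => ?_
    rw [map_pow, subst_coord]
    rfl
  simp only [map_add, map_sum, map_mul, map_sub, map_pow, subst_coord, hmon,
    subst_graphGerms_lift hr hF (hφ ()), subst_graphGerms_lift hr hF (ha _ _),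
    subst_graphGerms_indep hr hF (hb _)] at hE
  rw [hE, add_sub_cancel_left]
  refine Ideal.sum_mem _ fun i _ => Ideal.mul_mem_right _ _ ?_
  change O.X i ^ N - ∑ j, A i j * F j ∈ Q
  rw [hA, add_sub_cancel_left]
  exact hq i

/-! ### Hadamard's lemma and the coordinates -/

theorem O.comp_comp {l : ℕ} (F : Fin m → O n) (hF : ∀ j, O.ev n (F j) = 0) (G : Fin n → O l)
    (hG : ∀ j, O.ev l (G j) = 0) (hGF : ∀ j, O.ev l (O.comp G hG (F j)) = 0) (g : O m) :
    O.comp G hG (O.comp F hF g) = O.comp (fun j => O.comp G hG (F j)) hGF g := O.ext_rep (by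
  have h : ∀ᶠ x in 𝓝 0, ∀ j, (O.comp G hG (F j)).rep x = (F j).rep (O.toMap G x) :=
    eventually_all.2 fun j => O.rep_comp G hG (F j)
  filter_upwards [O.rep_comp G hG (O.comp F hF g),
    O.rep_comp (fun j => O.comp G hG (F j)) hGF g,
    (O.tendsto_toMap hG).eventually (O.rep_comp F hF g), h] with x h1 h2 h3 h4
  rw [h1, h2, h3]
  congr 1
  ext j
  exact (h4 j).symm)

theorem O.comp_id (g : O n) : O.comp O.X O.ev_X g = g := O.ext_rep (by
  have h : ∀ᶠ x in 𝓝 (0 : Fin n → ℂ), ∀ j, (O.X j).rep x = x j := eventually_all.2 O.rep_X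
  filter_upwards [O.rep_comp O.X O.ev_X g, h] with x h1 h2
  rw [h1]
  congr 1
  exact funext h2)

/-- The substitution `x_i = 0`, `i ∈ s`. -/
def zeroSub (s : Finset (Fin n)) : O n →ₐ[ℂ] O n :=
  O.comp (fun j => if j ∈ s then 0 else O.X j) fun j => by
    split_ifs
    · exact map_zero _
    · exact O.ev_X j

theorem zeroSub_X (s : Finset (Fin n)) (j : Fin n) :
    zeroSub s (O.X j) = if j ∈ s then 0 else O.X j := O.comp_X _ _ j

theorem zeroSub_empty (g : O n) : zeroSub ∅ g = g := by
  have := O.comp_id g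
  simpa [zeroSub] using this

theorem zeroSub_univ (g : O n) : zeroSub Finset.univ g = algebraMap ℂ (O n) (O.ev n g) :=
  O.ext_rep (by
  filter_upwards [O.rep_comp (fun j : Fin n => if j ∈ Finset.univ then 0 else O.X j) (fun j => by simp) g,
    O.rep_algebraMap (n := n) (O.ev n g), O.rep_zero (n := n)] with x h1 h2 h3
  rw [h2, O.ev_apply]
  refine h1.trans ?_
  congr 1
  ext j
  simp [O.toMap, h3])

theorem zeroSub_insert (i : Fin n) (s : Finset (Fin n)) (g : O n) :
    zeroSub (insert i s) g = zeroSub s (zeroSub {i} g) := by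
  have h : ∀ j, zeroSub s (if j ∈ ({i} : Finset (Fin n)) then 0 else O.X j) =
      if j ∈ insert i s then 0 else O.X j := by
    intro j
    by_cases hj : j = i
    · simp [hj]
    · simp [hj, zeroSub_X]
  symm
  unfold zeroSub
  rw [O.comp_comp]
  · congr 1
    congr 1
    ext1 j
    exact h j
  · intro j
    rw [show O.comp _ _ _ = _ from h j]
    split_ifs
    · exact map_zero _
    · exact O.ev_X j

/-- Hadamard's lemma in one variable. -/
theorem exists_sub_zeroSub_eq (i : Fin n) (g : O n) : ∃ q, g - zeroSub {i} g = O.X i * q := by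
  obtain ⟨ε, hε, h⟩ := exists_val_eq_of_analyticAt g.rep_analyticAt
  let r : Fin n → ℝ := fun _ => ε
  have hr : ∀ i, 0 < r i := fun _ => hε
  obtain ⟨w, hw⟩ := h r fun _ => le_rfl
  have hid : ∀ᶠ x in 𝓝 (0 : Fin n → ℂ), (fun j => (O.X j).rep x) = x :=
    (eventually_all.2 O.rep_X : ∀ᶠ x in 𝓝 (0 : Fin n → ℂ), ∀ j, (O.X j).rep x = x j).mono
      fun x hx => funext hx
  refine ⟨subst hr O.ev_X (divCoord hr i w), ?_⟩
  have h1 := congrArg (subst hr O.ev_X) (coord_mul_divCoord hr i w)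
  rw [map_mul, subst_coord, map_sub] at h1
  rw [h1]
  congr 1
  · symm
    refine subst_eq hr _ _ ?_
    filter_upwards [hid] with x hx hmem
    rw [hx] at hmem ⊢
    exact hw x hmem
  · symm
    refine subst_eq hr _ _ ?_
    have hF : ∀ j : Fin n, O.ev n (if j ∈ ({i} : Finset (Fin n)) then 0 else O.X j) = 0 := fun j => by
      split_ifs
      · exact map_zero _
      · exact O.ev_X j
    filter_upwards [hid, O.rep_comp (fun j : Fin n => if j ∈ ({i} : Finset (Fin n)) then 0 else O.X j) hF g,
      O.rep_zero (n := n)] with x hx h2 h3 hmem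
    rw [hx] at hmem ⊢
    refine Eq.trans ?_ h2.symm
    rw [val_zeroAt hr i w hmem, hw _ (update_mem hmem (by simpa using hε.le))]
    congr 1
    ext j
    by_cases hj : j = i
    · subst hj; simp [O.toMap, h3]
    · simp [O.toMap, hj, ← congrFun hx j]

/-- The one-variable Hadamard lemma, applied to one coordinate of s after another. -/
theorem sub_zeroSub_mem (s : Finset (Fin n)) (g : O n) :
    g - zeroSub s g ∈ Ideal.span (O.X '' (s : Set (Fin n))) := by
  induction s using Finset.induction_on generalizing g with
  | empty => rw [zeroSub_empty, sub_self]; exact zero_mem _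
  | insert i s hi ih =>
    obtain ⟨q, hq⟩ := exists_sub_zeroSub_eq i g
    rw [zeroSub_insert, ← sub_add_sub_cancel g (zeroSub {i} g), hq]
    refine add_mem (Ideal.mul_mem_right _ _ (Ideal.subset_span ⟨i, by simp, rfl⟩)) ?_
    exact Ideal.span_mono (Set.image_mono (by simp)) (ih _)

theorem mem_span_X_iff (s : Finset (Fin n)) (g : O n) :
    g ∈ Ideal.span (O.X '' (s : Set (Fin n))) ↔ zeroSub s g = 0 := by
  refine ⟨fun h => ?_, fun h => by simpa [h] using sub_zeroSub_mem s g⟩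
  suffices hle : Ideal.span (O.X '' (s : Set (Fin n))) ≤ RingHom.ker (zeroSub s) from hle h
  rw [Ideal.span_le]
  rintro _ ⟨i, hi, rfl⟩
  have : i ∈ s := hi
  simp [zeroSub_X, this]

theorem maximalIdeal_eq_span : IsLocalRing.maximalIdeal (O n) = Ideal.span (Set.range O.X) := by
  have h := mem_span_X_iff (n := n) Finset.univ
  rw [Finset.coe_univ, Set.image_univ] at h
  ext g
  rw [O.mem_maximalIdeal, h, zeroSub_univ, map_eq_zero_iff _ (algebraMap ℂ (O n)).injective]

theorem O.X_ne_zero (i : Fin n) : O.X i ≠ 0 := by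
  intro h
  have := pderiv_X i i
  rw [h, ← pd_apply, map_zero, if_pos rfl] at this
  exact zero_ne_one this

/-- The coordinates form a regular sequence. -/
theorem mem_span_X_of_X_mul_mem {s : Finset (Fin n)} {i : Fin n} (hi : i ∉ s) {u : O n}
    (h : O.X i * u ∈ Ideal.span (O.X '' (s : Set (Fin n)))) :
    u ∈ Ideal.span (O.X '' (s : Set (Fin n))) := by
  rw [mem_span_X_iff] at *
  rw [map_mul, zeroSub_X, if_neg hi] at h
  exact (mul_eq_zero.1 h).resolve_left (O.X_ne_zero i)

/-! ### Zeros of ideals -/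

/-- The order of vanishing at t = 0 is finite. Otherwise d = t^j D^j d for all j, where D is
division by t. As |t| ≤ r/4 at z and ‖D‖ ≤ 2/r, the value of d at z would be at most 2^(-j)‖d‖ for
every j, and could not be 1. -/
theorem exists_eq_coord_pow_mul {r : Fin n ⊕ Fin 1 → ℝ} (hr : ∀ i, 0 < r i) {d : PAlg r}
    (hd : d ∈ indep hr (leftVars n 1)) {z : Fin n ⊕ Fin 1 → ℂ} (hz : z ∈ polydisc r)
    (hzt : ‖z (Sum.inr 0)‖ ≤ r (Sum.inr 0) / 4) (hd1 : val d z = 1) :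
    ∃ j, ∃ d', d = coord r (Sum.inr 0) ^ j * d' ∧ val d' 0 ≠ 0 := by
  by_contra! hcon
  have hne : ∀ i ∈ leftVars n 1, Sum.inr 0 ≠ i := by simp
  have hmem : ∀ j : ℕ, (divCoord hr (Sum.inr 0) ^ j) d ∈ indep hr (leftVars n 1) := by
    intro j
    induction j with
    | zero => simpa using hd
    | succ j ih =>
      intro i hi
      rw [pow_succ', mul_apply_eq_comp]
      exact zeroAt_divCoord hr (hne i hi) (ih i hi)
  have key : ∀ j : ℕ, d = coord r (Sum.inr 0) ^ j * (divCoord hr (Sum.inr 0) ^ j) d := by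
    intro j
    induction j with
    | zero => simp
    | succ j ih =>
      have hz : zeroAt hr (Sum.inr 0) ((divCoord hr (Sum.inr 0) ^ j) d) = 0 := by
        apply ext_val
        intro x hx
        have hx0 := update_mem hx (i := Sum.inr 0) (z := 0) (by simpa using (hr _).le)
        rw [val_zeroAt hr _ _ hx, val_zero, ← val_indep hr _ (hmem j) hx0]
        refine Eq.trans (congrArg _ (funext fun i => ?_)) (hcon j _ ih)
        rcases i with i | i
        · simp
        · simp [Subsingleton.elim i 0]
      have := coord_mul_divCoord hr (Sum.inr 0) ((divCoord hr (Sum.inr 0) ^ j) d)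
      rw [hz, sub_zero] at this
      rw [pow_succ, mul_assoc, pow_succ' (divCoord hr (Sum.inr 0)), mul_apply_eq_comp, this]
      exact ih
  have hrpos := hr (Sum.inr 0)
  have hn : ∀ j : ℕ, ‖(divCoord hr (Sum.inr 0) ^ j) d‖ ≤ (2 / r (Sum.inr 0)) ^ j * ‖d‖ := by
    intro j
    induction j with
    | zero => simp
    | succ j ih =>
      rw [pow_succ', mul_apply_eq_comp, pow_succ', mul_assoc]
      exact (ContinuousLinearMap.le_opNorm _ _).trans
        (mul_le_mul (norm_divCoord_le hr _) ih (norm_nonneg _) (by positivity))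
  have hb : ∀ j : ℕ, 1 ≤ (1 / 2 : ℝ) ^ j * ‖d‖ := by
    intro j
    have h1 := congrArg norm (congrArg (fun w => val w z) (key j))
    rw [val_mul, val_pow _ _ hz, val_coord _ hz, norm_mul, norm_pow, hd1, norm_one] at h1
    calc (1 : ℝ) = _ := h1
      _ ≤ (r (Sum.inr 0) / 4) ^ j * ((2 / r (Sum.inr 0)) ^ j * ‖d‖) :=
          mul_le_mul (pow_le_pow_left₀ (norm_nonneg _) hzt j) ((norm_val_le _ _).trans (hn j))
            (norm_nonneg _) (by positivity)
      _ = _ := by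
          rw [← mul_assoc, ← mul_pow]
          congr 2
          field_simp
          norm_num
  have hlim : Tendsto (fun j : ℕ => (1 / 2 : ℝ) ^ j * ‖d‖) atTop (𝓝 (0 * ‖d‖)) :=
    (tendsto_pow_atTop_nhds_zero_of_lt_one (by norm_num) (by norm_num)).mul_const _
  have := ge_of_tendsto' hlim hb
  norm_num at this

/-- If `g` generates an ideal of finite colength modulo the prime ideal `Q` and `g ∉ Q`, then `g`
does not vanish on the zero set of `Q`. -/
theorem frequently_ne_zero {s : ℕ} (q : Fin s → O n) (g : O n) (hg0 : O.ev n g = 0)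
    [hQ : (Ideal.span (Set.range q)).IsPrime] (hg : g ∉ Ideal.span (Set.range q)) {N : ℕ}
    (hN : 0 < N) (hX : ∀ i, O.X i ^ N ∈ Ideal.span (Set.range q) ⊔ Ideal.span {g}) :
    ∃ᶠ x in 𝓝 0, (∀ l, (q l).rep x = 0) ∧ g.rep x ≠ 0 := by
  have h' : ∀ i, ∃ A : Fin s → O n, ∃ B, O.X i ^ N = ∑ l, A l * q l + B * g := by
    intro i
    obtain ⟨a, ha, b, hb, hs⟩ := Submodule.mem_sup.1 (hX i)
    obtain ⟨A, hA⟩ := (Ideal.mem_span_range_iff_exists_fun).1 ha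
    obtain ⟨B, hB⟩ := Ideal.mem_span_singleton'.1 hb
    exact ⟨A, B, by rw [hA, hB, hs]⟩
  choose A B hAB using h'
  intro hcon
  have hpt : ∀ᶠ x in 𝓝 (0 : Fin n → ℂ), ∀ i,
      x i ^ N = ∑ l, (A i l).rep x * (q l).rep x + (B i).rep x * g.rep x := by
    refine eventually_all.2 fun i => ?_
    have h1 : ∀ᶠ x in 𝓝 (0 : Fin n → ℂ), ∀ l,
        (A i l * q l).rep x = (A i l).rep x * (q l).rep x :=
      eventually_all.2 fun l => O.rep_mul _ _
    filter_upwards [O.rep_X i, O.rep_pow (O.X i) N, h1,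
      O.rep_sum Finset.univ fun l => A i l * q l, O.rep_mul (B i) g,
      O.rep_add (∑ l, A i l * q l) (B i * g)] with x h1 h2 h3 h4 h5 h6
    rw [← h1, ← h2, hAB, h6, Pi.add_apply, h4, h5, Pi.mul_apply]
    simp only [h3]
  obtain ⟨r, hr, φ, b, hφ, hb, hU, hdiv⟩ := exists_polydisc_division (m := 1)
    (Sum.elim q (Sum.elim (fun _ : Unit => g) fun p : Fin n × Fin s => A p.1 p.2)) (fun i _ => B i)
    (hpt.and hcon) hN
  set q' : Fin s → PAlg r := fun l => φ (Sum.inl l) with hq'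
  set g' : PAlg r := φ (Sum.inr (Sum.inl ())) with hg'
  set A' : Fin n → Fin s → PAlg r := fun i l => φ (Sum.inr (Sum.inr (i, l))) with hA'
  set t : PAlg r := coord r (Sum.inr 0) with ht
  -- The ideal of the graph t = g over the zero set of Q. The divisors x_i^N - Bᵢt lie in it, so the
  -- quotient is finite over the functions of t.
  set 𝔞 : Ideal (PAlg r) := Ideal.span (Set.range q') ⊔ Ideal.span {g' - t} with h𝔞
  let T := indep hr (leftVars n 1)
  have htT : t ∈ T := by
    intro i hi
    obtain ⟨j, -, rfl⟩ := Finset.mem_map.1 hi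
    exact zeroAt_coord_of_ne hr (by simp)
  have hgen : ∀ w, ∃ u ∈ lowDegree hr N (leftVars n 1), w - u ∈ 𝔞 := by
    intro w
    obtain ⟨u, hu, v, hv⟩ := hdiv w
    refine ⟨u, hu, ?_⟩
    rw [hv, add_sub_cancel_left]
    refine Ideal.sum_mem _ fun i _ => Ideal.mul_mem_right _ _ ?_
    have : coord r (Sum.inl i) ^ N - ∑ j, b i j * coord r (Sum.inr j) =
        ∑ l, A' i l * q' l + b i 0 * (g' - t) := by
      apply ext_val
      intro z hz
      rw [val_sub, val_pow _ _ hz, val_coord _ hz, val_sum, val_add, val_sum, val_mul, val_sub]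
      simp only [val_mul, hA', hq', hφ _ z hz, hg', Sum.elim_inl, Sum.elim_inr, hb _ _ z hz,
        Fin.sum_univ_one, ht]
      have := (hU z hz).1 i
      simp only [Function.comp_apply] at this
      rw [this]
      ring
    rw [this]
    refine add_mem ?_ ?_
    · exact Ideal.mem_sup_left (Ideal.sum_mem _ fun l _ => Ideal.mul_mem_left _ _
        (Ideal.subset_span ⟨l, rfl⟩))
    · exact Ideal.mem_sup_right (Ideal.mul_mem_left _ _ (Ideal.mem_span_singleton_self _))
  -- A nonzero value that g is assumed to omit on the zero set. The quarter of the radius is what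
  -- `exists_eq_coord_pow_mul` allows.
  set τ : ℂ := ((r (Sum.inr 0) / 4 : ℝ) : ℂ) with hτ
  have hr0 := hr (Sum.inr 0)
  have hτ0 : τ ≠ 0 := by
    rw [hτ]
    exact_mod_cast (div_pos hr0 (by norm_num)).ne'
  -- A common zero would be a zero of Q where g = τ ≠ 0, contrary to `hcon`.
  have htop : 𝔞 ⊔ Ideal.span {t - algebraMap ℂ (PAlg r) τ} = ⊤ := by
    by_contra hne
    obtain ⟨z, hz, hzero⟩ := exists_zero_of_ne_top hr hne
    have h1 : ∀ l, (q l).rep (z ∘ Sum.inl) = 0 := by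
      intro l
      have := hzero (q' l) (Ideal.mem_sup_left (Ideal.mem_sup_left (Ideal.subset_span ⟨l, rfl⟩)))
      rwa [hq', hφ _ z hz] at this
    have h2 : g.rep (z ∘ Sum.inl) = z (Sum.inr 0) := by
      have := hzero (g' - t) (Ideal.mem_sup_left (Ideal.mem_sup_right
        (Ideal.mem_span_singleton_self _)))
      rw [val_sub, hg', hφ _ z hz, ht, val_coord _ hz] at this
      exact sub_eq_zero.1 this
    have h3 : z (Sum.inr 0) = τ := by
      have := hzero _ (Ideal.mem_sup_right (Ideal.mem_span_singleton_self _))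
      rw [val_sub, ht, val_coord _ hz, Algebra.algebraMap_eq_smul_one, val_smul, val_one hz,
        mul_one] at this
      exact sub_eq_zero.1 this
    exact (hU z hz).2 ⟨h1, by rw [h2, h3]; exact hτ0⟩
  -- the determinant trick over the functions of the last variable
  have hfg : (⊤ : Submodule T (PAlg r ⧸ 𝔞)).FG := by
    refine Submodule.fg_def.2
      ⟨Set.range fun k => Ideal.Quotient.mk 𝔞 (monom r N (leftVars n 1) k), Set.finite_range _, ?_⟩
    rw [eq_top_iff]
    rintro w -
    obtain ⟨w, rfl⟩ := Ideal.Quotient.mk_surjective w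
    obtain ⟨u, hu, hwu⟩ := hgen w
    rw [Ideal.Quotient.eq.2 hwu]
    obtain ⟨c, hc, rfl⟩ := exists_eq_sum_of_mem_lowDegree hr hu
    rw [map_sum]
    refine Submodule.sum_mem _ fun k _ => ?_
    have : Ideal.Quotient.mk 𝔞 (c k * monom r N (leftVars n 1) k) =
        (⟨c k, hc k⟩ : T) • Ideal.Quotient.mk 𝔞 (monom r N (leftVars n 1) k) := rfl
    rw [this]
    exact Submodule.smul_mem _ _ (Submodule.subset_span ⟨k, rfl⟩)
  let p : T := ⟨t, htT⟩ - algebraMap ℂ T τ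
  -- Multiplication by t - τ is surjective on a finite module, so a function d of t with d(τ) = 1
  -- annihilates the quotient, that is, d lies in 𝔞.
  obtain ⟨d, hd1, hd2⟩ := Submodule.exists_sub_one_mem_and_smul_eq_zero_of_fg_of_le_smul
    (Ideal.span {p}) (⊤ : Submodule T (PAlg r ⧸ 𝔞)) hfg (by
      rintro w -
      obtain ⟨w, rfl⟩ := Ideal.Quotient.mk_surjective w
      have hw : w ∈ 𝔞 ⊔ Ideal.span {t - algebraMap ℂ (PAlg r) τ} := htop ▸ Submodule.mem_top
      obtain ⟨a, ha, c, hc, rfl⟩ := Submodule.mem_sup.1 hw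
      obtain ⟨e, rfl⟩ := Ideal.mem_span_singleton.1 hc
      rw [map_add, Ideal.Quotient.eq_zero_iff_mem.2 ha, zero_add]
      exact Submodule.smul_mem_smul (Ideal.mem_span_singleton_self p)
        (Submodule.mem_top (x := Ideal.Quotient.mk 𝔞 e)))
  have hd𝔞 : (d : PAlg r) ∈ 𝔞 := by
    have := hd2 (Ideal.Quotient.mk 𝔞 1) Submodule.mem_top
    have h2 : Ideal.Quotient.mk 𝔞 ((d : PAlg r) * 1) = 0 := this
    rwa [mul_one, Ideal.Quotient.eq_zero_iff_mem] at h2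
  let z₀ : Fin n ⊕ Fin 1 → ℂ := Sum.elim 0 fun _ => τ
  have hτn : ‖τ‖ = r (Sum.inr 0) / 4 := by
    rw [hτ, Complex.norm_real, Real.norm_eq_abs, abs_of_pos (by positivity)]
  have hz₀ : z₀ ∈ polydisc r := by
    rintro (i | i)
    · simpa [z₀] using (hr _).le
    · rw [Subsingleton.elim i 0]
      change ‖τ‖ ≤ _
      rw [hτn]; linarith
  have hdz : val (d : PAlg r) z₀ = 1 := by
    obtain ⟨c, hc⟩ := Ideal.mem_span_singleton.1 hd1
    have h2 : (d : PAlg r) - 1 = (t - algebraMap ℂ (PAlg r) τ) * (c : PAlg r) :=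
      congrArg (Subtype.val : T → PAlg r) hc
    have h3 := congrArg (fun w => val w z₀) h2
    simp only [val_sub, val_mul, val_one hz₀, ht, val_coord _ hz₀,
      Algebra.algebraMap_eq_smul_one, val_smul] at h3
    have : z₀ (Sum.inr 0) = τ := rfl
    rw [this, mul_one, sub_self, zero_mul] at h3
    exact sub_eq_zero.1 h3
  -- Substituting t = g maps 𝔞 into Q and turns d = t^j d' into g^j times a unit. This contradicts
  -- that Q is a prime not containing g.
  obtain ⟨j, d', hdd', hd'0⟩ := exists_eq_coord_pow_mul hr d.2 hz₀ hτn.le hdz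
  have hF : ∀ _ : Fin 1, O.ev n g = 0 := fun _ => hg0
  let E := subst hr (ev_graphGerms (F := fun _ => g) hF)
  have hE𝔞 : 𝔞 ≤ (Ideal.span (Set.range q)).comap E := by
    rw [h𝔞, sup_le_iff, Ideal.span_le, Ideal.span_le]
    constructor
    · rintro _ ⟨l, rfl⟩
      have : E (q' l) = q l := subst_graphGerms_lift hr hF (hφ (Sum.inl l))
      refine Ideal.mem_comap.2 ?_
      rw [this]
      exact Ideal.subset_span ⟨l, rfl⟩
    · rintro _ rfl
      have h1 : E g' = g := subst_graphGerms_lift hr hF (hφ (Sum.inr (Sum.inl ())))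
      have h2 : E t = g := subst_coord hr _ _
      refine Ideal.mem_comap.2 ?_
      rw [map_sub, h1, h2, sub_self]
      exact zero_mem _
  have hEd : g ^ j * E d' ∈ Ideal.span (Set.range q) := by
    have h1 : E (d : PAlg r) ∈ Ideal.span (Set.range q) := hE𝔞 hd𝔞
    have h2 : E t = g := subst_coord hr _ _
    rwa [hdd', map_mul, map_pow, h2] at h1
  have hunit : IsUnit (E d') := by
    rw [O.isUnit_iff, O.ev_apply, (rep_subst hr _ d').eq_of_nhds]
    have : (fun i => (graphGerms (fun _ : Fin 1 => g) i).rep 0) = 0 :=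
      funext fun i => ev_graphGerms hF i
    rwa [this]
  rcases hQ.mem_or_mem hEd with h1 | h1
  · exact hg (hQ.mem_of_pow_mem _ h1)
  · exact hQ.ne_top (Ideal.eq_top_of_isUnit_mem _ h1 hunit)

end BruceRoberts

/-! ### Regular sequences, depth and associated primes in Noetherian local rings. -/

namespace LocalDepth

open IsLocalRing

variable {R : Type*} [CommRing R]

/-- Multiplication by `x` is injective on `R / I`. -/
def RegularMod (I : Ideal R) (x : R) : Prop := ∀ u, x * u ∈ I → u ∈ I

/-- The associated primes of `R / I` are the primes of the form `I : u`. -/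
theorem mem_associatedPrimes_quotient_iff [IsNoetherianRing R] {I P : Ideal R} :
    P ∈ associatedPrimes R (R ⧸ I) ↔ P.IsPrime ∧ ∃ u, ∀ a, a ∈ P ↔ a * u ∈ I := by
  rw [AssociatedPrimes.mem_iff, isAssociatedPrime_iff, and_congr_right_iff]
  have h : ∀ u a : R, a ∈ (⊥ : Submodule R (R ⧸ I)).colon {Ideal.Quotient.mk I u} ↔
      a * u ∈ I := fun u a => by
    rw [Submodule.mem_colon_singleton, Submodule.mem_bot, Algebra.smul_def,
      Ideal.Quotient.algebraMap_eq, ← map_mul, Ideal.Quotient.eq_zero_iff_mem]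
  refine fun _ => ⟨?_, ?_⟩
  · rintro ⟨x, rfl⟩
    obtain ⟨u, rfl⟩ := Ideal.Quotient.mk_surjective x
    exact ⟨u, h u⟩
  · rintro ⟨u, hu⟩
    exact ⟨Ideal.Quotient.mk I u, Ideal.ext fun a => (hu a).trans (h u a).symm⟩

theorem exists_associatedPrime [IsNoetherianRing R] {I : Ideal R} {u : R} (hu : u ∉ I) :
    ∃ P ∈ associatedPrimes R (R ⧸ I), ∀ a, a * u ∈ I → a ∈ P := by
  obtain ⟨P, hP, hle⟩ := exists_le_isAssociatedPrime_of_isNoetherianRing R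
    (Ideal.Quotient.mk I u) (fun h => hu (Ideal.Quotient.eq_zero_iff_mem.1 h))
  refine ⟨P, hP, fun a ha => hle ?_⟩
  rw [Submodule.mem_colon_singleton, Submodule.mem_bot, Algebra.smul_def,
      Ideal.Quotient.algebraMap_eq, ← map_mul, Ideal.Quotient.eq_zero_iff_mem]
  exact ha

theorem regularMod_of_forall_notMem [IsNoetherianRing R] {I : Ideal R} {x : R}
    (h : ∀ P ∈ associatedPrimes R (R ⧸ I), x ∉ P) : RegularMod I x := by
  intro u hu
  by_contra hu'
  obtain ⟨P, hP, hle⟩ := exists_associatedPrime hu'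
  exact h P hP (hle x hu)

theorem RegularMod.notMem [IsNoetherianRing R] {I P : Ideal R} {x : R} (h : RegularMod I x)
    (hP : P ∈ associatedPrimes R (R ⧸ I)) : x ∉ P := by
  obtain ⟨hP', u, hu⟩ := mem_associatedPrimes_quotient_iff.1 hP
  intro hx
  have := h u ((hu x).1 hx)
  exact hP'.ne_top ((Ideal.eq_top_iff_one _).2 ((hu 1).2 (by simpa using this)))

theorem le_of_mem_associatedPrimes [IsNoetherianRing R] {I P : Ideal R}
    (hP : P ∈ associatedPrimes R (R ⧸ I)) : I ≤ P := by
  obtain ⟨-, u, hu⟩ := mem_associatedPrimes_quotient_iff.1 hP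
  exact fun a ha => (hu a).2 (Ideal.mul_mem_right _ _ ha)

theorem mem_sup_span_singleton_iff {I : Ideal R} {x u : R} :
    u ∈ I ⊔ Ideal.span {x} ↔ ∃ v, u - x * v ∈ I := by
  rw [Submodule.mem_sup]
  constructor
  · rintro ⟨i, hi, y, hy, rfl⟩
    obtain ⟨v, rfl⟩ := Ideal.mem_span_singleton'.1 hy
    exact ⟨v, by rwa [mul_comm x, add_sub_cancel_right]⟩
  · rintro ⟨v, hv⟩
    exact ⟨_, hv, x * v, Ideal.mul_mem_right _ _ (Ideal.mem_span_singleton_self x), by ring⟩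

/-- If xu ≡ zw modulo I, regularity of z modulo I + (x) gives w ≡ xv, and then x cancels. -/
theorem RegularMod.swap {I : Ideal R} {x z : R} (hx : RegularMod I x)
    (hz : RegularMod (I ⊔ Ideal.span {x}) z) : RegularMod (I ⊔ Ideal.span {z}) x := by
  intro u hu
  obtain ⟨w, hw⟩ := mem_sup_span_singleton_iff.1 hu
  have h1 : z * w ∈ I ⊔ Ideal.span {x} :=
    mem_sup_span_singleton_iff.2 ⟨u, by simpa using I.neg_mem hw⟩
  obtain ⟨v, hv⟩ := mem_sup_span_singleton_iff.1 (hz w h1)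
  refine mem_sup_span_singleton_iff.2 ⟨v, hx _ ?_⟩
  convert I.add_mem hw (I.mul_mem_left z hv) using 1
  ring

variable [IsLocalRing R]

/-- No nonzero element of `R / I` is annihilated by the maximal ideal. -/
def SocleFree (I : Ideal R) : Prop := ∀ u ∉ I, ∃ a ∈ maximalIdeal R, a * u ∉ I

theorem RegularMod.socleFree {I : Ideal R} {x : R} (h : RegularMod I x)
    (hx : x ∈ maximalIdeal R) : SocleFree I := fun u hu => ⟨x, hx, fun h' => hu (h u h')⟩

/-- The relation xu ≡ yv modulo I carries a nonzero socle class u modulo I + (y) to a nonzero socle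
class v modulo I + (x). In terms of the residue field k, both socles are Ext¹(k, R/I). -/
theorem SocleFree.exchange {I : Ideal R} {x y : R} (hx : RegularMod I x) (hy : RegularMod I y)
    (hxm : x ∈ maximalIdeal R) (h : SocleFree (I ⊔ Ideal.span {x})) :
    SocleFree (I ⊔ Ideal.span {y}) := by
  intro u hu
  by_contra! hcon
  obtain ⟨v, hv⟩ := mem_sup_span_singleton_iff.1 (hcon x hxm)
  obtain ⟨a, ha, hav⟩ := h v (by
    rw [mem_sup_span_singleton_iff]
    rintro ⟨w, hw⟩
    refine hu (mem_sup_span_singleton_iff.2 ⟨w, hx _ ?_⟩)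
    convert I.add_mem hv (I.mul_mem_left y hw) using 1
    ring)
  refine hav ?_
  obtain ⟨w, hw⟩ := mem_sup_span_singleton_iff.1 (hcon a ha)
  refine mem_sup_span_singleton_iff.2 ⟨w, hy _ ?_⟩
  convert I.sub_mem (I.mul_mem_left x hw) (I.mul_mem_left a hv) using 1
  ring

variable [IsNoetherianRing R]

/-- Prime avoidance: an associated prime containing the maximal ideal would produce a socle element.
-/
theorem exists_regularMod (s : Finset (Ideal R)) (hs : ∀ I ∈ s, SocleFree I) :
    ∃ z ∈ maximalIdeal R, ∀ I ∈ s, RegularMod I z := by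
  classical
  let T : Set (Ideal R) := ⋃ I ∈ (s : Set (Ideal R)), associatedPrimes R (R ⧸ I)
  have hT : T.Finite := s.finite_toSet.biUnion fun I _ => associatedPrimes.finite R (R ⧸ I)
  have key : ¬ (maximalIdeal R : Set R) ⊆ ⋃ P ∈ T, (P : Set R) := by
    intro h
    have := ((maximalIdeal R).subset_union_prime_finite hT (f := id) ⊥ ⊥ fun P hP _ _ => by
      simp only [T, Set.mem_iUnion] at hP
      obtain ⟨I, -, hP⟩ := hP
      exact hP.1).1 h
    obtain ⟨P, hP, hle⟩ := this
    simp only [T, Set.mem_iUnion] at hP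
    obtain ⟨I, hI, hP⟩ := hP
    obtain ⟨hP', u, hu⟩ := mem_associatedPrimes_quotient_iff.1 hP
    obtain ⟨a, ha, hau⟩ := hs I hI u (fun h => hP'.ne_top
      ((Ideal.eq_top_iff_one _).2 ((hu 1).2 (by simpa using h))))
    exact hau ((hu a).1 (hle ha))
  obtain ⟨z, hz, hzn⟩ := Set.not_subset.1 key
  exact ⟨z, hz, fun I hI => regularMod_of_forall_notMem fun P hP h =>
    hzn (Set.mem_biUnion (Set.mem_biUnion hI hP) h)⟩

/-- The local ring `R / I` admits a regular sequence of length `d`. -/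
def HasDepth : ℕ → Ideal R → Prop
  | 0, _ => True
  | d + 1, I => ∃ x ∈ maximalIdeal R, RegularMod I x ∧ HasDepth d (I ⊔ Ideal.span {x})

/-- The length of a regular sequence drops by one modulo any regular element. -/
theorem HasDepth.exchange {d : ℕ} {I : Ideal R} {x y : R} (hxm : x ∈ maximalIdeal R)
    (hym : y ∈ maximalIdeal R) (hx : RegularMod I x) (hy : RegularMod I y)
    (h : HasDepth d (I ⊔ Ideal.span {x})) : HasDepth d (I ⊔ Ideal.span {y}) := by
  classical
  induction d generalizing I x y with
  | zero => trivial
  | succ d ih =>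
    obtain ⟨w, hwm, hw, hd⟩ := h
    have h1 : SocleFree (I ⊔ Ideal.span {x}) := hw.socleFree hwm
    obtain ⟨z, hzm, hz⟩ := exists_regularMod {I, I ⊔ Ideal.span {x}, I ⊔ Ideal.span {y}} (by
      simp only [Finset.mem_insert, Finset.mem_singleton, forall_eq_or_imp, forall_eq]
      exact ⟨hx.socleFree hxm, h1, h1.exchange hx hy hxm⟩)
    simp only [Finset.mem_insert, Finset.mem_singleton, forall_eq_or_imp, forall_eq] at hz
    obtain ⟨hz, hzx, hzy⟩ := hz
    -- Since z is regular modulo I, I + (x) and I + (y), the induction hypothesis applies twice: w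
    -- is exchanged for z modulo I + (x), then x for y modulo I + (z).
    have h2 := ih hwm hzm hw hzx hd
    rw [sup_right_comm] at h2
    have h3 := ih hxm hym (hx.swap hzx) (hy.swap hzy) h2
    rw [sup_right_comm] at h3
    exact ⟨z, hzm, hzy, h3⟩

theorem HasDepth.quotient {d : ℕ} {I : Ideal R} {y : R} (h : HasDepth (d + 1) I)
    (hym : y ∈ maximalIdeal R) (hy : RegularMod I y) : HasDepth d (I ⊔ Ideal.span {y}) := by
  obtain ⟨x, hxm, hx, hd⟩ := h
  exact hd.exchange hxm hym hx hy

theorem ringKrullDim_add_one_le {P P' : Ideal R} [P.IsPrime] (h : P < P') :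
    ringKrullDim (R ⧸ P') + 1 ≤ ringKrullDim (R ⧸ P) := by
  obtain ⟨a, ha, haP⟩ := SetLike.exists_of_lt h
  refine ringKrullDim_succ_le_of_surjective (Ideal.Quotient.factor h.le)
    (Ideal.Quotient.factor_surjective h.le) (r := Ideal.Quotient.mk P a)
    (mem_nonZeroDivisors_of_ne_zero fun h0 => haP (Ideal.Quotient.eq_zero_iff_mem.1 h0)) ?_
  rw [Ideal.Quotient.factor_mk]
  exact Ideal.Quotient.eq_zero_iff_mem.2 ha

/-- Each regular element x leads from P to a strictly larger prime P', associated to I + (x) and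
containing x. Iterating gives a chain of d steps above P. -/
theorem HasDepth.le_ringKrullDim {d : ℕ} {I P : Ideal R} (h : HasDepth d I)
    (hP : P ∈ associatedPrimes R (R ⧸ I)) : (d : WithBot ℕ∞) ≤ ringKrullDim (R ⧸ P) := by
  induction d generalizing I P with
  | zero =>
    have := hP.1
    simpa using ringKrullDim_nonneg_of_nontrivial
  | succ d ih =>
    obtain ⟨x, hxm, hx, hd⟩ := h
    obtain ⟨hP', u, hu⟩ := mem_associatedPrimes_quotient_iff.1 hP
    -- The elements killed by P modulo I. If U were inside I + (x), regularity of x would give U ⊆ I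
    -- + xU, hence U ⊆ I by Nakayama, although U contains u. An element of U outside I + (x) has an
    -- annihilator containing P and x.
    let U : Ideal R :=
      { carrier := {v | ∀ a ∈ P, a * v ∈ I}
        zero_mem' := by simp
        add_mem' := fun {v w} hv hw a ha => by rw [mul_add]; exact I.add_mem (hv a ha) (hw a ha)
        smul_mem' := fun c v hv a ha => by
          rw [smul_eq_mul, mul_left_comm]; exact I.mul_mem_left c (hv a ha) }
    have hU : ¬ U ≤ I ⊔ Ideal.span {x} := by
      intro hle
      have h1 : U ≤ I ⊔ maximalIdeal R • U := by
        intro v hv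
        obtain ⟨w, hw⟩ := mem_sup_span_singleton_iff.1 (hle hv)
        have hwU : w ∈ U := fun a ha => hx _ (by
          convert I.sub_mem (hv a ha) (I.mul_mem_left a hw) using 1
          ring)
        rw [← sub_add_cancel v (x * w)]
        exact Submodule.add_mem_sup hw (Submodule.smul_mem_smul hxm hwU)
      have h2 := Submodule.le_of_le_smul_of_le_jacobson_bot (IsNoetherian.noetherian U)
        (maximalIdeal_le_jacobson _) h1
      have h3 : u ∈ I := h2 fun a ha => (hu a).1 ha
      exact hP'.ne_top ((Ideal.eq_top_iff_one _).2 ((hu 1).2 (by simpa using h3)))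
    obtain ⟨v, hv, hvn⟩ := Set.not_subset.1 hU
    obtain ⟨P', hPP', hle⟩ := exists_associatedPrime hvn
    have hlt : P < P' := by
      refine lt_of_le_of_ne (fun a ha => hle a (Ideal.mem_sup_left (hv a ha))) ?_
      rintro rfl
      refine hx.notMem hP (hle x (Ideal.mem_sup_right ?_))
      exact Ideal.mul_mem_right _ _ (Ideal.mem_span_singleton_self x)
    have := ringKrullDim_add_one_le hlt
    push_cast
    exact le_trans (by gcongr; exact ih hd hPP') this

/-- If the maximal ideal is not minimal over g, prime avoidance gives a in it outside all minimal
primes of g. A minimal prime of a has height at most 1 and contains g, so it strictly contains a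
minimal prime of g. The latter has height 0, hence is zero, which contradicts g ≠ 0. -/
theorem maximalIdeal_le_radical_span_singleton [IsDomain R] {g : R} (hg : g ≠ 0)
    (h : ∀ P : Ideal R, P.IsPrime → P ≠ ⊥ → g ∈ P) :
    maximalIdeal R ≤ (Ideal.span {g}).radical := by
  by_cases hgtop : Ideal.span {g} = ⊤
  · rw [hgtop, Ideal.radical_top]
    exact le_top
  by_cases hm : maximalIdeal R ∈ (Ideal.span {g}).minimalPrimes
  · rw [Ideal.radical_eq_sInf]
    refine le_sInf fun J hJ => hm.2 ⟨hJ.2, hJ.1⟩ (le_maximalIdeal hJ.2.ne_top)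
  have key : ¬ (maximalIdeal R : Set R) ⊆ ⋃ P ∈ (Ideal.span {g}).minimalPrimes, (P : Set R) := by
    intro hsub
    obtain ⟨P, hP, hle⟩ := ((maximalIdeal R).subset_union_prime_finite
      (Ideal.finite_minimalPrimes_of_isNoetherianRing R _) (f := id) ⊥ ⊥
        fun P hP _ _ => hP.1.1).1 hsub
    refine hm ?_
    rwa [le_antisymm hle (le_maximalIdeal hP.1.1.ne_top)]
  obtain ⟨a, ham, han⟩ := Set.not_subset.1 key
  simp only [Set.mem_iUnion, not_exists] at han
  have ha0 : Ideal.span {a} ≠ ⊤ := fun htop => (mem_maximalIdeal a).1 ham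
    (Ideal.span_singleton_eq_top.1 htop)
  obtain ⟨P, hP⟩ := Ideal.nonempty_minimalPrimes ha0
  have haP : a ∈ P := hP.1.2 (Ideal.mem_span_singleton_self a)
  have := hP.1.1
  have hane : a ≠ 0 := by
    rintro rfl
    obtain ⟨P1, hP1⟩ := Ideal.nonempty_minimalPrimes hgtop
    exact han P1 hP1 P1.zero_mem
  have hgP : g ∈ P := h P hP.1.1 (by rintro rfl; exact hane haP)
  obtain ⟨P1, hP1, hle⟩ := Ideal.exists_minimalPrimes_le
    ((Ideal.span_singleton_le_iff_mem P).2 hgP)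
  have hlt : P1 < P := lt_of_le_of_ne hle (by rintro rfl; exact han P1 hP1 haP)
  have hh : P.height ≤ 1 := Ideal.height_le_one_of_isPrincipal_of_mem_minimalPrimes _ P hP
  have hP1' := hP1.1.1
  have h0 : P1.height < 1 := (Ideal.height_le_iff (n := 1)).1 (by exact_mod_cast hh) P1 hP1' hlt
  rw [Order.lt_one_iff, Ideal.height_eq_zero_iff_eq_bot] at h0
  refine absurd (hP1.1.2 (Ideal.mem_span_singleton_self g)) ?_
  rw [h0]
  exact hg

/-- An element `g` outside the radical of `I` avoids a prime ideal `Q ⊇ I` such that `Q + (g)`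
is primary to the maximal ideal. -/
theorem exists_prime_radical_sup {I : Ideal R} {g : R} (hg : g ∉ I.radical) :
    ∃ Q : Ideal R, Q.IsPrime ∧ I ≤ Q ∧ g ∉ Q ∧
      maximalIdeal R ≤ (Q ⊔ Ideal.span {g}).radical := by
  have hne : {Q : Ideal R | Q.IsPrime ∧ I ≤ Q ∧ g ∉ Q}.Nonempty := by
    rw [Ideal.radical_eq_sInf, Ideal.mem_sInf] at hg
    push Not at hg
    obtain ⟨Q, ⟨h1, h2⟩, h3⟩ := hg
    exact ⟨Q, h2, h1, h3⟩
  -- By maximality of Q among the primes that contain I and avoid g, every nonzero prime of R/Q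
  -- contains g.
  obtain ⟨Q, ⟨hQ, hIQ, hgQ⟩, hmax⟩ := set_has_maximal_iff_noetherian.mpr ‹_› _ hne
  refine ⟨Q, hQ, hIQ, hgQ, ?_⟩
  have hloc : IsLocalRing (R ⧸ Q) := IsLocalRing.of_surjective' (Ideal.Quotient.mk Q)
    Ideal.Quotient.mk_surjective
  have key := maximalIdeal_le_radical_span_singleton (R := R ⧸ Q) (g := Ideal.Quotient.mk Q g)
    (fun h => hgQ (Ideal.Quotient.eq_zero_iff_mem.1 h)) (fun P hP hP0 => by
      by_contra hgP
      have hle : Q ≤ P.comap (Ideal.Quotient.mk Q) := fun a ha => by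
        rw [Ideal.mem_comap, Ideal.Quotient.eq_zero_iff_mem.2 ha]; exact P.zero_mem
      have hQP := hmax (P.comap (Ideal.Quotient.mk Q)) ⟨inferInstance, hIQ.trans hle, hgP⟩
      refine hP0 (eq_bot_iff.2 fun b hb => ?_)
      obtain ⟨b, rfl⟩ := Ideal.Quotient.mk_surjective b
      have : b ∈ Q := by
        by_contra hbQ
        exact hQP (lt_of_le_of_ne hle fun h => hbQ (h ▸ hb))
      exact Ideal.Quotient.eq_zero_iff_mem.2 this)
  intro a ha
  have h1 : Ideal.Quotient.mk Q a ∈ maximalIdeal (R ⧸ Q) := by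
    have := IsLocalHom.of_surjective (Ideal.Quotient.mk Q) Ideal.Quotient.mk_surjective
    rw [mem_maximalIdeal, mem_nonunits_iff]
    intro hu
    exact (mem_maximalIdeal a).1 ha (isUnit_of_map_unit (Ideal.Quotient.mk Q) a hu)
  obtain ⟨k, hk⟩ := key h1
  refine ⟨k, ?_⟩
  rw [← map_pow] at hk
  obtain ⟨c, hc⟩ := Ideal.mem_span_singleton'.1 hk
  obtain ⟨c, rfl⟩ := Ideal.Quotient.mk_surjective c
  rw [← map_mul, Ideal.Quotient.eq] at hc
  exact mem_sup_span_singleton_iff.2 ⟨c, by simpa [mul_comm] using Q.neg_mem hc⟩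

end LocalDepth

/-! ### Noether normalisation, Noetherianity of 𝒪ₙ and the Nullstellensatz. -/

namespace BruceRoberts

variable {n m : ℕ}

open IsLocalRing

/-- If `F` and `Q` together generate an ideal primary to the maximal ideal, then `𝒪ₙ / Q` is a
finite module over `𝒪ₘ`, which acts through `F`. -/
theorem finite_quotient_of_pow_mem (F : Fin m → O n) (hF : ∀ j, O.ev n (F j) = 0) (Q : Ideal (O n))
    {N : ℕ} (hN : 0 < N) (h : ∀ i, O.X i ^ N ∈ Ideal.span (Set.range F) ⊔ Q) :
    let _ := (O.comp F hF).toRingHom.toAlgebra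
    Module.Finite (O m) (O n ⧸ Q) := by
  classical
  intro _
  let e : (Fin n ⊕ Fin m → Fin N) → O n ⧸ Q := fun k =>
    Ideal.Quotient.mk Q (∏ i, O.X i ^ (k (Sum.inl i) : ℕ))
  refine ⟨⟨(Finset.univ.image e), eq_top_iff.2 fun g _ => ?_⟩⟩
  obtain ⟨g, rfl⟩ := Ideal.Quotient.mk_surjective g
  obtain ⟨c, hc⟩ := exists_eq_sum_comp F hF Q hN h g
  have hg : Ideal.Quotient.mk Q g = ∑ k, c k • e k := by
    rw [Ideal.Quotient.eq.2 hc, map_sum]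
    refine Finset.sum_congr rfl fun k _ => ?_
    rw [map_mul]
    rfl
  rw [hg]
  exact Submodule.sum_mem _ fun k _ => Submodule.smul_mem _ _ (Submodule.subset_span (by simp))

theorem exists_pow_mem_of_le_radical {Q : Ideal (O n)}
    (h : maximalIdeal (O n) ≤ Q.radical) : ∃ N, 0 < N ∧ ∀ i, O.X i ^ N ∈ Q := by
  have h1 : ∀ i : Fin n, ∃ N, O.X i ^ N ∈ Q := fun i => h (O.mem_maximalIdeal.2 (O.ev_X i))
  choose N hN using h1
  -- The sum dominates every exponent, and the added 1 keeps it positive even for n = 0.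
  refine ⟨∑ i, N i + 1, Nat.succ_pos _, fun i => Q.pow_mem_of_pow_mem (hN i) ?_⟩
  have := Finset.single_le_sum (f := N) (fun i _ => Nat.zero_le _) (Finset.mem_univ i)
  omega

/-- A nonzero germ does not vanish identically on some line through the origin. -/
theorem exists_line_ne_zero {f : O n} (hf : f ≠ 0) :
    ∃ v : Fin n → ℂ, ¬ ∀ᶠ t : ℂ in 𝓝 0, f.rep (t • v) = 0 := by
  obtain ⟨ε, hε, h⟩ := f.exists_ball
  by_contra! hcon
  refine hf (O.ext_rep ?_)
  filter_upwards [Metric.ball_mem_nhds (0 : Fin n → ℂ) hε, O.rep_zero (n := n)] with v hv h0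
  rw [h0, Pi.zero_apply]
  have hU : Convex ℝ ((fun t : ℂ => t • v) ⁻¹' Metric.ball 0 ε) :=
    (convex_ball (0 : Fin n → ℂ) ε).linear_preimage
      ((LinearMap.toSpanSingleton ℂ (Fin n → ℂ) v).restrictScalars ℝ)
  -- On the convex set of t with tv in the ball, the identity theorem carries the vanishing near t =
  -- 0 to t = 1.
  have key := AnalyticOnNhd.eqOn_zero_of_preconnected_of_eventuallyEq_zero
    (f := fun t : ℂ => f.rep (t • v)) (U := (fun t : ℂ => t • v) ⁻¹' Metric.ball 0 ε) (z₀ := 0)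
    (fun t ht => AnalyticAt.comp (g := f.rep) (f := fun t : ℂ => t • v) (h _ ht)
      ((LinearMap.toSpanSingleton ℂ (Fin n → ℂ) v).toContinuousLinearMap.analyticAt t))
    hU.isPreconnected (by simpa using hε) (hcon v)
  simpa using key (show (1 : ℂ) ∈ _ by simpa using hv)

/-- After a linear change of coordinates, a nonzero germ `f` is a power of a coordinate times a unit
modulo the other coordinates. -/
theorem exists_linear_forms {f : O (n + 1)} (hf : f ≠ 0) :
    ∃ F : Fin n → O (n + 1), (∀ j, O.ev _ (F j) = 0) ∧ ∃ N, 0 < N ∧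
      ∀ i, O.X i ^ N ∈ Ideal.span (Set.range F) ⊔ Ideal.span {f} := by
  obtain ⟨v, hv⟩ := exists_line_ne_zero hf
  by_cases hv0 : v = 0
  · have hu : IsUnit f := O.isUnit_iff.2 fun h0 => hv (by simpa [hv0] using show f.rep 0 = 0 from h0)
    refine ⟨0, fun j => map_zero _, 1, one_pos, fun i => ?_⟩
    rw [Ideal.span_singleton_eq_top.2 hu, sup_top_eq]
    trivial
  obtain ⟨i₀, hi₀⟩ := Function.ne_iff.1 hv0
  rw [Pi.zero_apply] at hi₀
  have han : AnalyticAt ℂ (fun t : ℂ => f.rep (t • v)) 0 := by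
    refine AnalyticAt.comp (g := f.rep) (f := fun t : ℂ => t • v) ?_
      ((LinearMap.toSpanSingleton ℂ (Fin (n + 1) → ℂ) v).toContinuousLinearMap.analyticAt 0)
    simpa using f.rep_analyticAt
  obtain ⟨k, φ, hφ, hφ0, hfφ⟩ := han.exists_eventuallyEq_pow_smul_nonzero_iff.2 hv
  let C := algebraMap ℂ (O (n + 1))
  let Z : O (n + 1) := C (v i₀)⁻¹ * O.X i₀
  have hZ : O.ev _ Z = 0 := by simp only [Z, map_mul, O.ev_X, mul_zero]
  let H : Fin (n + 1) → O (n + 1) := fun i => C (v i) * O.X i₀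
  have hH : ∀ i, O.ev _ (H i) = 0 := fun i => by simp only [H, map_mul, O.ev_X, mul_zero]
  -- G is the linear change of coordinates sending the i₀-axis to the line ℂv, and G' is its
  -- inverse. H is the restriction of G to that axis.
  let G : Fin (n + 1) → O (n + 1) := fun i => H i + if i = i₀ then 0 else O.X i
  have hG : ∀ i, O.ev _ (G i) = 0 := fun i => by
    simp only [G, map_add, hH, zero_add]; split_ifs <;> simp [O.ev_X]
  let G' : Fin (n + 1) → O (n + 1) := fun i => if i = i₀ then Z else O.X i - C (v i) * Z
  have hG' : ∀ i, O.ev _ (G' i) = 0 := fun i => by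
    simp only [G']; split_ifs <;> simp [O.ev_X, hZ]
  have hCc : ∀ (F : Fin (n + 1) → O (n + 1)) (hF : ∀ i, O.ev _ (F i) = 0) (c : ℂ),
      O.comp F hF (C c) = C c := fun F hF c => (O.comp F hF).commutes c
  have hGX : ∀ i, O.comp G' hG' (G i) = O.X i := by
    intro i
    simp only [G, H, map_add, map_mul, hCc, O.comp_X]
    by_cases hi : i = i₀
    · subst hi
      simp only [G', if_true, map_zero, add_zero, Z]
      rw [← mul_assoc, ← map_mul, mul_inv_cancel₀ hi₀, map_one, one_mul]
    · simp only [G', if_neg hi, if_true, O.comp_X]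
      ring
  have hinv : O.comp G' hG' (O.comp G hG f) = f := by
    rw [O.comp_comp G hG G' hG' fun i => by rw [hGX, O.ev_X]]
    simp only [hGX]
    exact O.comp_id f
  let u : O (n + 1) := O.mk (fun x => φ (x i₀)) (by
    refine AnalyticAt.comp (g := φ) (f := fun x : Fin (n + 1) → ℂ => x i₀) hφ ?_
    exact ContinuousLinearMap.analyticAt
      (ContinuousLinearMap.proj (R := ℂ) (φ := fun _ : Fin (n + 1) => ℂ) i₀) 0)
  have hu : IsUnit u := O.isUnit_iff.2 (by rw [O.ev_mk]; exact hφ0)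
  let s : Finset (Fin (n + 1)) := Finset.univ.erase i₀
  have hzG : ∀ i, zeroSub s (G i) = H i := by
    intro i
    have h1 : zeroSub s (C (v i)) = C (v i) := (zeroSub s).commutes _
    simp only [G, H, map_add, map_mul, h1, zeroSub_X]
    by_cases hi : i = i₀ <;> simp [s, hi, zeroSub_X]
  have hzf : zeroSub s (O.comp G hG f) = O.X i₀ ^ k * u := by
    have h1 : zeroSub s (O.comp G hG f) = O.comp H hH f := by
      refine (O.comp_comp G hG _ _ (fun i => ?_) f).trans ?_
      · exact (congrArg (O.ev _) (hzG i)).trans (hH i)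
      · congr 2
        exact funext hzG
    rw [h1]
    refine O.ext_rep ?_
    have h2 : ∀ᶠ x in 𝓝 0, ∀ i, (H i).rep x = v i * x i₀ := by
      refine eventually_all.2 fun i => ?_
      filter_upwards [O.rep_mul (C (v i)) (O.X i₀), O.rep_algebraMap (n := n + 1) (v i),
        O.rep_X i₀] with x h1 h2 h3
      rw [h1, Pi.mul_apply, h2, h3]
    have h3 : Tendsto (fun x : Fin (n + 1) → ℂ => x i₀) (𝓝 0) (𝓝 0) :=
      (continuous_apply i₀).tendsto 0
    filter_upwards [O.rep_comp H hH f, h2, h3.eventually hfφ, O.rep_mul (O.X i₀ ^ k) u,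
      O.rep_pow (O.X i₀) k, O.rep_X i₀, O.rep_mk (fun x => φ (x i₀)) _] with x a1 a2 a3 a4 a5 a6 a7
    rw [a1, a4, Pi.mul_apply, a5, a6, a7]
    rw [sub_zero, smul_eq_mul] at a3
    rw [← a3]
    congr 1
    ext i
    rw [O.toMap, a2, Pi.smul_apply, smul_eq_mul, mul_comm]
  let F : Fin n → O (n + 1) := fun j => G' (i₀.succAbove j)
  have hFmem : ∀ i, i ≠ i₀ → G' i ∈ Ideal.span (Set.range F) ⊔ Ideal.span {f} := by
    intro i hi
    obtain ⟨j, rfl⟩ := Fin.exists_succAbove_eq hi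
    exact Ideal.mem_sup_left (Ideal.subset_span ⟨j, rfl⟩)
  -- On the i₀-axis f ∘ G is x^k times a unit. Transport by G' makes f equal to Z^k times a unit
  -- modulo F.
  have hZk : Z ^ k ∈ Ideal.span (Set.range F) ⊔ Ideal.span {f} := by
    have h1 := Ideal.mem_map_of_mem (O.comp G' hG') (sub_zeroSub_mem s (O.comp G hG f))
    rw [map_sub, hinv, hzf, map_mul, map_pow, O.comp_X, Ideal.map_span] at h1
    have h2 : Ideal.span (O.comp G' hG' '' (O.X '' (s : Set (Fin (n + 1))))) ≤
        Ideal.span (Set.range F) ⊔ Ideal.span {f} := by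
      rw [Ideal.span_le]
      rintro _ ⟨_, ⟨i, hi, rfl⟩, rfl⟩
      rw [O.comp_X]
      exact hFmem i (by simpa [s] using hi)
    have h3 : f ∈ Ideal.span (Set.range F) ⊔ Ideal.span {f} :=
      Ideal.mem_sup_right (Ideal.mem_span_singleton_self f)
    have h4 := sub_mem h3 (h2 h1)
    rw [sub_sub_cancel] at h4
    have h5 : G' i₀ = Z := if_pos rfl
    rw [h5] at h4
    exact (Ideal.mul_unit_mem_iff_mem _ (hu.map (O.comp G' hG'))).1 h4
  -- Modulo the ideal, each Xᵢ is the multiple vᵢZ of Z. The exponent k + 1 instead of k guarantees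
  -- positivity.
  refine ⟨F, fun j => hG' _, k + 1, Nat.succ_pos k, fun i => ?_⟩
  have hXi : O.X i - C (v i) * Z ∈ Ideal.span (Set.range F) ⊔ Ideal.span {f} := by
    by_cases hi : i = i₀
    · have : O.X i - C (v i) * Z = 0 := by
        rw [hi, sub_eq_zero]
        simp only [Z]
        rw [← mul_assoc, ← map_mul, mul_inv_cancel₀ hi₀, map_one, one_mul]
      rw [this]
      exact zero_mem _
    · have h1 := hFmem i hi
      simpa only [G', if_neg hi] using h1
  rw [← Ideal.Quotient.eq_zero_iff_mem, map_pow, Ideal.Quotient.eq.2 hXi, ← map_pow,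
    Ideal.Quotient.eq_zero_iff_mem, mul_pow, pow_succ Z, ← mul_assoc]
  exact Ideal.mul_mem_right _ _ (Ideal.mul_mem_left _ _ hZk)

/-- Induction on n. For a nonzero f in I, the ring 𝒪ₙ₊₁/(f) is finite over 𝒪ₙ, hence Noetherian. So
I is an extension of a finitely generated ideal of the quotient by (f). -/
instance : IsNoetherianRing (O n) := by
  induction n with
  | zero =>
    refine isNoetherianRing_of_surjective ℂ (O 0) (algebraMap ℂ (O 0)) fun g => ⟨O.ev 0 g, ?_⟩
    rw [← zeroSub_univ]
    exact zeroSub_empty g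
  | succ n ih =>
    refine isNoetherianRing_iff_ideal_fg _ |>.2 fun I => ?_
    by_cases hI : I = ⊥
    · rw [hI]; exact Submodule.fg_bot
    obtain ⟨f, hfI, hf⟩ := Submodule.exists_mem_ne_zero_of_ne_bot hI
    obtain ⟨F, hF, N, hN, h⟩ := exists_linear_forms hf
    let _ := (O.comp F hF).toRingHom.toAlgebra
    have hfin : Module.Finite (O n) (O (n + 1) ⧸ Ideal.span {f}) :=
      finite_quotient_of_pow_mem F hF _ hN h
    have h1 : IsNoetherian (O n) (O (n + 1) ⧸ Ideal.span {f}) := isNoetherian_of_isNoetherianRing_of_finite _ _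
    have h2 : IsNoetherian (O (n + 1)) (O (n + 1) ⧸ Ideal.span {f}) := isNoetherian_of_tower (O n) h1
    refine Submodule.fg_of_fg_map_of_fg_inf_ker (Submodule.mkQ (Ideal.span {f}))
      (IsNoetherian.noetherian _) ?_
    rw [Submodule.ker_mkQ, inf_eq_right.2 ((Ideal.span_singleton_le_iff_mem I).2 hfI)]
    exact Submodule.fg_span (Set.finite_singleton f)

/-- The Nullstellensatz for holomorphic germs. -/
theorem vanishingIdeal_le_radical {p : ℕ} (h : Fin p → O n) (h0 : ∀ i, O.ev n (h i) = 0) :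
    vanishingIdeal (zeroSet h) ≤ (componentIdeal h).radical := by
  intro g hg
  by_contra hgr
  have hg0 : O.ev n g = 0 := Eventually.self_of_nhds hg h0
  -- Reduction to a prime Q modulo which g is a parameter. The zeros of Q lie in X because I ⊆ Q, so
  -- g would vanish on them, against `frequently_ne_zero`.
  obtain ⟨Q, hQ, hIQ, hgQ, hrad⟩ := LocalDepth.exists_prime_radical_sup hgr
  obtain ⟨N, hN, hX⟩ := exists_pow_mem_of_le_radical hrad
  obtain ⟨s, q, rfl⟩ := Submodule.fg_iff_exists_fin_generating_family.1 (IsNoetherian.noetherian Q)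
  refine frequently_ne_zero q g hg0 hgQ hN hX ?_
  have hI : ∀ i, ∃ c : Fin s → O n, ∑ l, c l * q l = h i := fun i =>
    Ideal.mem_span_range_iff_exists_fun.1 (hIQ (Ideal.subset_span ⟨i, rfl⟩))
  choose c hc using hI
  have hc' : ∀ᶠ x in 𝓝 0, ∀ i, (h i).rep x = ∑ l, (c i l).rep x * (q l).rep x := by
    refine eventually_all.2 fun i => ?_
    rw [← hc i]
    filter_upwards [O.rep_sum Finset.univ fun l => c i l * q l,
      eventually_all.2 fun l => O.rep_mul (c i l) (q l)] with x h1 h2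
    rw [h1]
    exact Finset.sum_congr rfl fun l _ => h2 l
  filter_upwards [hc', hg] with x h1 h2
  rintro ⟨h3, h4⟩
  exact h4 (h2 fun i => by simp [h1, h3])

end BruceRoberts

/-! ### Krull dimension of quotients by parameters. -/

namespace LocalDepth

open IsLocalRing Pointwise

variable {R : Type*} [CommRing R]

/-- Translates the results on dimensions of supports into results on the rings R/(I + (x)). -/
theorem annihilator_quotSMulTop_quotient (I : Ideal R) (x : R) :
    Module.annihilator R (QuotSMulTop x (R ⧸ I)) = I ⊔ Ideal.span {x} := by
  ext a
  have key : ∀ y : R, (Ideal.Quotient.mk I y : R ⧸ I) ∈ (x • ⊤ : Submodule R (R ⧸ I)) ↔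
      y ∈ I ⊔ Ideal.span {x} := by
    intro y
    rw [Submodule.mem_smul_pointwise_iff_exists, mem_sup_span_singleton_iff]
    constructor
    · rintro ⟨z, -, hz⟩
      obtain ⟨z, rfl⟩ := Ideal.Quotient.mk_surjective z
      exact ⟨z, Ideal.Quotient.eq.1 hz.symm⟩
    · rintro ⟨z, hz⟩
      exact ⟨Ideal.Quotient.mk I z, trivial, (Ideal.Quotient.eq.2 hz).symm⟩
  rw [Module.mem_annihilator]
  constructor
  · intro h
    have := h (Submodule.Quotient.mk (Ideal.Quotient.mk I 1))
    rw [← Submodule.Quotient.mk_smul, Submodule.Quotient.mk_eq_zero] at this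
    refine (key a).1 ?_
    convert this using 1
    rw [← Ideal.Quotient.mk_eq_mk, ← Ideal.Quotient.mk_eq_mk, ← Submodule.Quotient.mk_smul,
      smul_eq_mul, mul_one]
  · intro h m
    obtain ⟨m, rfl⟩ := Submodule.Quotient.mk_surjective _ m
    obtain ⟨m, rfl⟩ := Ideal.Quotient.mk_surjective m
    rw [← Submodule.Quotient.mk_smul, Submodule.Quotient.mk_eq_zero]
    exact (key (a * m)).2 (Ideal.mul_mem_right _ _ h)

theorem supportDim_quotSMulTop_quotient (I : Ideal R) (x : R) :
    Module.supportDim R (QuotSMulTop x (R ⧸ I)) = ringKrullDim (R ⧸ (I ⊔ Ideal.span {x})) := by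
  rw [Module.supportDim_eq_ringKrullDim_quotient_annihilator, annihilator_quotSMulTop_quotient]

theorem ringKrullDim_le_quotient_add_one [IsNoetherianRing R] [IsLocalRing R] (I : Ideal R) {x : R}
    (hx : x ∈ maximalIdeal R) :
    ringKrullDim (R ⧸ I) ≤ ringKrullDim (R ⧸ (I ⊔ Ideal.span {x})) + 1 := by
  rw [← supportDim_quotSMulTop_quotient, ← Module.supportDim_quotient_eq_ringKrullDim]
  exact Module.supportDim_le_supportDim_quotSMulTop_succ hx

theorem ringKrullDim_quotient_add_one_le [IsNoetherianRing R] {I : Ideal R} {x : R}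
    (h : ∀ P ∈ I.minimalPrimes, x ∉ P) :
    ringKrullDim (R ⧸ (I ⊔ Ideal.span {x})) + 1 ≤ ringKrullDim (R ⧸ I) := by
  rw [← supportDim_quotSMulTop_quotient, ← Module.supportDim_quotient_eq_ringKrullDim]
  refine Module.supportDim_quotSMulTop_succ_le_of_notMem_minimalPrimes ?_
  rwa [Ideal.annihilator_quotient]

theorem ringKrullDim_quotient_le_of_le {I J : Ideal R} (h : I ≤ J) :
    ringKrullDim (R ⧸ J) ≤ ringKrullDim (R ⧸ I) :=
  ringKrullDim_le_of_surjective (Ideal.Quotient.factor h) (Ideal.Quotient.factor_surjective h)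

theorem sup_span_range_cons {p : ℕ} (I : Ideal R) (x : R) (h : Fin p → R) :
    I ⊔ Ideal.span (Set.range (Fin.cons x h : Fin (p + 1) → R)) =
      I ⊔ Ideal.span {x} ⊔ Ideal.span (Set.range h) := by
  rw [Fin.range_cons, Ideal.span_insert, sup_assoc]

theorem ringKrullDim_le_quotient_add [IsNoetherianRing R] [IsLocalRing R] {p : ℕ} (I : Ideal R)
    (h : Fin p → R) (hm : ∀ i, h i ∈ maximalIdeal R) :
    ringKrullDim (R ⧸ I) ≤ ringKrullDim (R ⧸ (I ⊔ Ideal.span (Set.range h))) + p := by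
  induction p generalizing I with
  | zero =>
    have : I ⊔ Ideal.span (Set.range h) = I := by simp
    rw [this]
    simp
  | succ p ih =>
    obtain ⟨x, h, rfl⟩ : ∃ x h', h = Fin.cons x h' := ⟨h 0, Fin.tail h, (Fin.cons_self_tail h).symm⟩
    rw [sup_span_range_cons]
    refine (ringKrullDim_le_quotient_add_one I (hm 0)).trans ?_
    rw [Fin.cons_zero]
    push_cast
    rw [← add_assoc]
    gcongr
    exact ih _ h fun i => by simpa using hm i.succ

/-- In a local ring of depth `e + p`, a quotient of dimension `e` by `p` elements has depth `e`. -/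
theorem HasDepth.sup_span_range [IsNoetherianRing R] [IsLocalRing R] {p e : ℕ} {I : Ideal R}
    (h : Fin p → R) (hm : ∀ i, h i ∈ maximalIdeal R) (hI : HasDepth (e + p) I)
    (hd : ringKrullDim (R ⧸ (I ⊔ Ideal.span (Set.range h))) ≤ e) :
    HasDepth e (I ⊔ Ideal.span (Set.range h)) := by
  induction p generalizing I with
  | zero => simpa using hI
  | succ p ih =>
    obtain ⟨x, h, rfl⟩ : ∃ x h', h = Fin.cons x h' := ⟨h 0, Fin.tail h, (Fin.cons_self_tail h).symm⟩
    rw [sup_span_range_cons] at hd ⊢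
    have hm' : ∀ i, h i ∈ maximalIdeal R := fun i => by simpa using hm i.succ
    have hxm : x ∈ maximalIdeal R := hm 0
    -- An associated prime P of I has dimension at least e + p + 1. If it contained x, its dimension
    -- would be at most that of R/(I + (x)). The latter is at most e + p, as p further elements
    -- lower it to e or less.
    refine ih h hm' (HasDepth.quotient hI hxm (regularMod_of_forall_notMem fun P hP hx => ?_)) hd
    have h1 := hI.le_ringKrullDim hP
    have h2 : ringKrullDim (R ⧸ P) ≤ ringKrullDim (R ⧸ (I ⊔ Ideal.span {x})) :=
      ringKrullDim_quotient_le_of_le (sup_le (le_of_mem_associatedPrimes hP)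
        ((Ideal.span_singleton_le_iff_mem P).2 hx))
    have h3 := ringKrullDim_le_quotient_add (I ⊔ Ideal.span {x}) h hm'
    have h4 : ((e + (p + 1) : ℕ) : WithBot ℕ∞) ≤ ((e + p : ℕ) : WithBot ℕ∞) := by
      refine h1.trans (h2.trans (h3.trans ?_))
      push_cast
      gcongr
    have h5 : e + (p + 1) ≤ e + p := by exact_mod_cast h4
    omega

theorem ringKrullDim_quotient_eq_of_le_radical {I J : Ideal R} (h1 : I ≤ J) (h2 : J ≤ I.radical) :
    ringKrullDim (R ⧸ I) = ringKrullDim (R ⧸ J) := by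
  rw [ringKrullDim_quotient, ringKrullDim_quotient]
  have : PrimeSpectrum.zeroLocus (I : Set R) = PrimeSpectrum.zeroLocus J := by
    refine le_antisymm ?_ (PrimeSpectrum.zeroLocus_anti_mono h1)
    rw [← PrimeSpectrum.zeroLocus_radical I]
    exact PrimeSpectrum.zeroLocus_anti_mono h2
  rw [this]

/-- Quotients of dimension zero are primary to the maximal ideal. -/
theorem maximalIdeal_le_radical_of_ringKrullDim_le_zero [IsNoetherianRing R] [IsLocalRing R] {J : Ideal R}
    (h : ringKrullDim (R ⧸ J) ≤ 0) : maximalIdeal R ≤ J.radical := by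
  rw [Ideal.radical_eq_sInf]
  refine le_sInf fun P hP => ?_
  by_contra hlt
  have hP' := hP.2
  have h1 := ringKrullDim_add_one_le
    (lt_of_le_of_ne (le_maximalIdeal hP'.ne_top) fun h => hlt h.ge)
  have h2 : (0 : WithBot ℕ∞) ≤ ringKrullDim (R ⧸ maximalIdeal R) :=
    ringKrullDim_nonneg_of_nontrivial
  have h3 : (1 : WithBot ℕ∞) ≤ 0 := by
    calc (1 : WithBot ℕ∞) = 0 + 1 := by simp
      _ ≤ ringKrullDim (R ⧸ maximalIdeal R) + 1 := by gcongr
      _ ≤ ringKrullDim (R ⧸ J) := h1.trans (ringKrullDim_quotient_le_of_le hP.1)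
      _ ≤ 0 := h
  exact absurd h3 (by decide)

/-- An integral homomorphism does not raise the dimension. -/
theorem ringKrullDim_le_of_isIntegral {T A : Type*} [CommRing T] [CommRing A] (f : T →+* A)
    (hf : f.IsIntegral) : ringKrullDim A ≤ ringKrullDim T := by
  let _ := f.toAlgebra
  have : Algebra.IsIntegral T A := ⟨hf⟩
  refine Order.krullDim_le_of_strictMono
    (fun P => ⟨P.asIdeal.comap (algebraMap T A), inferInstance⟩) fun P Q hPQ => ?_
  exact Ideal.IsIntegral.comap_lt_comap (show P.asIdeal < Q.asIdeal from hPQ)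

end LocalDepth

/-! ### Depth and dimension of an ICIS, generic linear forms. -/

namespace BruceRoberts

variable {n m p : ℕ}

open IsLocalRing LocalDepth

theorem hasDepth_span_X (s : Finset (Fin n)) (k : ℕ) (hs : s.card + k = n) :
    HasDepth k (Ideal.span (O.X '' (s : Set (Fin n)))) := by
  classical
  induction k generalizing s with
  | zero => trivial
  | succ k ih =>
    have hne : s ≠ Finset.univ := by
      rintro rfl
      rw [Finset.card_fin] at hs
      omega
    obtain ⟨i, hi⟩ : ∃ i, i ∉ s := by simpa [Finset.eq_univ_iff_forall] using hne
    refine ⟨O.X i, O.mem_maximalIdeal.2 (O.ev_X i), fun u => mem_span_X_of_X_mul_mem hi, ?_⟩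
    have := ih (insert i s) (by rw [Finset.card_insert_of_notMem hi]; omega)
    rwa [Finset.coe_insert, Set.image_insert_eq, Ideal.span_insert, sup_comm] at this

theorem hasDepth_bot : HasDepth n (⊥ : Ideal (O n)) := by
  have := hasDepth_span_X (n := n) ∅ n (by simp)
  simpa using this

theorem ringKrullDim_le : ringKrullDim (O n) ≤ n := by
  refine (ringKrullDim_le_spanFinrank_maximalIdeal (R := O n)).trans ?_
  have h1 := Submodule.spanFinrank_span_le_ncard_of_finite (R := O n)
    (Set.finite_range (O.X : Fin n → O n))
  have h2 : (Set.range (O.X : Fin n → O n)).ncard ≤ n := by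
    rw [← Set.image_univ]
    refine (Set.ncard_image_le Set.finite_univ).trans ?_
    simp
  have h3 : (maximalIdeal (O n)).spanFinrank ≤ n := by
    rw [maximalIdeal_eq_span]
    exact h1.trans h2
  exact_mod_cast h3

theorem IsICIS.ev_eq_zero {h : Fin p → O n} (hh : IsICIS h) (i : Fin p) : O.ev n (h i) = 0 :=
  hh.map_zero i

theorem componentIdeal_le_vanishingIdeal (h : Fin p → O n) :
    componentIdeal h ≤ vanishingIdeal (zeroSet h) := by
  refine Ideal.span_le.2 ?_
  rintro _ ⟨i, rfl⟩
  exact Eventually.of_forall fun x hx => hx i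

/-- By the Nullstellensatz I(X) lies between I and its radical, so both quotients have the same
dimension. Radicality of I is not needed for this. -/
theorem IsICIS.ringKrullDim_eq {h : Fin p → O n} (hh : IsICIS h) :
    ringKrullDim (O n ⧸ componentIdeal h) = ((n - p : ℕ) : WithBot ℕ∞) := by
  rw [← hh.dim_eq]
  exact ringKrullDim_quotient_eq_of_le_radical (componentIdeal_le_vanishingIdeal h)
    (vanishingIdeal_le_radical h hh.ev_eq_zero)

/-- A complete intersection is Cohen-Macaulay: the n coordinates form a regular sequence, and p
equations that lower the dimension to n - p use up only p of the depth. -/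
theorem IsICIS.hasDepth {h : Fin p → O n} (hh : IsICIS h) :
    HasDepth (n - p) (componentIdeal h) := by
  have h1 : HasDepth (n - p + p) (⊥ : Ideal (O n)) := by
    rw [Nat.sub_add_cancel hh.le]
    exact hasDepth_bot
  have h2 := h1.sup_span_range h (fun i => O.mem_maximalIdeal.2 (hh.ev_eq_zero i)) (by
    rw [bot_sup_eq]
    exact hh.ringKrullDim_eq.le)
  rwa [bot_sup_eq] at h2

/-- An ideal of finite colength is primary to the maximal ideal. -/
theorem maximalIdeal_le_radical_of_idealColength_lt_top {J : Ideal (O n)}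
    (h : idealColength J < ⊤) : maximalIdeal (O n) ≤ J.radical := by
  have hfin : Module.Finite ℂ (O n ⧸ J) := by
    rw [idealColength, cdim, Cardinal.toENat_lt_top] at h
    exact Module.rank_lt_aleph0_iff.1 h
  have : IsArtinianRing (O n ⧸ J) := IsArtinianRing.of_finite ℂ _
  refine maximalIdeal_le_radical_of_ringKrullDim_le_zero ?_
  exact Ring.krullDimLE_iff.1 inferInstance

/-- Positive dimension enters here: depth at least 1 excludes embedded components at the origin. -/
theorem IsICIS.notMem_associatedPrimes {h : Fin p → O n} (hh : IsICIS h) (hpn : p < n)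
    {P : Ideal (O n)} (hP : P ∈ associatedPrimes (O n) (O n ⧸ componentIdeal h)) :
    P ≠ maximalIdeal (O n) := by
  rintro rfl
  have h1 := hh.hasDepth.le_ringKrullDim hP
  have h2 : ringKrullDim (O n ⧸ maximalIdeal (O n)) = 0 :=
    ringKrullDim_eq_zero_of_isField ((Ideal.Quotient.maximal_ideal_iff_isField_quotient _).1
      inferInstance)
  rw [h2] at h1
  have : n - p ≤ 0 := by exact_mod_cast h1
  omega

/-- The ideal I + (minors) is primary to the maximal ideal, so a prime containing it would be the
maximal ideal. -/
theorem IsICIS.exists_minor_notMem {h : Fin p → O n} (hh : IsICIS h) (hpn : p < n)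
    {P : Ideal (O n)} (hP : P ∈ associatedPrimes (O n) (O n ⧸ componentIdeal h)) :
    ∃ e : Fin p ↪o Fin n, (Matrix.of fun i j : Fin p => pderiv (e j) (h i)).det ∉ P := by
  by_contra! hcon
  have hP' := hP.1
  refine hh.notMem_associatedPrimes hpn hP (le_antisymm (le_maximalIdeal hP'.ne_top) ?_)
  refine (maximalIdeal_le_radical_of_idealColength_lt_top hh.finite).trans ?_
  rw [Ideal.IsPrime.radical_le_iff hP']
  refine sup_le (le_of_mem_associatedPrimes hP) (Ideal.span_le.2 ?_)
  rintro _ ⟨e, rfl⟩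
  exact hcon e

/-- The linear form with coefficients `c`. -/
def linForm (c : Fin n → ℂ) : O n := ∑ i, algebraMap ℂ (O n) (c i) * O.X i

theorem ev_linForm (c : Fin n → ℂ) : O.ev n (linForm c) = 0 := by
  simp [linForm, O.ev_X]

theorem pderiv_linForm (c : Fin n → ℂ) (j : Fin n) :
    pderiv j (linForm c) = algebraMap ℂ (O n) (c j) := by
  rw [← pd_apply, linForm, map_sum, Finset.sum_eq_single j]
  · simp [Derivation.leibniz, pd_apply, pderiv_X]
  · intro i _ hi
    simp [Derivation.leibniz, pd_apply, pderiv_X, hi]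
  · simp

/-- A finite set of proper subspaces of `ℂⁿ` does not cover. -/
theorem exists_forall_notMem_subspace {V : Type*} [AddCommGroup V] [Module ℂ V]
    {S : Set (Submodule ℂ V)} (hS : S.Finite) (h : ∀ W ∈ S, W ≠ ⊤) : ∃ c, ∀ W ∈ S, c ∉ W := by
  have key := Subspace.biUnion_ne_univ_of_top_notMem (s := hS.toFinset) (fun ht =>
    h ⊤ (hS.mem_toFinset.1 ht) rfl)
  obtain ⟨c, hc⟩ := (Set.ne_univ_iff_exists_notMem _).1 key
  simp only [Set.mem_iUnion, not_exists] at hc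
  exact ⟨c, fun W hW hcW => hc W (hS.mem_toFinset.2 hW) hcW⟩

/-- The linear forms in an ideal. -/
def linFormsIn (J : Ideal (O n)) : Submodule ℂ (Fin n → ℂ) where
  carrier := {c | linForm c ∈ J}
  zero_mem' := by simp [linForm]
  add_mem' := fun {a b} ha hb => by
    have : linForm (a + b) = linForm a + linForm b := by
      simp [linForm, add_mul, Finset.sum_add_distrib]
    simpa [this] using J.add_mem ha hb
  smul_mem' := fun c a ha => by
    have : linForm (c • a) = algebraMap ℂ (O n) c * linForm a := by
      simp [linForm, Finset.mul_sum, mul_assoc]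
    simpa [this] using J.mul_mem_left (algebraMap ℂ (O n) c) ha

theorem linFormsIn_ne_top {J : Ideal (O n)} (hJ : ¬ maximalIdeal (O n) ≤ J) :
    linFormsIn J ≠ ⊤ := by
  intro h
  apply hJ
  rw [maximalIdeal_eq_span, Ideal.span_le]
  rintro _ ⟨i, rfl⟩
  have h1 : Pi.single i 1 ∈ linFormsIn J := h ▸ Submodule.mem_top
  have h2 : linForm (Pi.single i 1 : Fin n → ℂ) = O.X i := by
    rw [linForm, Finset.sum_eq_single i]
    · simp
    · intro j _ hj
      simp [hj]
    · simp
  exact h2 ▸ h1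

/-- The differential of `g` with entries in the residue field of `P`. -/
def residueDifferential (P : Ideal (O n)) [P.IsPrime] (g : O n) : Fin n → P.ResidueField :=
  fun i => algebraMap (O n) P.ResidueField (pderiv i g)

/-- The linear forms whose differential lies in a given subspace. -/
def linFormsOver (P : Ideal (O n)) [P.IsPrime] (W : Submodule P.ResidueField (Fin n → P.ResidueField)) :
    Submodule ℂ (Fin n → ℂ) where
  carrier := {c | residueDifferential P (linForm c) ∈ W}
  zero_mem' := by
    have : residueDifferential P (linForm (0 : Fin n → ℂ)) = 0 := by
      ext i; simp [residueDifferential, pderiv_linForm]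
    simp [this]
  add_mem' := fun {a b} ha hb => by
    have : residueDifferential P (linForm (a + b)) =
        residueDifferential P (linForm a) + residueDifferential P (linForm b) := by
      ext i; simp [residueDifferential, pderiv_linForm]
    simpa [this] using W.add_mem ha hb
  smul_mem' := fun c a ha => by
    have : residueDifferential P (linForm (c • a)) =
        algebraMap (O n) P.ResidueField (algebraMap ℂ (O n) c) •
          residueDifferential P (linForm a) := by
      ext i; simp [residueDifferential, pderiv_linForm]
    change _ ∈ W
    rw [this]
    exact W.smul_mem _ ha

/-- The differentials of the coordinates are the standard basis, so a proper subspace over the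
residue field misses one of them. -/
theorem linFormsOver_ne_top (P : Ideal (O n)) [P.IsPrime]
    {W : Submodule P.ResidueField (Fin n → P.ResidueField)} (hW : W ≠ ⊤) :
    linFormsOver P W ≠ ⊤ := by
  intro h
  apply hW
  rw [eq_top_iff, ← (Pi.basisFun P.ResidueField (Fin n)).span_eq, Submodule.span_le]
  rintro _ ⟨i, rfl⟩
  have h1 : Pi.single i 1 ∈ linFormsOver P W := h ▸ Submodule.mem_top
  have h2 : residueDifferential P (linForm (Pi.single i 1 : Fin n → ℂ)) =
      Pi.basisFun P.ResidueField (Fin n) i := by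
    ext j
    by_cases hj : j = i
    · subst hj; simp [residueDifferential, pderiv_linForm]
    · simp [residueDifferential, pderiv_linForm, hj]
  exact h2 ▸ h1

theorem IsICIS.linearIndependent {h : Fin p → O n} (hh : IsICIS h) (hpn : p < n)
    {P : Ideal (O n)} [P.IsPrime] (hP : P ∈ associatedPrimes (O n) (O n ⧸ componentIdeal h)) :
    LinearIndependent P.ResidueField fun i => residueDifferential P (h i) := by
  obtain ⟨e, he⟩ := hh.exists_minor_notMem hpn hP
  refine LinearIndependent.of_comp (LinearMap.funLeft P.ResidueField P.ResidueField e) ?_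
  have h1 : (Matrix.of fun i j : Fin p => algebraMap (O n) P.ResidueField
      (pderiv (e j) (h i))).det ≠ 0 := by
    have h2 : (Matrix.of fun i j : Fin p => algebraMap (O n) P.ResidueField (pderiv (e j) (h i))) =
        (algebraMap (O n) P.ResidueField).mapMatrix
          (Matrix.of fun i j : Fin p => pderiv (e j) (h i)) := rfl
    rw [h2, ← RingHom.map_det, Ne, Ideal.algebraMap_residueField_eq_zero]
    exact he
  exact Matrix.linearIndependent_rows_iff_isUnit.2 ((Matrix.isUnit_iff_isUnit_det _).2 h1.isUnit)

theorem ringKrullDim_le_zero_of_mem_minimalPrimes {J : Ideal (O n)}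
    (h : maximalIdeal (O n) ∈ J.minimalPrimes) : ringKrullDim (O n ⧸ J) ≤ 0 := by
  have : Ring.KrullDimLE 0 (O n ⧸ J) := by
    refine Ring.krullDimLE_zero_iff.2 fun P hP => ?_
    have hJ : J ≤ P.comap (Ideal.Quotient.mk J) := fun a ha => by
      rw [Ideal.mem_comap, Ideal.Quotient.eq_zero_iff_mem.2 ha]; exact P.zero_mem
    have h1 : P.comap (Ideal.Quotient.mk J) = maximalIdeal (O n) :=
      le_antisymm (le_maximalIdeal (Ideal.IsPrime.ne_top inferInstance))
        (h.2 ⟨inferInstance, hJ⟩ (le_maximalIdeal (Ideal.IsPrime.ne_top inferInstance)))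
    have h2 : (P.comap (Ideal.Quotient.mk J)).IsMaximal := h1 ▸ inferInstance
    rw [← Ideal.map_comap_of_surjective _ Ideal.Quotient.mk_surjective P]
    exact (Ideal.map_eq_top_or_isMaximal_of_surjective _ Ideal.Quotient.mk_surjective h2).resolve_left
      (by rw [Ideal.map_comap_of_surjective _ Ideal.Quotient.mk_surjective]; exact hP.ne_top)
  exact Ring.krullDimLE_iff.1 this

/-- Generic linear forms are parameters on an ICIS and complete its differential to a matrix which is
invertible at the associated primes. -/
theorem IsICIS.exists_linForms {h : Fin p → O n} (hh : IsICIS h) (hpn : p < n) (j : ℕ)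
    (hj : p + j ≤ n) :
    ∃ c : Fin j → Fin n → ℂ, ∃ G : Fin (p + j) → O n,
      (∀ a, G a ∈ componentIdeal h ∨ ∃ k, G a = linForm (c k)) ∧
      ringKrullDim (O n ⧸ (componentIdeal h ⊔ Ideal.span (Set.range fun k => linForm (c k)))) ≤
        ((n - p - j : ℕ) : WithBot ℕ∞) ∧
      ∀ (P : Ideal (O n)) [P.IsPrime], P ∈ associatedPrimes (O n) (O n ⧸ componentIdeal h) →
        LinearIndependent P.ResidueField fun a => residueDifferential P (G a) := by
  induction j with
  | zero =>
    refine ⟨Fin.elim0, h, fun a => Or.inl (Ideal.subset_span ⟨a, rfl⟩), ?_, fun P _ hP =>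
      hh.linearIndependent hpn hP⟩
    have : componentIdeal h ⊔ Ideal.span (Set.range fun k : Fin 0 =>
        linForm (Fin.elim0 k : Fin n → ℂ)) = componentIdeal h := by simp
    rw [this, Nat.sub_zero]
    exact hh.ringKrullDim_eq.le
  | succ j ih =>
    obtain ⟨c, G, hG, hdim, hli⟩ := ih (by omega)
    set J := componentIdeal h ⊔ Ideal.span (Set.range fun k => linForm (c k)) with hJ
    -- A new form must avoid finitely many proper complex subspaces: the forms in a nonmaximal
    -- minimal prime of J, so that the dimension drops, and the forms whose differential at an
    -- associated prime depends on the previous ones.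
    let S₁ : Set (Submodule ℂ (Fin n → ℂ)) :=
      linFormsIn '' {Q | Q ∈ J.minimalPrimes ∧ Q ≠ maximalIdeal (O n)}
    have hS₁ : S₁.Finite := ((Ideal.finite_minimalPrimes_of_isNoetherianRing _ J).subset
      fun Q hQ => hQ.1).image _
    let V : ∀ P ∈ associatedPrimes (O n) (O n ⧸ componentIdeal h), Submodule ℂ (Fin n → ℂ) :=
      fun P hP => haveI := hP.1
        linFormsOver P (Submodule.span _ (Set.range fun a => residueDifferential P (G a)))
    have hS₂ := (associatedPrimes.finite (O n) (O n ⧸ componentIdeal h)).dependent_image V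
    obtain ⟨c₀, hc₀⟩ := exists_forall_notMem_subspace (hS₁.union hS₂) (by
      rintro W (⟨Q, ⟨hQ, hQm⟩, rfl⟩ | ⟨P, hP, rfl⟩)
      · refine linFormsIn_ne_top fun hle => hQm ?_
        exact le_antisymm (le_maximalIdeal hQ.1.1.ne_top) hle
      · have := hP.1
        refine linFormsOver_ne_top P fun htop => ?_
        -- Only p + j < n vectors are present, too few to span.
        have h1 := finrank_range_le_card (R := P.ResidueField)
          fun a => residueDifferential P (G a)
        rw [Set.finrank, htop, finrank_top, Module.finrank_fin_fun, Fintype.card_fin] at h1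
        omega)
    refine ⟨Fin.cons c₀ c, Fin.cons (linForm c₀) G, ?_, ?_, ?_⟩
    · refine Fin.cases (Or.inr ⟨0, rfl⟩) fun a => ?_
      refine (hG a).imp id ?_
      rintro ⟨k, hk⟩
      exact ⟨k.succ, by simpa using hk⟩
    · have h1 : (fun k => linForm ((Fin.cons c₀ c : Fin (j + 1) → Fin n → ℂ) k)) =
          Fin.cons (linForm c₀) fun k => linForm (c k) := by
        ext1 k
        refine Fin.cases ?_ (fun k => ?_) k <;> simp
      rw [h1, sup_span_range_cons, sup_right_comm, ← hJ]
      -- In this case the quotient already has dimension at most 0 and any form will do.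
      by_cases hm : maximalIdeal (O n) ∈ J.minimalPrimes
      · refine (ringKrullDim_quotient_le_of_le (le_sup_left : J ≤ _)).trans ?_
        refine (ringKrullDim_le_zero_of_mem_minimalPrimes hm).trans ?_
        exact_mod_cast Nat.zero_le _
      · have h2 := ringKrullDim_quotient_add_one_le (I := J) (x := linForm c₀) fun Q hQ hx =>
          hc₀ _ (Or.inl ⟨Q, ⟨hQ, fun h => hm (h ▸ hQ)⟩, rfl⟩) hx
        have h3 := h2.trans hdim
        have h4 : n - p - j = n - p - (j + 1) + 1 := by omega
        rw [h4] at h3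
        push_cast at h3
        exact ENat.WithBot.add_le_add_one_right_iff.1 h3
    · intro P _ hP
      have h1 : (fun a => residueDifferential P ((Fin.cons (linForm c₀) G : Fin (p + (j + 1)) → O n) a)) =
          (Fin.cons (residueDifferential P (linForm c₀)) fun a => residueDifferential P (G a) :
            Fin (p + j + 1) → _) := by
        ext1 k
        refine Fin.cases ?_ (fun k => ?_) k <;> rfl
      have h2 := linearIndependent_finCons.2
        ⟨hli P hP, fun hmem => hc₀ _ (Or.inr ⟨P, hP, rfl⟩) hmem⟩
      rw [← h1] at h2
      exact h2

end BruceRoberts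

/-! ### Differentials and the reducedness of an ICIS. -/

/-- A finite torsion-free algebra over a domain is reduced when a nonzerodivisor annihilates
its differentials. -/
theorem isReduced_of_smul_kaehlerDifferential_eq_zero {T A : Type} [CommRing T] [IsDomain T]
    [CommRing A] [Algebra T A] [Algebra.EssFiniteType T A]
    (hT : ∀ t : T, t ≠ 0 → algebraMap T A t ∈ nonZeroDivisors A) {Δ : A}
    (hΔ : Δ ∈ nonZeroDivisors A) (h : ∀ a, Δ • KaehlerDifferential.D T A a = 0) :
    IsReduced A := by
  -- In the total ring of fractions Q the element Δ is invertible, so all differentials over T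
  -- vanish, and Q is unramified over the fraction field K of T. An unramified algebra essentially
  -- of finite type over a field is reduced, and A embeds in Q.
  let Q := Localization (nonZeroDivisors A)
  let K := FractionRing T
  have hu : ∀ t : nonZeroDivisors T, IsUnit (algebraMap T Q t) := fun t => by
    rw [IsScalarTower.algebraMap_apply T A Q]
    exact IsLocalization.map_units Q ⟨_, hT t (nonZeroDivisors.coe_ne_zero t)⟩
  let _ : Algebra K Q := (IsLocalization.lift (M := nonZeroDivisors T) hu).toAlgebra
  have : IsScalarTower T K Q := IsScalarTower.of_algebraMap_eq' (by
    rw [RingHom.algebraMap_toAlgebra, IsLocalization.lift_comp])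
  have hQ : ∀ a : A, KaehlerDifferential.D T Q (algebraMap A Q a) = 0 := fun a => by
    have h1 : algebraMap A Q Δ • KaehlerDifferential.D T Q (algebraMap A Q a) = 0 := by
      have := congrArg (KaehlerDifferential.map T T A Q) (h a)
      rw [map_zero, LinearMap.map_smul, KaehlerDifferential.map_D] at this
      rwa [algebraMap_smul]
    exact (IsLocalization.map_units Q ⟨Δ, hΔ⟩).smul_eq_zero.1 h1
  have hD : ∀ q : Q, KaehlerDifferential.D T Q q = 0 := fun q => by
    obtain ⟨a, s, rfl⟩ := IsLocalization.exists_mk'_eq (nonZeroDivisors A) q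
    have h1 := congrArg (KaehlerDifferential.D T Q)
      (IsLocalization.mk'_spec Q a s)
    rw [Derivation.leibniz, hQ, hQ, smul_zero, zero_add] at h1
    exact (IsLocalization.map_units Q s).smul_eq_zero.1 h1
  have hunr : Algebra.FormallyUnramified T Q := by
    refine ⟨?_⟩
    have h1 : (⊤ : Submodule Q (Ω[Q⁄T])) = ⊥ := by
      rw [← KaehlerDifferential.span_range_derivation, Submodule.span_eq_bot]
      rintro _ ⟨q, rfl⟩
      exact hD q
    exact (Submodule.subsingleton_iff Q).1 (subsingleton_of_bot_eq_top h1.symm)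
  have h1 : Algebra.FormallyUnramified K Q := Algebra.FormallyUnramified.of_restrictScalars T K Q
  have h2 : Algebra.EssFiniteType K Q := Algebra.EssFiniteType.of_comp T K Q
  have h3 : IsReduced Q := Algebra.FormallyUnramified.isReduced_of_field K Q
  exact isReduced_of_injective (algebraMap A Q) (IsLocalization.injective Q le_rfl)

namespace BruceRoberts

variable {n m p : ℕ}

open IsLocalRing LocalDepth

/-- A derivation into a finite module which kills the coordinates vanishes. -/
theorem derivation_eq_zero {M : Type} [AddCommGroup M] [Module (O n) M] [Module ℂ M]
    [IsScalarTower ℂ (O n) M] [Module.Finite (O n) M] (D : Derivation ℂ (O n) M)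
    (h : ∀ i, D (O.X i) = 0) : D = 0 := by
  -- Writing g = g(0) + ∑ xᵢaᵢ gives Dg = ∑ xᵢDaᵢ, so each iteration gains a power of the maximal
  -- ideal. Krull's intersection theorem for finite modules concludes.
  have key : ∀ (k : ℕ) (g : O n), D g ∈ (maximalIdeal (O n) ^ k • ⊤ : Submodule (O n) M) := by
    intro k
    induction k with
    | zero => intro g; simp
    | succ k ih =>
      intro g
      have h1 : g - algebraMap ℂ (O n) (O.ev n g) ∈ maximalIdeal (O n) :=
        O.mem_maximalIdeal.2 (by simp)
      rw [maximalIdeal_eq_span] at h1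
      obtain ⟨a, ha⟩ := Ideal.mem_span_range_iff_exists_fun.1 h1
      have h2 : D g = ∑ i, O.X i • D (a i) := by
        have h3 := congrArg D ha
        rw [map_sub, D.map_algebraMap, sub_zero, map_sum] at h3
        rw [← h3]
        refine Finset.sum_congr rfl fun i _ => ?_
        rw [D.leibniz, h, smul_zero, zero_add]
      rw [h2]
      refine Submodule.sum_mem _ fun i _ => ?_
      rw [pow_succ', Submodule.mul_smul]
      exact Submodule.smul_mem_smul (O.mem_maximalIdeal.2 (O.ev_X i)) (ih _)
  ext g
  have h1 := Ideal.iInf_pow_smul_eq_bot_of_isLocalRing (M := M) (maximalIdeal (O n))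
    (Ideal.IsPrime.ne_top inferInstance)
  have h2 : D g ∈ (⨅ i : ℕ, maximalIdeal (O n) ^ i • ⊤ : Submodule (O n) M) :=
    (Submodule.mem_iInf _).2 fun k => key k g
  rw [h1] at h2
  simpa using h2

/-- The chain rule for derivations into finite modules. -/
theorem derivation_eq_sum {M : Type} [AddCommGroup M] [Module (O n) M] [Module ℂ M]
    [IsScalarTower ℂ (O n) M] [Module.Finite (O n) M] (D : Derivation ℂ (O n) M) (g : O n) :
    D g = ∑ i, pderiv i g • D (O.X i) := by
  let E : Derivation ℂ (O n) M :=
    ∑ i, ((LinearMap.toSpanSingleton (O n) M (D (O.X i))).compDer (pd i))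
  have hE : ∀ g, E g = ∑ i, pderiv i g • D (O.X i) := fun g => by
    have h1 := congrFun (map_sum (Derivation.coeFnAddMonoidHom (R := ℂ) (A := O n) (M := M))
      (fun i => (LinearMap.toSpanSingleton (O n) M (D (O.X i))).compDer (pd i)) Finset.univ) g
    rw [Finset.sum_apply] at h1
    exact h1
  have h1 := derivation_eq_zero (D - E) fun i => by
    rw [Derivation.sub_apply, hE, Finset.sum_eq_single i]
    · simp [pderiv_X]
    · intro j _ hj
      simp [pderiv_X, hj.symm]
    · simp
  rw [← hE, sub_eq_zero.1 h1]

end BruceRoberts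

theorem Matrix.det_smul_eq_zero_of_sum_smul_eq_zero {ι R M : Type*} [Fintype ι] [DecidableEq ι]
    [CommRing R] [AddCommGroup M] [Module R M] (A : Matrix ι ι R) (v : ι → M)
    (h : ∀ a, ∑ i, A a i • v i = 0) (b : ι) : A.det • v b = 0 := by
  have h1 : ∑ a, A.adjugate b a • ∑ i, A a i • v i = A.det • v b := by
    simp only [Finset.smul_sum, smul_smul]
    rw [Finset.sum_comm]
    simp only [← Finset.sum_smul, ← Matrix.mul_apply, Matrix.adjugate_mul]
    rw [Finset.sum_eq_single b]
    · simp
    · intro i _ hi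
      simp [Matrix.one_apply_ne hi.symm]
    · simp
  rw [← h1]
  simp [h]

namespace BruceRoberts

variable {n m p d : ℕ}

open IsLocalRing LocalDepth

/-- Germs pulled back from a finite projection to a space of dimension at most that of `P`
are not in `P`. -/
theorem comp_notMem_of_le_ringKrullDim (F : Fin d → O n) (hF : ∀ j, O.ev n (F j) = 0)
    {P : Ideal (O n)} [P.IsPrime] {N : ℕ} (hN : 0 < N)
    (hX : ∀ i, O.X i ^ N ∈ Ideal.span (Set.range F) ⊔ P)
    (hd : (d : WithBot ℕ∞) ≤ ringKrullDim (O n ⧸ P)) {t : O d} (ht : t ≠ 0) :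
    O.comp F hF t ∉ P := by
  intro htP
  let _ := (O.comp F hF).toRingHom.toAlgebra
  have hfin : Module.Finite (O d) (O n ⧸ P) := finite_quotient_of_pow_mem F hF P hN hX
  let f : O d →+* O n ⧸ P := algebraMap (O d) (O n ⧸ P)
  have hf : f.IsIntegral := Algebra.IsIntegral.isIntegral
  have htf : t ∈ RingHom.ker f := Ideal.Quotient.eq_zero_iff_mem.2 htP
  have hker : (RingHom.ker f).IsPrime := RingHom.ker_isPrime f
  -- 𝒪ₙ/P is integral over the image of 𝒪_d. If t were in the kernel, that image would have
  -- dimension less than d.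
  have h1 : ringKrullDim (O n ⧸ P) ≤ ringKrullDim (O d ⧸ RingHom.ker f) := by
    refine ringKrullDim_le_of_isIntegral (RingHom.kerLift f) ?_
    exact RingHom.IsIntegral.tower_top (Ideal.Quotient.mk _) _ hf
  have h2 : ringKrullDim (O d ⧸ RingHom.ker f) + 1 ≤ ringKrullDim (O d ⧸ (⊥ : Ideal (O d))) :=
    ringKrullDim_add_one_le (bot_lt_iff_ne_bot.2 fun h => ht (by rw [h] at htf; exact htf))
  have h3 : ringKrullDim (O d ⧸ (⊥ : Ideal (O d))) ≤ d :=
    (ringKrullDim_quotient_le _).trans ringKrullDim_le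
  have h4 : (d : WithBot ℕ∞) + 1 ≤ d :=
    calc (d : WithBot ℕ∞) + 1 ≤ ringKrullDim (O d ⧸ RingHom.ker f) + 1 := by
          gcongr
          exact hd.trans h1
      _ ≤ d := h2.trans h3
  have h5 : d + 1 ≤ d := by exact_mod_cast h4
  omega

theorem mk_mem_nonZeroDivisors {I : Ideal (O n)} {x : O n} (h : RegularMod I x) :
    Ideal.Quotient.mk I x ∈ nonZeroDivisors (O n ⧸ I) := by
  rw [mem_nonZeroDivisors_iff_right]
  intro u hu
  obtain ⟨u, rfl⟩ := Ideal.Quotient.mk_surjective u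
  rw [← map_mul, Ideal.Quotient.eq_zero_iff_mem, mul_comm] at hu
  exact Ideal.Quotient.eq_zero_iff_mem.2 (h u hu)

/-- The determinant of the differentials of germs which are zero or pulled back in `𝒪ₙ / I`
annihilates the relative differentials of `𝒪ₙ / I`. -/
theorem det_smul_kaehlerDifferential (F : Fin d → O n) (hF : ∀ j, O.ev n (F j) = 0)
    (I : Ideal (O n)) {N : ℕ} (hN : 0 < N)
    (hX : ∀ i, O.X i ^ N ∈ Ideal.span (Set.range F) ⊔ I) (G : Fin n → O n)
    (hG : ∀ a, G a ∈ I ∨ ∃ k, G a = F k) :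
    let _ := (O.comp F hF).toRingHom.toAlgebra
    ∀ g : O n ⧸ I, Ideal.Quotient.mk I (Matrix.of fun a i => pderiv i (G a)).det •
      KaehlerDifferential.D (O d) (O n ⧸ I) g = 0 := by
  intro _ g
  have hfin : Module.Finite (O d) (O n ⧸ I) := finite_quotient_of_pow_mem F hF I hN hX
  have hfinΩ : Module.Finite (O n) (Ω[(O n ⧸ I)⁄(O d)]) := Module.Finite.trans (O n ⧸ I) _
  -- The universal derivation, viewed on 𝒪ₙ with values in a finite module so that the chain rule
  -- applies. It kills every G a, which is zero in 𝒪ₙ/I or comes from 𝒪_d. So the differentials of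
  -- the coordinates solve a homogeneous system with the Jacobian matrix of G.
  let D : Derivation ℂ (O n) (Ω[(O n ⧸ I)⁄(O d)]) := Derivation.mk'
    { toFun := fun g => KaehlerDifferential.D (O d) (O n ⧸ I) (Ideal.Quotient.mk I g)
      map_add' := fun a b => by rw [map_add, map_add]
      map_smul' := fun c a => by
        have h1 : Ideal.Quotient.mk I (c • a) =
            algebraMap ℂ (O d) c • Ideal.Quotient.mk I a := by
          rw [Algebra.smul_def, Algebra.smul_def, map_mul, ← (O.comp F hF).commutes c]
          rfl
        rw [h1, Derivation.map_smul, ← algebraMap_smul (O n ⧸ I), RingHom.id_apply,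
          ← algebraMap_smul (O n ⧸ I) c]
        congr 1
        exact congrArg (Ideal.Quotient.mk I) ((O.comp F hF).commutes c) } fun a b => by
      change KaehlerDifferential.D (O d) (O n ⧸ I) (Ideal.Quotient.mk I (a * b)) = _
      rw [map_mul, Derivation.leibniz]
      rfl
  have hD : ∀ g, D g = KaehlerDifferential.D (O d) (O n ⧸ I) (Ideal.Quotient.mk I g) := fun g => rfl
  have key := Matrix.det_smul_eq_zero_of_sum_smul_eq_zero
    (Matrix.of fun a i => pderiv i (G a)) (fun i => D (O.X i)) fun a => by
      have h1 := derivation_eq_sum D (G a)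
      refine h1.symm.trans ?_
      rw [hD]
      obtain h2 | ⟨k, h2⟩ := hG a
      · rw [Ideal.Quotient.eq_zero_iff_mem.2 h2, map_zero]
      · have h3 : Ideal.Quotient.mk I (G a) = algebraMap (O d) (O n ⧸ I) (O.X k) := by
          rw [h2, ← O.comp_X F hF k]
          rfl
        rw [h3, Derivation.map_algebraMap]
  obtain ⟨g, rfl⟩ := Ideal.Quotient.mk_surjective g
  rw [← hD, derivation_eq_sum D g, Finset.smul_sum]
  refine Finset.sum_eq_zero fun i _ => ?_
  rw [smul_comm]
  have h1 : Ideal.Quotient.mk I (Matrix.of fun a i => pderiv i (G a)).det • D (O.X i) = 0 := key i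
  rw [h1, smul_zero]

/-- With d generic linear forms the quotient is finite over 𝒪_d. It is torsion-free because each
associated prime has dimension at least d. The Jacobian determinant of G is a nonzerodivisor because
its rows are independent at each associated prime. -/
theorem IsICIS.isRadical {h : Fin p → O (p + d)} (hh : IsICIS h) (hd : 0 < d) :
    (componentIdeal h).IsRadical := by
  obtain ⟨c, G, hG, hdim, hli⟩ := hh.exists_linForms (by omega) d le_rfl
  let F : Fin d → O (p + d) := fun k => linForm (c k)
  have hF : ∀ k, O.ev _ (F k) = 0 := fun k => ev_linForm _
  rw [Nat.add_sub_cancel_left, Nat.sub_self] at hdim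
  obtain ⟨N, hN, hX⟩ := exists_pow_mem_of_le_radical
    (maximalIdeal_le_radical_of_ringKrullDim_le_zero hdim)
  rw [sup_comm] at hX
  have hdepth := hh.hasDepth
  rw [Nat.add_sub_cancel_left] at hdepth
  have hT : ∀ t : O d, t ≠ 0 → RegularMod (componentIdeal h) (O.comp F hF t) := fun t ht => by
    refine regularMod_of_forall_notMem fun P hP => ?_
    have := hP.1
    exact comp_notMem_of_le_ringKrullDim F hF hN
      (fun i => sup_le_sup_left (le_of_mem_associatedPrimes hP) _ (hX i))
      (hdepth.le_ringKrullDim hP) ht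
  have hΔ : RegularMod (componentIdeal h) (Matrix.of fun a i => pderiv i (G a)).det := by
    refine regularMod_of_forall_notMem fun P hP => ?_
    have := hP.1
    have h1 := (Matrix.linearIndependent_rows_iff_isUnit (A := Matrix.of fun a i =>
      algebraMap _ P.ResidueField (pderiv i (G a)))).1 (hli P hP)
    have h2 : (Matrix.of fun a i => algebraMap _ P.ResidueField (pderiv i (G a))) =
        (algebraMap _ P.ResidueField).mapMatrix (Matrix.of fun a i => pderiv i (G a)) := rfl
    rw [Matrix.isUnit_iff_isUnit_det, h2, ← RingHom.map_det, isUnit_iff_ne_zero, Ne,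
      Ideal.algebraMap_residueField_eq_zero] at h1
    exact h1
  let _ := (O.comp F hF).toRingHom.toAlgebra
  have hfin : Module.Finite (O d) (O (p + d) ⧸ componentIdeal h) :=
    finite_quotient_of_pow_mem F hF _ hN hX
  have hred : IsReduced (O (p + d) ⧸ componentIdeal h) :=
    isReduced_of_smul_kaehlerDifferential_eq_zero (T := O d)
      (fun t ht => mk_mem_nonZeroDivisors (hT t ht)) (mk_mem_nonZeroDivisors hΔ)
      (det_smul_kaehlerDifferential F hF _ hN hX G hG)
  exact (Ideal.isRadical_iff_quotient_reduced _).2 hred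

theorem IsICIS.vanishingIdeal_eq {h : Fin p → O n} (hh : IsICIS h) (hpn : p < n) :
    vanishingIdeal (zeroSet h) = componentIdeal h := by
  obtain ⟨d, rfl⟩ := Nat.exists_eq_add_of_le hpn.le
  refine le_antisymm ?_ (componentIdeal_le_vanishingIdeal h)
  exact (vanishingIdeal_le_radical h hh.ev_eq_zero).trans (hh.isRadical (by omega))

end BruceRoberts

/-! ### Exact sequences, colengths and the Tjurina number. -/

namespace BruceRoberts

variable {n p : ℕ}

theorem cdim_eq_add_of_exact {A B C : Type} [AddCommGroup A] [Module ℂ A] [AddCommGroup B]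
    [Module ℂ B] [AddCommGroup C] [Module ℂ C] (g : A →ₗ[ℂ] B) (f : B →ₗ[ℂ] C)
    (hg : Function.Injective g) (hf : Function.Surjective f)
    (h : Function.Exact g f) : cdim B = cdim A + cdim C := by
  have h1 := LinearMap.rank_range_add_rank_ker f
  rw [LinearMap.range_eq_top.2 hf, rank_top, LinearMap.exact_iff.1 h,
    ← (LinearEquiv.ofInjective g hg).rank_eq] at h1
  rw [cdim, cdim, cdim, ← h1, map_add, add_comm]

theorem cdim_lt_top_iff {V : Type} [AddCommGroup V] [Module ℂ V] :
    cdim V < ⊤ ↔ Module.Finite ℂ V := by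
  rw [cdim, Cardinal.toENat_lt_top, Module.rank_lt_aleph0_iff]

theorem colength_eq_add_relDim {s : ℕ} {A B : Submodule (O n) (Fin s → O n)} (h : B ≤ A) :
    colength B = colength A + relDim A B := by
  rw [add_comm]
  refine cdim_eq_add_of_exact
    ((Submodule.mapQ (B.submoduleOf A) B A.subtype le_rfl).restrictScalars ℂ)
    ((Submodule.factor h).restrictScalars ℂ) ?_ (Submodule.factor_surjective h) ?_
  · refine (injective_iff_map_eq_zero _).2 fun z hz => ?_
    obtain ⟨z, rfl⟩ := Submodule.Quotient.mk_surjective _ z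
    exact (Submodule.Quotient.mk_eq_zero _).2 ((Submodule.Quotient.mk_eq_zero B).1 hz)
  · intro y
    obtain ⟨y, rfl⟩ := Submodule.Quotient.mk_surjective _ y
    constructor
    · intro hy
      have hyA : y ∈ A := (Submodule.Quotient.mk_eq_zero A).1 hy
      exact ⟨Submodule.Quotient.mk ⟨y, hyA⟩, rfl⟩
    · rintro ⟨z, hz⟩
      obtain ⟨z, rfl⟩ := Submodule.Quotient.mk_surjective _ z
      rw [← hz]
      exact (Submodule.Quotient.mk_eq_zero A).2 z.2

/-- The colength of a submodule of `𝒪ₙ ⊕ 𝒪ₙᵖ` is the sum of the colengths of its intersection with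
the first summand and of its projection to the second. -/
theorem colength_eq_add (M : Submodule (O n) (Fin (p + 1) → O n)) :
    colength M =
      idealColength (M.comap (LinearMap.single (O n) (fun _ : Fin (p + 1) => O n) 0)) +
        colength (M.map (LinearMap.funLeft (O n) (O n) (Fin.succ : Fin p → Fin (p + 1)))) := by
  have hle : M ≤ (M.map (LinearMap.funLeft (O n) (O n) (Fin.succ : Fin p → Fin (p + 1)))).comap
    (LinearMap.funLeft (O n) (O n) Fin.succ) := Submodule.le_comap_map _ _
  have hsurj : Function.Surjective
      (LinearMap.funLeft (O n) (O n) (Fin.succ : Fin p → Fin (p + 1))) :=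
    LinearMap.funLeft_surjective_of_injective _ _ _ (Fin.succ_injective p)
  refine cdim_eq_add_of_exact
    ((Submodule.mapQ _ M (LinearMap.single (O n) (fun _ : Fin (p + 1) => O n) 0)
      le_rfl).restrictScalars ℂ)
    ((Submodule.mapQ M _ (LinearMap.funLeft (O n) (O n) Fin.succ) hle).restrictScalars ℂ) ?_ ?_ ?_
  · refine (injective_iff_map_eq_zero _).2 fun z hz => ?_
    obtain ⟨z, rfl⟩ := Submodule.Quotient.mk_surjective _ z
    exact (Submodule.Quotient.mk_eq_zero _).2 ((Submodule.Quotient.mk_eq_zero M).1 hz)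
  · intro y
    obtain ⟨y, rfl⟩ := Submodule.Quotient.mk_surjective _ y
    obtain ⟨x, rfl⟩ := hsurj y
    exact ⟨Submodule.Quotient.mk x, rfl⟩
  · intro y
    obtain ⟨y, rfl⟩ := Submodule.Quotient.mk_surjective _ y
    constructor
    · intro hy
      obtain ⟨z, hz, hzy⟩ := (Submodule.Quotient.mk_eq_zero _).1 hy
      -- z in M has the same last p components as y, so y - z is concentrated in the first summand.
      refine ⟨Submodule.Quotient.mk (y 0 - z 0), ?_⟩
      refine (Submodule.Quotient.eq M).2 ?_
      have h1 : LinearMap.single (O n) (fun _ : Fin (p + 1) => O n) 0 (y 0 - z 0) = y - z := by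
        ext i
        refine Fin.cases ?_ (fun i => ?_) i
        · simp
        · have := congrFun hzy i
          simp only [LinearMap.funLeft_apply] at this
          simp [this]
      rw [h1, sub_sub_cancel_left]
      exact M.neg_mem hz
    · rintro ⟨z, hz⟩
      obtain ⟨z, rfl⟩ := Submodule.Quotient.mk_surjective _ z
      rw [← hz]
      refine (Submodule.Quotient.mk_eq_zero _).2 ?_
      have h1 : LinearMap.funLeft (O n) (O n) (Fin.succ : Fin p → Fin (p + 1))
          (LinearMap.single (O n) (fun _ : Fin (p + 1) => O n) 0 z) = 0 := by
        ext i
        simp [LinearMap.funLeft_apply]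
      rw [h1]
      exact zero_mem _

theorem mem_idealPow {I : Ideal (O n)} {x : Fin p → O n} : x ∈ idealPow I p ↔ ∀ i, x i ∈ I := by
  simp [idealPow, Submodule.mem_pi]

theorem idealPow_eq_smul_top (I : Ideal (O n)) (p : ℕ) : idealPow I p = I • ⊤ := by
  refine le_antisymm (fun x hx => ?_) (Submodule.smul_le.2 fun a ha x _ => ?_)
  · rw [mem_idealPow] at hx
    have h1 : x = ∑ i, x i • (Pi.single i 1 : Fin p → O n) := by
      ext j
      simp [Finset.sum_apply, Pi.single_apply]
    rw [h1]
    exact Submodule.sum_mem _ fun i _ => Submodule.smul_mem_smul (hx i) trivial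
  · exact mem_idealPow.2 fun i => I.mul_mem_right _ ha

theorem mem_directSum {N : Ideal (O n)} {M : Submodule (O n) (Fin p → O n)}
    {x : Fin (p + 1) → O n} : x ∈ directSum N M ↔ x 0 ∈ N ∧ (fun i : Fin p => x i.succ) ∈ M :=
  Iff.rfl

theorem mem_jacobianModule {s : ℕ} {g : Fin s → O n} {x : Fin s → O n} :
    x ∈ jacobianModule g ↔ ∃ δ : Fin n → O n, x = fun i => der δ (g i) := by
  rw [jacobianModule, Submodule.mem_span_range_iff_exists_fun]
  refine exists_congr fun δ => ?_
  rw [eq_comm]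
  have : ∑ j, δ j • (fun i => pderiv j (g i)) = fun i => der δ (g i) := by
    ext i
    simp [der, Finset.sum_apply]
  rw [this]

theorem der_mul (δ : Fin n → O n) (a b : O n) : der δ (a * b) = a * der δ b + b * der δ a := by
  simp only [der, ← pd_apply, Derivation.leibniz, smul_eq_mul, Finset.mul_sum,
    ← Finset.sum_add_distrib]
  exact Finset.sum_congr rfl fun j _ => by ring

theorem der_sum {κ : Type*} (δ : Fin n → O n) (s : Finset κ) (a : κ → O n) :
    der δ (∑ k ∈ s, a k) = ∑ k ∈ s, der δ (a k) := by
  simp only [der, ← pd_apply, map_sum, Finset.mul_sum]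
  exact Finset.sum_comm

/-- Since I(X) = I, the Leibniz rule reduces the condition to the generators of I. -/
theorem IsICIS.mem_logDer_iff {h : Fin p → O n} (hh : IsICIS h) (hpn : p < n) {δ : Fin n → O n} :
    δ ∈ logDer (zeroSet h) ↔ ∀ i, der δ (h i) ∈ componentIdeal h := by
  have h1 : δ ∈ logDer (zeroSet h) ↔
      ∀ g ∈ vanishingIdeal (zeroSet h), der δ g ∈ vanishingIdeal (zeroSet h) := Iff.rfl
  rw [h1, hh.vanishingIdeal_eq hpn]
  refine ⟨fun h2 i => h2 _ (Ideal.subset_span ⟨i, rfl⟩), fun h2 g hg => ?_⟩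
  obtain ⟨c, rfl⟩ := Ideal.mem_span_range_iff_exists_fun.1 hg
  rw [der_sum]
  refine Ideal.sum_mem _ fun i _ => ?_
  rw [der_mul]
  exact Ideal.add_mem _ (Ideal.mul_mem_left _ _ (h2 i))
    (Ideal.mul_mem_right _ _ (Ideal.subset_span ⟨i, rfl⟩))

/-- The projection forgets f and N, which is why the same τ(h) occurs in all four formulas. -/
theorem map_pairModule (f : O n) (h : Fin p → O n) (N : Ideal (O n)) :
    (pairModule f h N).map (LinearMap.funLeft (O n) (O n) (Fin.succ : Fin p → Fin (p + 1))) =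
      jacobianModule h ⊔ componentIdeal h • ⊤ := by
  rw [pairModule, Submodule.map_sup]
  congr 1
  · rw [jacobianModule, Submodule.map_span, ← Set.range_comp]
    rfl
  · rw [← idealPow_eq_smul_top]
    refine le_antisymm ?_ fun x hx => ?_
    · rintro _ ⟨x, hx, rfl⟩
      exact hx.2
    · refine ⟨Fin.cons 0 x, mem_directSum.2 ⟨N.zero_mem, ?_⟩, ?_⟩
      · simpa using hx
      · ext i
        simp [LinearMap.funLeft_apply]

/-- An element (x, 0) of the module is (δf, δh) + (u, v) with u in N and v in I^p. The last p
components say that δh has entries in I, that is, δ is logarithmic. -/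
theorem IsICIS.comap_pairModule {h : Fin p → O n} (hh : IsICIS h) (hpn : p < n) (f : O n)
    (N : Ideal (O n)) :
    (pairModule f h N).comap (LinearMap.single (O n) (fun _ : Fin (p + 1) => O n) 0) =
      logIdeal (zeroSet h) f ⊔ N := by
  refine le_antisymm (fun x hx => ?_) (sup_le (Ideal.span_le.2 ?_) fun x hx => ?_)
  · obtain ⟨w, hw, u, hu, hwu⟩ := Submodule.mem_sup.1 (Submodule.mem_comap.1 hx)
    obtain ⟨δ, rfl⟩ := mem_jacobianModule.1 hw
    obtain ⟨hu0, hu1⟩ := mem_directSum.1 hu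
    rw [mem_idealPow] at hu1
    have h0 : der δ f + u 0 = x := by simpa using congrFun hwu 0
    have hs : ∀ i : Fin p, der δ (h i) + u i.succ = 0 := fun i => by
      simpa using congrFun hwu i.succ
    rw [← h0]
    refine Submodule.add_mem_sup (Ideal.subset_span ⟨δ, ?_, rfl⟩) hu0
    refine (hh.mem_logDer_iff hpn).2 fun i => ?_
    rw [eq_neg_of_add_eq_zero_left (hs i)]
    exact Ideal.neg_mem_iff _ |>.2 (hu1 i)
  · rintro _ ⟨δ, hδ, rfl⟩
    have h1 : (fun i => der δ ((Fin.cons f h : Fin (p + 1) → O n) i)) ∈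
        jacobianModule (Fin.cons f h : Fin (p + 1) → O n) := mem_jacobianModule.2 ⟨δ, rfl⟩
    have h2 : (Fin.cons 0 fun i => - der δ (h i) : Fin (p + 1) → O n) ∈
        directSum N (idealPow (componentIdeal h) p) := by
      refine mem_directSum.2 ⟨N.zero_mem, mem_idealPow.2 fun i => ?_⟩
      rw [Fin.cons_succ]
      exact Ideal.neg_mem_iff _ |>.2 ((hh.mem_logDer_iff hpn).1 hδ i)
    have h3 := Submodule.add_mem_sup h1 h2
    refine Submodule.mem_comap.2 ?_
    refine (congrArg (· ∈ pairModule f h N) ?_).mpr h3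
    ext i
    refine Fin.cases ?_ (fun i => ?_) i <;> simp
  · refine Submodule.mem_comap.2 (Submodule.mem_sup_right (mem_directSum.2 ⟨?_, ?_⟩))
    · simpa using hx
    · refine mem_idealPow.2 fun i => ?_
      simp

/-- The relative version of the formula for the Bruce-Roberts number. -/
theorem IsICIS.idealColength_add_tjurina {h : Fin p → O n} (hh : IsICIS h) (hpn : p < n) (f : O n)
    (N : Ideal (O n)) :
    idealColength (logIdeal (zeroSet h) f ⊔ N) + tjurina h = colength (pairModule f h N) := by
  rw [colength_eq_add, map_pairModule, hh.comap_pairModule hpn]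
  rfl

/-- Cramer's rule. -/
theorem minorIdeal_smul_le (h : Fin p → O n) :
    minorIdeal h • (⊤ : Submodule (O n) (Fin p → O n)) ≤ jacobianModule h := by
  refine Submodule.smul_le.2 fun a ha x _ => ?_
  refine Submodule.span_induction (p := fun a _ => a • x ∈ jacobianModule h) ?_ ?_ ?_ ?_ ha
  · rintro _ ⟨e, rfl⟩
    set M := Matrix.of fun i j : Fin p => pderiv (e j) (h i) with hM
    have h1 : M.det • x = ∑ j, (M.adjugate.mulVec x) j • fun i => pderiv (e j) (h i) := by
      have h2 : M.mulVec (M.adjugate.mulVec x) = M.det • x := by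
        rw [Matrix.mulVec_mulVec, Matrix.mul_adjugate, Matrix.smul_mulVec, Matrix.one_mulVec]
      rw [← h2]
      ext i
      simp only [Matrix.mulVec, dotProduct, Finset.sum_apply, Pi.smul_apply, smul_eq_mul]
      exact Finset.sum_congr rfl fun j _ => mul_comm _ _
    rw [h1]
    exact Submodule.sum_mem _ fun j _ => Submodule.smul_mem _ _ (Submodule.subset_span ⟨e j, rfl⟩)
  · rw [zero_smul]; exact zero_mem _
  · intro a b _ _ ha hb
    rw [add_smul]; exact add_mem ha hb
  · intro c a _ ha
    rw [smul_assoc]; exact Submodule.smul_mem _ c ha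

/-- By Cramer's rule D(h) + I𝒪ₙᵖ contains p copies of the ideal I + (minors), which has finite
colength. -/
theorem IsICIS.tjurina_lt_top {h : Fin p → O n} (hh : IsICIS h) : tjurina h < ⊤ := by
  have h1 : idealPow (componentIdeal h ⊔ minorIdeal h) p ≤
      jacobianModule h ⊔ componentIdeal h • ⊤ := by
    rw [idealPow_eq_smul_top, Submodule.sup_smul, sup_comm]
    exact sup_le_sup_right (minorIdeal_smul_le h) _
  have h2 : Module.Finite ℂ (O n ⧸ (componentIdeal h ⊔ minorIdeal h)) :=
    cdim_lt_top_iff.1 hh.finite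
  have h3 : Module.Finite ℂ ((Fin p → O n) ⧸ idealPow (componentIdeal h ⊔ minorIdeal h) p) :=
    Module.Finite.equiv ((Submodule.quotientPi fun _ : Fin p =>
      componentIdeal h ⊔ minorIdeal h).restrictScalars ℂ).symm
  refine cdim_lt_top_iff.2 ?_
  exact Module.Finite.of_surjective ((Submodule.factor h1).restrictScalars ℂ)
    (Submodule.factor_surjective h1)

theorem pairModule_mono (f : O n) (h : Fin p → O n) {N N' : Ideal (O n)} (hN : N ≤ N') :
    pairModule f h N ≤ pairModule f h N' :=
  sup_le_sup_left (fun _ hx => ⟨hN hx.1, hx.2⟩) _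

end BruceRoberts

end

/-! ### The four formulas and their differences. -/

open BruceRoberts in
theorem corollary2p9 {n p : ℕ} (hpn : p < n) (h : Fin p → O n) (hh : IsICIS h) (f : O n) :
    (muX (zeroSet h) f < ⊤ ↔ colength (pairModule f h 0) < ⊤) ∧
    (muX (zeroSet h) f < ⊤ →
      (tjurina h < ⊤ ∧ tauX (zeroSet h) f < ⊤ ∧ muXrel (zeroSet h) f < ⊤ ∧
        tauXrel (zeroSet h) f < ⊤) ∧
      muX (zeroSet h) f + tjurina h = colength (pairModule f h 0) ∧
      tauX (zeroSet h) f + tjurina h = colength (pairModule f h (Ideal.span {f})) ∧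
      muXrel (zeroSet h) f + tjurina h = colength (pairModule f h (componentIdeal h)) ∧
      tauXrel (zeroSet h) f + tjurina h =
        colength (pairModule f h (Ideal.span {f} ⊔ componentIdeal h)) ∧
      muX (zeroSet h) f = tauX (zeroSet h) f +
        relDim (pairModule f h (Ideal.span {f})) (pairModule f h 0) ∧
      muXrel (zeroSet h) f = tauXrel (zeroSet h) f +
        relDim (pairModule f h (Ideal.span {f} ⊔ componentIdeal h))
          (pairModule f h (componentIdeal h))) := by
  have ht := hh.tjurina_lt_top
  have e1 : muX (zeroSet h) f + tjurina h = colength (pairModule f h 0) := by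
    rw [← hh.idealColength_add_tjurina hpn, Ideal.zero_eq_bot, sup_bot_eq, muX]
  have e2 : tauX (zeroSet h) f + tjurina h = colength (pairModule f h (Ideal.span {f})) :=
    hh.idealColength_add_tjurina hpn f _
  have e3 : muXrel (zeroSet h) f + tjurina h = colength (pairModule f h (componentIdeal h)) := by
    rw [← hh.idealColength_add_tjurina hpn, muXrel, hh.vanishingIdeal_eq hpn]
  have e4 : tauXrel (zeroSet h) f + tjurina h =
      colength (pairModule f h (Ideal.span {f} ⊔ componentIdeal h)) := by
    rw [← hh.idealColength_add_tjurina hpn, tauXrel, hh.vanishingIdeal_eq hpn, sup_assoc]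
  -- All identities are kept additive in `ℕ∞`, where only the finite summand τ(h) is cancelled. They
  -- therefore hold without assuming μ_X(f) finite.
  have cancel : ∀ {a b c : ℕ∞}, a + tjurina h = b + tjurina h + c → a = b + c := by
    intro a b c h1
    rw [add_right_comm] at h1
    exact (WithTop.add_right_inj ht.ne).1 h1
  have r1 : muX (zeroSet h) f = tauX (zeroSet h) f +
      relDim (pairModule f h (Ideal.span {f})) (pairModule f h 0) := by
    refine cancel ?_
    rw [e1, e2]
    exact colength_eq_add_relDim (pairModule_mono f h bot_le)
  have r2 : muXrel (zeroSet h) f = tauXrel (zeroSet h) f +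
      relDim (pairModule f h (Ideal.span {f} ⊔ componentIdeal h))
        (pairModule f h (componentIdeal h)) := by
    refine cancel ?_
    rw [e3, e4]
    exact colength_eq_add_relDim (pairModule_mono f h le_sup_right)
  -- The same cancellation for N = 0 and N = I. It passes finiteness from μ_X to μ_X⁻, and `r2`
  -- passes it on to τ_X⁻.
  have r3 : muXrel (zeroSet h) f ≤ muX (zeroSet h) f := by
    refine le_of_le_of_eq le_self_add (cancel (a := muX (zeroSet h) f)
      (c := relDim (pairModule f h (componentIdeal h)) (pairModule f h 0)) ?_).symm
    rw [e1, e3]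
    exact colength_eq_add_relDim (pairModule_mono f h bot_le)
  refine ⟨?_, fun hmu => ⟨⟨ht, ?_, ?_, ?_⟩, e1, e2, e3, e4, r1, r2⟩⟩
  · rw [← e1, ENat.add_lt_top]
    exact ⟨fun h1 => ⟨h1, ht⟩, fun h1 => h1.1⟩
  · exact lt_of_le_of_lt (r1 ▸ le_self_add) hmu
  · exact lt_of_le_of_lt r3 hmu
  · exact lt_of_le_of_lt (le_trans (r2 ▸ le_self_add) r3) hmu
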